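/- **Setting.** Let $(X,m)$ be a Young tower: a probability space with a partition $(B_{i,j})_{i\in I,\,0\le j<\phi_i}$ into sets of positive measure ($I$ countable, $\phi_i\ge 1$) and a measure preserving map $T:X\to X$ such that $T$ is a measure preserving isomorphism from $B_{i,j}$ to $B_{i,j+1}$ for $j<\phi_i-1$ and an isomorphism from $B_{i,\phi_i-1}$ to $B=\bigcup_k B_{k,0}$, and such that the partition $\bigvee_{n\ge 0}T^{-n}(B_{i,j})$ separates points. Put $\phi=\phi_i$ on $B_{i,0}$ and $T_B=T^\phi:B\to B$. For $x,y\in X$ the separation time $s(x,y)$ is $0$ if $x,y$ lie in different blocks $B_{i,j}$, and $1+s(x',y')$ otherwise, where $x',y'$ are the next iterates of $x,y$ in $B$. Let $g_m$ be the inverse of the jacobian of $T_B$; it satisfies $|\log g_m(x)-\log g_m(y)|\le C\kappa^{s(x,y)}$ for all $i$ and $x,y\in B_{i,0}$, with some $\kappa\in(0,1)$ and $C>0$. The tower is assumed to be mixing, $\gcd(\phi_i)=1$, and $m\{x\in B:\phi(x)>n\}=O(n^{-\beta})$ with $\beta>2$. Write $C_\theta(Z)$ for the functions $u$ on $Z$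 with $|u(x)-u(y)|\le C\theta^{s(x,y)}$ for all $x,y \in Z$ and some $C$. Let $0<\tau<1$, let $f\in C_\tau(X)$ be real valued with $\int f\,dm=0$, and put $S_nf=\sum_{k=0}^{n-1}f\circ T^k$, $f_B(x)=\sum_{k=0}^{\phi(x)-1}f(T^kx)$ for $x\in B$, $E_B(u)=\frac1{m(B)}\int_B u\,dm$, $\hat T_Bu(x)=\sum_{T_By=x}g_m(y)u(y)$ and $R(1,t)u=\hat T_B(e^{itf_B}u)$. Let $0<\eta<\min(1/2,\beta-2)$ and $\nu=\tau^\eta$, and suppose that the distortion bound for $g_m$ holds with $\kappa=\nu$ (this is the case for $\eta$ small enough). The operators $R(1,t)$ are considered on the space $C_\nu(B)$ of complex valued functions. **Proposition.** Each $R(1,t)$, $t\in\mathbb R$, maps $C_\nu(B)$ to itself. There is $\sigma\ge 0$ such that $\frac1{\sqrt n}S_nf\to\mathcal N(0,\sigma^2)$ in distribution, and there is a unique $a\in C_\nu(B)$ with $\int_B a\,dm=0$ and $(I-\hat T_B)a=\hat T_Bf_B$, written $a=(I-\hat T_B)^{-1}\hat T_Bf_B$. Moreover there are $\varepsilon,\delta>0$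 such that, for $|t|<\delta$, $R(1,t)$ has exactly one eigenvalue $\lambda(1,t)$ on $C_\nu(B)$ with $|\lambda(1,t)-1|<\varepsilon$; it has the form $$\lambda(1,t)=1-\frac{\sigma^2}{2m(B)}L(t)$$ for a complex valued function $L$ with $L(t)\sim t^2$ as $t\to 0$, and $$\lambda(1,t)=E_B(e^{itf_B})-t^2E_B(af_B)+O(t^3)\qquad (t\to 0).$$ -/

import Mathlib

open MeasureTheory ProbabilityTheory Filter Topology Asymptotics
open scoped NNReal ENNReal

noncomputable section

/-- The combinatorial part of a Young tower: a space partitioned into blocks `B_{i,j}`, for `i ∈ I`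
and `j < φ i`, and a map `T` sending `B_{i,j}` bijectively to `B_{i,j+1}` when `j < φ i - 1` and
`B_{i, φ i - 1}` bijectively to the base `B = ⋃ i, B_{i,0}`. The partition is recorded by the column
`col x` and the level `lev x` of each point: `x ∈ B_{i,j}` means `col x = i` and `lev x = j`. -/
structure TowerMap (X I : Type*) where
  T : X → X
  φ : I → ℕ
  φ_pos : ∀ i, 0 < φ i
  col : X → I
  lev : X → ℕ
  lev_lt : ∀ x, lev x < φ (col x)
  bijOn_succ : ∀ i j, j + 1 < φ i →
    Set.BijOn T {x | col x = i ∧ lev x = j} {x | col x = i ∧ lev x = j + 1}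
  bijOn_top : ∀ i, Set.BijOn T {x | col x = i ∧ lev x = φ i - 1} {x | lev x = 0}

namespace TowerMap

variable {X I : Type*} (Y : TowerMap X I)

/-- The block `B_{i,j}`. -/
def block (i : I) (j : ℕ) : Set X := {x | Y.col x = i ∧ Y.lev x = j}

/-- The base `B`, the union of the `B_{i,0}`. -/
def base : Set X := {x | Y.lev x = 0}

/-- The next iterate in the base (at a positive time): `x ∈ B_{i,j}` is sent to
`T^(φ i - j) x`. -/
def next (x : X) : X := Y.T^[Y.φ (Y.col x) - Y.lev x] x

theorem next_mem_base (x : X) : Y.next x ∈ Y.base := by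
  obtain ⟨d, hd⟩ : ∃ d, d = Y.φ (Y.col x) - Y.lev x - 1 := ⟨_, rfl⟩
  have hx := Y.lev_lt x
  unfold next
  induction d generalizing x with
  | zero =>
    have h1 : Y.φ (Y.col x) - Y.lev x = 1 := by omega
    rw [h1]
    exact (Y.bijOn_top (Y.col x)).mapsTo ⟨rfl, by omega⟩
  | succ d ih =>
    have hT := (Y.bijOn_succ (Y.col x) (Y.lev x) (by omega)).mapsTo ⟨rfl, rfl⟩
    obtain ⟨hc, hl⟩ := hT
    have := ih (Y.T x) (by rw [hc, hl]; omega) (Y.lev_lt _)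
    rw [hc, hl] at this
    have e : Y.φ (Y.col x) - Y.lev x = (Y.φ (Y.col x) - (Y.lev x + 1)) + 1 := by omega
    rw [e, Function.iterate_succ_apply]
    exact this

/-- The induced map `T_B = T^φ : B → B`. -/
def TB (x : Y.base) : Y.base := ⟨Y.next x, Y.next_mem_base x⟩

/-- The separation time on the whole tower: the first `n` such that the `n`-th iterates of `x` and
`y` under `next` are in different blocks (`⊤` if there is none). It vanishes when `x` and `y` are in
different blocks, and is `1 + s (next x) (next y)` otherwise; on the base it is the
separation time under `T_B` with respect to the partition `(B_{i,0})`. -/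
def sep (x y : X) : ℕ∞ :=
  sInf {N : ℕ∞ | ∃ n : ℕ, N = n ∧ ¬ (Y.col (Y.next^[n] x) = Y.col (Y.next^[n] y) ∧
    Y.lev (Y.next^[n] x) = Y.lev (Y.next^[n] y))}

/-- `θ ^ s` for `s ∈ ℕ ∪ {∞}`, with `θ ^ ∞ = 0`. -/
def epow (θ : ℝ) : ℕ∞ → ℝ
  | ⊤ => 0
  | (n : ℕ) => θ ^ n

/-- `u ∈ C_θ(X)`. -/
def MemC (θ : ℝ) (u : X → ℝ) : Prop :=
  ∃ C : ℝ, 0 < C ∧ ∀ x y, |u x - u y| ≤ C * epow θ (Y.sep x y)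

/-- `u ∈ C_θ(B)`, for complex valued functions on the base. -/
def MemCBase (θ : ℝ) (u : Y.base → ℂ) : Prop :=
  ∃ C : ℝ, 0 < C ∧ ∀ x y : Y.base, ‖u x - u y‖ ≤ C * epow θ (Y.sep x y)

/-- The Birkhoff sum `S_n f`. -/
def birk (f : X → ℝ) (n : ℕ) (x : X) : ℝ := ∑ k ∈ Finset.range n, f (Y.T^[k] x)

/-- The induced function `f_B(x) = ∑_{k < φ(x)} f(T^k x)` on the base. -/
def fB (f : X → ℝ) (x : Y.base) : ℝ := Y.birk f (Y.φ (Y.col x)) x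

/-- Bounded distortion with constant `κ` for a function `g` on the base:
`|log g(x) - log g(y)| ≤ C κ ^ s(x,y)` for `x` and `y` in the same block `B_{i,0}`. -/
def BoundedDistortion (g : Y.base → ℝ) (κ : ℝ) : Prop :=
  ∃ C : ℝ, 0 < C ∧ ∀ x y : Y.base, Y.col x = Y.col y →
    |Real.log (g x) - Real.log (g y)| ≤ C * epow κ (Y.sep x y)

end TowerMap

/-- A Young tower on the probability space `(X, m)`. -/
structure YoungTower {X : Type*} [MeasurableSpace X] (m : Measure X) [IsProbabilityMeasure m]
    (I : Type*) [Countable I] extends TowerMap X I where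
  measurableSet_block : ∀ i j, MeasurableSet (toTowerMap.block i j)
  measure_block_pos : ∀ i j, j < φ i → 0 < m (toTowerMap.block i j)
  /-- `T` is measurable and preserves `m` (hence is nonsingular). -/
  measurePreserving : MeasurePreserving T m m
  /-- `T` is a measure preserving isomorphism between `B_{i,j}` and `B_{i,j+1}`. -/
  image_succ : ∀ i j, j + 1 < φ i → ∀ A ⊆ toTowerMap.block i j, MeasurableSet A →
    MeasurableSet (T '' A) ∧ m (T '' A) = m A
  /-- `T` is a (nonsingular) isomorphism between `B_{i, φ i - 1}` and `B`. -/
  image_top : ∀ i, ∀ A ⊆ toTowerMap.block i (φ i - 1), MeasurableSet A →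
    MeasurableSet (T '' A) ∧ (m (T '' A) = 0 ↔ m A = 0)
  /-- The inverse `g_m` of the jacobian of `T_B` with respect to `m`. Two functions that satisfy
  `g_pos`, `jacobian` and `distortion` are equal. -/
  g : toTowerMap.base → ℝ
  g_pos : ∀ x, 0 < g x
  /-- `m (T_B A) = ∫_A 1 / g_m dm` for `A ⊆ B_{i,0}`. -/
  jacobian : ∀ i, ∀ A : Set toTowerMap.base, (∀ x ∈ A, col x = i) → MeasurableSet A →
    m ((fun x => (toTowerMap.TB x : X)) '' A) =
      ∫⁻ x in A, ENNReal.ofReal (g x)⁻¹ ∂(m.comap Subtype.val)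
  distortion : ∃ κ : ℝ, 0 < κ ∧ κ < 1 ∧ toTowerMap.BoundedDistortion g κ
  /-- The partition `⋁_{n ≥ 0} T^{-n} (B_{i,j})` separates the points. -/
  separates : ∀ x y, (∀ n : ℕ, col (T^[n] x) = col (T^[n] y) ∧ lev (T^[n] x) = lev (T^[n] y)) →
    x = y

namespace YoungTower

variable {X I : Type*} [MeasurableSpace X] {m : Measure X} [IsProbabilityMeasure m] [Countable I]
  (Y : YoungTower m I)

/-- The tower is mixing: `gcd (φ_i) = 1`. -/
def Mixing : Prop := ∀ d : ℕ, (∀ i, d ∣ Y.φ i) → d = 1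

/-- The measure `m` restricted to the base `B`. -/
def mB : Measure Y.base := m.comap Subtype.val

/-- `E_B(u) = (1 / m(B)) ∫_B u dm`. -/
def EB (u : Y.base → ℂ) : ℂ := ((m.real Y.base)⁻¹ : ℝ) * ∫ x, u x ∂Y.mB

/-- The transfer operator of the induced map,
`T̂_B u(x) = ∑_{T_B y = x} g_m(y) u(y)`. -/
def transferB (u : Y.base → ℂ) (x : Y.base) : ℂ :=
  ∑' y : {y : Y.base // Y.TB y = x}, (Y.g y : ℂ) * u y

/-- The perturbed operator `R(1,t) u = T̂_B (e^{i t f_B} u)`. -/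
def R1 (f : X → ℝ) (t : ℝ) (u : Y.base → ℂ) : Y.base → ℂ :=
  Y.transferB (fun x => Complex.exp (Complex.I * t * Y.fB f x) * u x)

/-- `z` is an eigenvalue of `R(1,t)` acting on `C_θ(B)`. -/
def IsEigenvalue (θ : ℝ) (f : X → ℝ) (t : ℝ) (z : ℂ) : Prop :=
  ∃ u : Y.base → ℂ, Y.MemCBase θ u ∧ u ≠ 0 ∧ Y.R1 f t u = fun x => z * u x

/-- `a = (I - T̂_B)⁻¹ (T̂_B f_B)`, the inverse being taken on the functions of `C_θ(B)` with
vanishing integral: `a` is such a function and `(I - T̂_B) a = T̂_B f_B`. -/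
def IsResolventSolution (θ : ℝ) (f : X → ℝ) (a : Y.base → ℂ) : Prop :=
  Y.MemCBase θ a ∧ ∫ x, a x ∂Y.mB = 0 ∧
    ∀ x, a x - Y.transferB a x = Y.transferB (fun y => (Y.fB f y : ℂ)) x

end YoungTower

end

/-!
The proof perturbs the spectrum of the transfer operator `T̂_B` of the induced map, and then
transports the central limit theorem from the base to the tower.

The map `T_B` has full branches: it sends each block `B_{i,0}` bijectively to the base. With bounded
distortion, `T̂_B` therefore contracts a cone of positive Hölder functions, and its powers converge
exponentially fast on `C_ν(B)` to the projection `E_B` (`exists_norm_pow_transfer_sub_le`). So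
`I - T̂_B` is invertible on the functions of vanishing integral (`exists_resolvent`), which gives
`a`.

The tail bound gives a square integrable return time `φ` (`integrable_ret_sq`), and `f_B` and its
variation on each column are bounded by multiples of `φ` (`RetBound`). This is enough for
`R(1,t) = T̂_B + O(t)` in operator norm and `R(1,t) 1 = 1 + i t T̂_B f_B + O(t ^ 2)` in `C_ν(B)`.
For an eigenfunction normalized as `1 + w`, with `E_B w = 0`, the function `w` is the fixed point of
a contraction built from the resolvent (`exists_eigenvalue_perturbation`): this gives the eigenvalue
`λ(1,t)`, its uniqueness, and `w = i t a + O(t ^ 2)`. Taking `E_B` in the eigenvalue equation gives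
the expansion with error `O(t ^ 3)` (`norm_eigenvalue_sub_le`).

The function `ψ = f_B + a - a ∘ T_B` is annihilated by `T̂_B`, so that the `ψ ∘ T_B ^ k` are
orthogonal, and the expansion of the eigenvalue reads `λ(1,t) = 1 - V t ^ 2 / (2 m(B)) + o(t ^ 2)`
with `V = ∫_B ψ ^ 2` (`integral_martingalePart_sq`). The variance is `σ ^ 2 = V`. When `V = 0` the
function `ψ` vanishes identically, `e^{ita}` is an eigenfunction for the eigenvalue `1`, and hence
`λ(1,t) = 1` exactly for small `t`, as the form `1 - σ ^ 2 L(t) / (2 m(B))` requires.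

For the central limit theorem, powers of the eigenvalue give the limit of the characteristic
functions of the Birkhoff sums of `f_B` at time `p = ⌊m(B) N⌋` (`tendsto_integral_exp_birkB`). These
are the Birkhoff sums of `f` at the time `Φ_p` of the `p`-th return, and `Φ_p` is at distance
`O(√N)` of `N` in `L ^ 2`; the oscillation of the sums `S_n f` on a slightly longer window of times
is `o(√N)` on average, because `∫ |S_l f| = O(√l)` (`VarianceBound.norm_integral_exp_sub_le`).
Finally, the tower has the density `φ` over the base, and `∫_B u e^{itS_N f}` depends asymptotically
only on the integral of `u`: replacing `u` by `T̂_B u` changes nothing in the limit, and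
`T̂_B φ - 1 / m(B)` is of the form `u - T̂_B u` (`tendsto_integral_ret_mul_exp_sub`).
-/

noncomputable section

/-! ### Return map, inverse branches and separation time -/

namespace TowerMap

variable {X I : Type*} (Y : TowerMap X I)

theorem bijOn_iterate (i : I) (k : ℕ) (hk : k < Y.φ i) :
    Set.BijOn Y.T^[k] (Y.block i 0) (Y.block i k) := by
  induction k with
  | zero => exact Set.bijOn_id _
  | succ k ih =>
    rw [Function.iterate_succ']
    exact (Y.bijOn_succ i k hk).comp (ih (by omega))

theorem bijOn_return (i : I) : Set.BijOn Y.T^[Y.φ i] (Y.block i 0) Y.base := by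
  have hp := Y.φ_pos i
  have h := (Y.bijOn_top i).comp (Y.bijOn_iterate i (Y.φ i - 1) (by omega))
  rw [← Function.iterate_succ'] at h
  rwa [show (Y.φ i - 1).succ = Y.φ i by omega] at h

theorem mem_block_iterate (x : Y.base) (k : ℕ) (hk : k < Y.φ (Y.col x)) :
    Y.T^[k] (x : X) ∈ Y.block (Y.col x) k :=
  (Y.bijOn_iterate _ k hk).mapsTo ⟨rfl, x.2⟩

theorem next_eq (x : Y.base) : Y.next (x : X) = Y.T^[Y.φ (Y.col x)] (x : X) := by
  have h : Y.lev (x : X) = 0 := x.2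
  simp [next, h]

theorem coe_TB (x : Y.base) : (Y.TB x : X) = Y.T^[Y.φ (Y.col x)] (x : X) := Y.next_eq x

theorem next_iterate (x : Y.base) (k : ℕ) (hk : k < Y.φ (Y.col x)) :
    Y.next (Y.T^[k] (x : X)) = Y.next (x : X) := by
  obtain ⟨h1, h2⟩ := Y.mem_block_iterate x k hk
  rw [Y.next_eq, next, h1, h2, ← Function.iterate_add_apply]
  congr 1
  omega

/-- Each column of the base is mapped bijectively onto the base by the return map. -/
theorem existsUnique_branch (i : I) (x : Y.base) : ∃! y : Y.base, Y.col y = i ∧ Y.TB y = x := by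
  obtain ⟨y, hy, hyx⟩ := (Y.bijOn_return i).surjOn x.2
  refine ⟨⟨y, hy.2⟩, ⟨hy.1, Subtype.ext ?_⟩, ?_⟩
  · rw [coe_TB]; dsimp only; rw [hy.1, hyx]
  · rintro z ⟨hz, hzx⟩
    refine Subtype.ext ((Y.bijOn_return i).injOn ⟨hz, z.2⟩ hy ?_)
    rw [hyx, ← hzx, coe_TB, hz]

/-- The inverse branch of the return map `T_B` with values in `B_{i,0}`. -/
def branch (i : I) (x : Y.base) : Y.base := (Y.existsUnique_branch i x).choose

@[simp] theorem col_branch (i : I) (x : Y.base) : Y.col (Y.branch i x) = i :=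
  (Y.existsUnique_branch i x).choose_spec.1.1

@[simp] theorem TB_branch (i : I) (x : Y.base) : Y.TB (Y.branch i x) = x :=
  (Y.existsUnique_branch i x).choose_spec.1.2

theorem branch_TB {i : I} {y : Y.base} (h : Y.col y = i) : Y.branch i (Y.TB y) = y :=
  ((Y.existsUnique_branch i (Y.TB y)).choose_spec.2 y ⟨h, rfl⟩).symm

/-- The fibres of the return map are indexed by the columns. -/
def fibreEquiv (x : Y.base) : I ≃ {y : Y.base // Y.TB y = x} where
  toFun i := ⟨Y.branch i x, Y.TB_branch i x⟩
  invFun y := Y.col y.1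
  left_inv i := by simp
  right_inv y := by
    obtain ⟨y, rfl⟩ := y
    exact Subtype.ext (Y.branch_TB rfl)

/-- `x` and `y` are in the same block. -/
def SameBlock (x y : X) : Prop := Y.col x = Y.col y ∧ Y.lev x = Y.lev y

theorem natCast_le_sep {x y : X} {n : ℕ} :
    (n : ℕ∞) ≤ Y.sep x y ↔ ∀ k < n, Y.SameBlock (Y.next^[k] x) (Y.next^[k] y) := by
  unfold sep
  rw [le_sInf_iff]
  constructor
  · intro h k hk
    by_contra hc
    have := h k ⟨k, rfl, hc⟩
    exact absurd (Nat.cast_le.1 this) (by omega)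
  · rintro h _ ⟨k, rfl, hk⟩
    by_contra hc
    exact hk (h k (by exact_mod_cast not_le.1 hc))

theorem sep_of_sameBlock {x y : X} (h : Y.SameBlock x y) :
    Y.sep x y = Y.sep (Y.next x) (Y.next y) + 1 := by
  have key : ∀ n : ℕ, ((n + 1 : ℕ) : ℕ∞) ≤ Y.sep x y ↔
      (n : ℕ∞) ≤ Y.sep (Y.next x) (Y.next y) := by
    intro n
    rw [natCast_le_sep, natCast_le_sep]
    constructor
    · intro H k hk
      simpa [Function.iterate_succ_apply] using H (k + 1) (by omega)
    · intro H k hk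
      cases k with
      | zero => exact h
      | succ k => simpa [Function.iterate_succ_apply] using H k (by omega)
  refine ENat.eq_of_forall_natCast_le_iff fun n => ?_
  cases n with
  | zero => simp
  | succ n =>
    rw [key]
    push_cast
    exact (ENat.add_le_add_iff_right (by simp)).symm

theorem sep_comm (x y : X) : Y.sep x y = Y.sep y x := by
  unfold sep
  simp only [eq_comm]

theorem sameBlock_base {x y : Y.base} : Y.SameBlock (x : X) y ↔ Y.col x = Y.col y := by
  have hx : Y.lev (x : X) = 0 := x.2
  have hy : Y.lev (y : X) = 0 := y.2
  simp [SameBlock, hx, hy]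

section epow

variable {θ : ℝ}

theorem epow_nonneg (h : 0 ≤ θ) (n : ℕ∞) : 0 ≤ epow θ n := by
  cases n with
  | top => exact le_rfl
  | coe n => exact pow_nonneg h n

theorem epow_le_one (h : 0 ≤ θ) (h1 : θ ≤ 1) (n : ℕ∞) : epow θ n ≤ 1 := by
  cases n with
  | top => exact zero_le_one
  | coe n => exact pow_le_one₀ h h1

theorem epow_add_one (n : ℕ∞) : epow θ (n + 1) = θ * epow θ n := by
  cases n with
  | top => exact (mul_zero θ).symm
  | coe n => exact pow_succ' θ n

theorem epow_mono {θ' : ℝ} (h : 0 ≤ θ) (h' : θ ≤ θ') (n : ℕ∞) : epow θ n ≤ epow θ' n := by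
  cases n with
  | top => exact le_rfl
  | coe n => exact pow_le_pow_left₀ h h' n

theorem epow_le_pow (h : 0 ≤ θ) (h1 : θ ≤ 1) {n : ℕ∞} {k : ℕ} (hk : (k : ℕ∞) ≤ n) :
    epow θ n ≤ θ ^ k := by
  cases n with
  | top => exact pow_nonneg h k
  | coe n => exact pow_le_pow_of_le_one h h1 (by exact_mod_cast hk)

end epow

/-- The separation distance `θ ^ s(x,y)` on the base. -/
def dB (θ : ℝ) (x y : Y.base) : ℝ := epow θ (Y.sep x y)

variable {θ : ℝ}

theorem dB_nonneg (h : 0 ≤ θ) (x y : Y.base) : 0 ≤ Y.dB θ x y := epow_nonneg h _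

theorem dB_le_one (h : 0 ≤ θ) (h1 : θ ≤ 1) (x y : Y.base) : Y.dB θ x y ≤ 1 := epow_le_one h h1 _

theorem dB_comm (x y : Y.base) : Y.dB θ x y = Y.dB θ y x := by
  unfold dB; rw [Y.sep_comm]

/-- The return map expands distances by the factor `1 / θ` within a column. -/
theorem dB_of_col_eq {x y : Y.base} (h : Y.col x = Y.col y) :
    Y.dB θ x y = θ * Y.dB θ (Y.TB x) (Y.TB y) := by
  unfold dB
  rw [Y.sep_of_sameBlock (Y.sameBlock_base.2 h), epow_add_one]
  rfl

theorem dB_branch (i : I) (x y : Y.base) :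
    Y.dB θ (Y.branch i x) (Y.branch i y) = θ * Y.dB θ x y := by
  rw [Y.dB_of_col_eq (by simp)]; simp

/-- Points of the same column of the base keep their separation time while they climb the tower. -/
theorem sep_iterate {x y : Y.base} (h : Y.col x = Y.col y) {k : ℕ} (hk : k < Y.φ (Y.col x)) :
    Y.sep (Y.T^[k] (x : X)) (Y.T^[k] (y : X)) = Y.sep (x : X) y := by
  have hx := Y.mem_block_iterate x k hk
  have hy := Y.mem_block_iterate y k (h ▸ hk)
  rw [Y.sep_of_sameBlock (Y.sameBlock_base.2 h), Y.sep_of_sameBlock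
    ⟨hx.1.trans (h.trans hy.1.symm), hx.2.trans hy.2.symm⟩, Y.next_iterate x k hk,
    Y.next_iterate y k (h ▸ hk)]

/-- The return time as a function on the base. -/
def ret (x : Y.base) : ℕ := Y.φ (Y.col x)

theorem ret_pos (x : Y.base) : 0 < Y.ret x := Y.φ_pos _

/-- The Birkhoff sums of a function on the base under the return map. -/
def birkB (F : Y.base → ℝ) (n : ℕ) (x : Y.base) : ℝ := ∑ k ∈ Finset.range n, F (Y.TB^[k] x)

/-- The time `Φ_n` of the `n`-th return to the base. -/
def retSum (n : ℕ) (x : Y.base) : ℕ := ∑ k ∈ Finset.range n, Y.ret (Y.TB^[k] x)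

theorem birkB_succ (F : Y.base → ℝ) (n : ℕ) (x : Y.base) :
    Y.birkB F (n + 1) x = F x + Y.birkB F n (Y.TB x) := by
  unfold birkB
  rw [Finset.sum_range_succ']
  simp [Function.iterate_succ_apply, add_comm]

theorem retSum_succ (n : ℕ) (x : Y.base) :
    Y.retSum (n + 1) x = Y.ret x + Y.retSum n (Y.TB x) := by
  unfold retSum
  rw [Finset.sum_range_succ']
  simp [Function.iterate_succ_apply, add_comm]

theorem birk_add (f : X → ℝ) (n k : ℕ) (x : X) :
    Y.birk f (n + k) x = Y.birk f n x + Y.birk f k (Y.T^[n] x) := by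
  unfold birk
  rw [Finset.sum_range_add]
  congr 1
  refine Finset.sum_congr rfl fun j _ => ?_
  rw [← Function.iterate_add_apply, add_comm]

/-- The Birkhoff sum of `f` up to the time of the `n`-th return is the `n`-th Birkhoff sum of `f_B`
for the return map. -/
theorem birk_retSum (f : X → ℝ) (n : ℕ) (x : Y.base) :
    Y.birk f (Y.retSum n x) x = Y.birkB (Y.fB f) n x := by
  induction n generalizing x with
  | zero => simp [birk, birkB, retSum]
  | succ n ih =>
    rw [retSum_succ, birk_add, birkB_succ, ← ih, coe_TB]; rfl

theorem abs_birk_le {f : X → ℝ} {M : ℝ} (hM : ∀ x, |f x| ≤ M) (n : ℕ) (x : X) :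
    |Y.birk f n x| ≤ n * M := by
  unfold birk
  refine (Finset.abs_sum_le_sum_abs _ _).trans ?_
  simpa using Finset.sum_le_sum (s := Finset.range n) fun k _ => hM (Y.T^[k] x)

/-- The difference `S_n f ∘ T^k - S_n f` telescopes to two sums of `k` terms: the bound does not
depend on `n`. -/
theorem abs_birk_iterate_sub_le {f : X → ℝ} {M : ℝ} (hM : ∀ x, |f x| ≤ M) (n k : ℕ) (x : X) :
    |Y.birk f n (Y.T^[k] x) - Y.birk f n x| ≤ 2 * k * M := by
  have h1 := Y.birk_add f n k x
  have h2 := Y.birk_add f k n x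
  rw [add_comm k n] at h2
  have e : Y.birk f n (Y.T^[k] x) - Y.birk f n x =
      Y.birk f k (Y.T^[n] x) - Y.birk f k x := by linarith
  rw [e]
  have := abs_sub (Y.birk f k (Y.T^[n] x)) (Y.birk f k x)
  have h3 := Y.abs_birk_le hM k (Y.T^[n] x)
  have h4 := Y.abs_birk_le hM k x
  linarith

theorem abs_birk_sub_birk_le {f : X → ℝ} {M : ℝ} (hM : ∀ x, |f x| ≤ M) (n k : ℕ) (x : X) :
    |Y.birk f n x - Y.birk f k x| ≤ |(n : ℝ) - k| * M := by
  wlog h : k ≤ n generalizing n k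
  · rw [abs_sub_comm, abs_sub_comm (n : ℝ)]; exact this k n (by omega)
  obtain ⟨j, rfl⟩ := Nat.exists_eq_add_of_le h
  rw [birk_add]
  have := Y.abs_birk_le hM j (Y.T^[k] x)
  push_cast
  rw [add_sub_cancel_left, add_sub_cancel_left, abs_of_nonneg (by positivity : (0 : ℝ) ≤ j)]
  exact this

theorem abs_fB_le {f : X → ℝ} {M : ℝ} (hM : ∀ x, |f x| ≤ M) (x : Y.base) :
    |Y.fB f x| ≤ M * Y.ret x := by
  have := Y.abs_birk_le hM (Y.φ (Y.col x)) x
  rw [mul_comm]; exact this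

theorem abs_fB_sub_le {f : X → ℝ} {C : ℝ} (hC : ∀ x y, |f x - f y| ≤ C * epow θ (Y.sep x y))
    {x y : Y.base} (h : Y.col x = Y.col y) :
    |Y.fB f x - Y.fB f y| ≤ C * Y.ret x * Y.dB θ x y := by
  unfold fB birk
  rw [← h, ← Finset.sum_sub_distrib]
  refine (Finset.abs_sum_le_sum_abs _ _).trans ?_
  have : ∀ k ∈ Finset.range (Y.φ (Y.col x)),
      |f (Y.T^[k] (x : X)) - f (Y.T^[k] (y : X))| ≤ C * Y.dB θ x y := by
    intro k hk
    have := hC (Y.T^[k] (x : X)) (Y.T^[k] (y : X))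
    rwa [Y.sep_iterate h (Finset.mem_range.1 hk)] at this
  refine (Finset.sum_le_sum this).trans (le_of_eq ?_)
  simp [ret]; ring

end TowerMap

/-! ### Measurability -/

/-- A function that agrees with a measurable function on each fibre of a countably valued measurable
map is measurable. -/
theorem measurable_of_countable_cover {Z K β : Type*} [MeasurableSpace Z] [MeasurableSpace β]
    [Countable K] {c : Z → K} (hc : ∀ k, MeasurableSet (c ⁻¹' {k})) {u : Z → β}
    (huv : ∀ z₀, ∃ v : Z → β, Measurable v ∧ ∀ z, c z = c z₀ → u z = v z) : Measurable u := by
  intro S hS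
  have : u ⁻¹' S = ⋃ k, c ⁻¹' {k} ∩ u ⁻¹' S := by
    ext z
    simp
  rw [this]
  refine MeasurableSet.iUnion fun k => ?_
  by_cases h : ∃ z₀, c z₀ = k
  · obtain ⟨z₀, rfl⟩ := h
    obtain ⟨v, hv, huv⟩ := huv z₀
    have : c ⁻¹' {c z₀} ∩ u ⁻¹' S = c ⁻¹' {c z₀} ∩ v ⁻¹' S := by
      ext z
      simp only [Set.mem_inter_iff, Set.mem_preimage, Set.mem_singleton_iff, and_congr_right_iff]
      intro hz
      rw [huv z hz]
    rw [this]
    exact (hc _).inter (hv hS)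
  · convert MeasurableSet.empty
    ext z
    simp only [Set.mem_inter_iff, Set.mem_preimage, Set.mem_singleton_iff,
      Set.mem_empty_iff_false, iff_false]
    exact fun hz => h ⟨z, hz.1⟩

/-- A function that is, near each point and up to `ε`, a function of a countably valued code is
measurable. -/
theorem measurable_of_code {Z β : Type*} [MeasurableSpace Z] [PseudoMetricSpace β]
    [MeasurableSpace β] [BorelSpace β] {K : ℕ → Type*} [∀ n, Countable (K n)]
    {c : ∀ n, Z → K n} (hc : ∀ n k, MeasurableSet (c n ⁻¹' {k})) {u : Z → β}
    (hu : ∀ z, ∀ ε > 0, ∃ N, ∀ n ≥ N, ∀ y, c n z = c n y → dist (u z) (u y) < ε) :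
    Measurable u := by
  have key : ∀ n, Measurable (fun z => u (⟨z, rfl⟩ : ∃ y, c n z = c n y).choose) := by
    intro n
    have cong : ∀ (k k' : K n) (h : ∃ y, k = c n y) (h' : ∃ y, k' = c n y), k = k' →
        u h.choose = u h'.choose := by
      rintro k _ h h' rfl; rfl
    refine measurable_of_countable_cover (hc n) fun z₀ =>
      ⟨fun _ => u (⟨z₀, rfl⟩ : ∃ y, c n z₀ = c n y).choose, measurable_const, fun z hz => ?_⟩
    exact cong _ _ _ _ hz
  refine measurable_of_tendsto_metrizable key ?_
  rw [tendsto_pi_nhds]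
  intro z
  rw [Metric.tendsto_atTop]
  intro ε hε
  obtain ⟨N, hN⟩ := hu z ε hε
  refine ⟨N, fun n hn => ?_⟩
  rw [dist_comm]
  exact hN n hn _ (⟨z, rfl⟩ : ∃ y, c n z = c n y).choose_spec

namespace YoungTower

open TowerMap

variable {X I : Type*} [MeasurableSpace X] {m : Measure X} [IsProbabilityMeasure m] [Countable I]
  (Y : YoungTower m I)

theorem measurable_iterate (n : ℕ) : Measurable Y.T^[n] := Y.measurePreserving.measurable.iterate n

theorem measurableSet_blockCode (k : I × ℕ) :
    MeasurableSet ((fun x => (Y.col x, Y.lev x)) ⁻¹' {k}) := by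
  convert Y.measurableSet_block k.1 k.2 using 1
  ext x
  simp [block, Prod.ext_iff]

theorem measurable_next : Measurable Y.next := by
  refine measurable_of_countable_cover Y.measurableSet_blockCode fun z₀ =>
    ⟨Y.T^[Y.φ (Y.col z₀) - Y.lev z₀], Y.measurable_iterate _, fun z hz => ?_⟩
  simp only [Prod.mk.injEq] at hz
  rw [next, hz.1, hz.2]

theorem base_eq_iUnion : Y.base = ⋃ i, Y.block i 0 := by
  ext x; simp [base, block]

theorem measurableSet_base : MeasurableSet Y.base := by
  rw [base_eq_iUnion]
  exact MeasurableSet.iUnion fun i => Y.measurableSet_block i 0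

theorem measurable_TB : Measurable Y.TB :=
  (Y.measurable_next.comp measurable_subtype_coe).subtype_mk

theorem measurableSet_colB (i : I) : MeasurableSet {x : Y.base | Y.col x = i} := by
  have : {x : Y.base | Y.col x = i} = Subtype.val ⁻¹' Y.block i 0 := by
    ext x
    have h : Y.lev (x : X) = 0 := x.2
    simp [block, h]
  rw [this]
  exact measurable_subtype_coe (Y.measurableSet_block i 0)

theorem measurable_comp_col {β : Type*} [MeasurableSpace β] (q : I → β) :
    Measurable (fun x : Y.base => q (Y.col x)) :=
  measurable_of_countable_cover (c := fun x : Y.base => Y.col x) Y.measurableSet_colB fun z₀ =>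
    ⟨fun _ => q (Y.col z₀), measurable_const, fun z hz => by rw [hz]⟩

theorem measurable_ret : Measurable Y.ret := Y.measurable_comp_col Y.φ

/-- The blocks visited by the first `n` iterates under `next`. -/
def code (n : ℕ) (x : X) : Fin n → I × ℕ := fun k => (Y.col (Y.next^[k] x), Y.lev (Y.next^[k] x))

theorem measurableSet_code (n : ℕ) (k : Fin n → I × ℕ) : MeasurableSet (Y.code n ⁻¹' {k}) := by
  have : Y.code n ⁻¹' {k} =
      ⋂ j : Fin n, Y.next^[j] ⁻¹' ((fun x => (Y.col x, Y.lev x)) ⁻¹' {k j}) := by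
    ext x
    simp [code, funext_iff]
  rw [this]
  exact MeasurableSet.iInter fun j => (Y.measurable_next.iterate j) (Y.measurableSet_blockCode _)

theorem le_sep_of_code_eq {n : ℕ} {x y : X} (h : Y.code n x = Y.code n y) :
    (n : ℕ∞) ≤ Y.sep x y := by
  rw [natCast_le_sep]
  intro k hk
  have := congrFun h ⟨k, hk⟩
  simp only [code, Prod.mk.injEq] at this
  exact this

theorem measurable_of_memC {θ : ℝ} (h0 : 0 ≤ θ) (h1 : θ < 1) {u : X → ℝ} (hu : Y.MemC θ u) :
    Measurable u := by
  obtain ⟨C, hC, hu⟩ := hu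
  refine measurable_of_code Y.measurableSet_code fun z ε hε => ?_
  have ht : Tendsto (fun n => C * θ ^ n) atTop (𝓝 0) := by
    simpa using (tendsto_pow_atTop_nhds_zero_of_lt_one h0 h1).const_mul C
  obtain ⟨N, hN⟩ := eventually_atTop.1 (ht.eventually (gt_mem_nhds hε))
  refine ⟨N, fun n hn y hy => ?_⟩
  rw [Real.dist_eq]
  exact ((hu z y).trans (mul_le_mul_of_nonneg_left
    (epow_le_pow h0 h1.le (Y.le_sep_of_code_eq hy)) hC.le)).trans_lt (hN n hn)

/-- Functions on the base that are continuous with respect to the separation time. -/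
def SepContinuous {β : Type*} [PseudoMetricSpace β] (u : Y.base → β) : Prop :=
  ∀ x : Y.base, ∀ ε > 0, ∃ N : ℕ, ∀ y : Y.base, (N : ℕ∞) ≤ Y.sep (x : X) y → dist (u x) (u y) < ε

theorem SepContinuous.measurable {β : Type*} [PseudoMetricSpace β] [MeasurableSpace β]
    [BorelSpace β] {u : Y.base → β} (hu : Y.SepContinuous u) : Measurable u := by
  refine measurable_of_code (c := fun n (x : Y.base) => Y.code n x)
    (fun n k => measurable_subtype_coe (Y.measurableSet_code n k)) fun z ε hε => ?_
  obtain ⟨N, hN⟩ := hu z ε hε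
  exact ⟨N, fun n hn y hy => hN y ((Nat.cast_le.2 hn).trans (Y.le_sep_of_code_eq hy))⟩

/-- A function that is Hölder continuous on each column, with a constant that may depend on the
column, is continuous. -/
theorem sepContinuous_of_col {β : Type*} [PseudoMetricSpace β] {θ : ℝ} (h0 : 0 ≤ θ) (h1 : θ < 1)
    {u : Y.base → β} {q : I → ℝ}
    (hu : ∀ x y : Y.base, Y.col x = Y.col y → dist (u x) (u y) ≤ q (Y.col x) * Y.dB θ x y) :
    Y.SepContinuous u := by
  intro x ε hε
  have ht : Tendsto (fun n => |q (Y.col x)| * θ ^ n) atTop (𝓝 0) := by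
    simpa using (tendsto_pow_atTop_nhds_zero_of_lt_one h0 h1).const_mul _
  obtain ⟨N, hN⟩ := eventually_atTop.1 (ht.eventually (gt_mem_nhds hε))
  refine ⟨N + 1, fun y hy => ?_⟩
  have hcol : Y.col x = Y.col y := (Y.natCast_le_sep.1 hy 0 (by omega)).1
  refine (hu x y hcol).trans_lt (lt_of_le_of_lt ?_ (hN (N + 1) (by omega)))
  exact mul_le_mul (le_abs_self _) (epow_le_pow h0 h1.le hy) (Y.dB_nonneg h0 _ _) (abs_nonneg _)

/-! ### The tower as a suspension of its base -/

instance : IsFiniteMeasure Y.mB := by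
  refine ⟨?_⟩
  rw [mB, comap_subtype_coe_apply Y.measurableSet_base]
  exact measure_lt_top m _

theorem mB_apply (A : Set Y.base) : Y.mB A = m (Subtype.val '' A) :=
  comap_subtype_coe_apply Y.measurableSet_base _ _

theorem mB_univ : Y.mB Set.univ = m Y.base := by
  rw [mB_apply]; simp

theorem mB_real_univ : Y.mB.real Set.univ = m.real Y.base := by
  simp [Measure.real, mB_univ]

theorem mB_col (i : I) : Y.mB {x : Y.base | Y.col x = i} = m (Y.block i 0) := by
  rw [mB_apply]
  congr 1
  ext x
  constructor
  · rintro ⟨y, hy, rfl⟩; exact ⟨hy, y.2⟩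
  · rintro ⟨h1, h2⟩; exact ⟨⟨x, h2⟩, h1, rfl⟩

theorem mB_col_pos (i : I) : 0 < Y.mB {x : Y.base | Y.col x = i} := by
  rw [mB_col]; exact Y.measure_block_pos i 0 (Y.φ_pos i)

theorem measure_base_pos : 0 < m.real Y.base := by
  obtain ⟨x⟩ : Nonempty X := nonempty_of_isProbabilityMeasure m
  refine ENNReal.toReal_pos ?_ (measure_ne_top _ _)
  rw [← mB_univ]
  exact ((Y.mB_col_pos (Y.col x)).trans_le (measure_mono (Set.subset_univ _))).ne'

theorem image_iterate (i : I) (k : ℕ) (hk : k < Y.φ i) (A : Set X) (hA : A ⊆ Y.block i 0)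
    (hm : MeasurableSet A) : MeasurableSet (Y.T^[k] '' A) ∧ m (Y.T^[k] '' A) = m A := by
  induction k with
  | zero => simpa using hm
  | succ k ih =>
    obtain ⟨h1, h2⟩ := ih (by omega)
    rw [Function.iterate_succ', Set.image_comp]
    have hs : Y.T^[k] '' A ⊆ Y.block i k :=
      (Set.image_mono hA).trans (Y.bijOn_iterate i k (by omega)).image_eq.subset
    obtain ⟨h3, h4⟩ := Y.image_succ i k hk _ hs h1
    exact ⟨h3, h4.trans h2⟩

theorem measurableSet_image_return (i : I) (A : Set X) (hA : A ⊆ Y.block i 0)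
    (hm : MeasurableSet A) : MeasurableSet (Y.T^[Y.φ i] '' A) := by
  have hp := Y.φ_pos i
  have h := Y.image_iterate i (Y.φ i - 1) (by omega) A hA hm
  have hs : Y.T^[Y.φ i - 1] '' A ⊆ Y.block i (Y.φ i - 1) :=
    (Set.image_mono hA).trans (Y.bijOn_iterate i _ (by omega)).image_eq.subset
  have := (Y.image_top i _ hs h.1).1
  rw [← Set.image_comp, ← Function.iterate_succ'] at this
  rwa [show (Y.φ i - 1).succ = Y.φ i by omega] at this

/-- The map `T^k` transports the measure of `B_{i,0}` to the measure of `B_{i,k}`. -/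
theorem map_iterate_restrict (i : I) (k : ℕ) (hk : k < Y.φ i) :
    (m.restrict (Y.block i 0)).map Y.T^[k] = m.restrict (Y.block i k) := by
  ext A hA
  rw [Measure.map_apply (Y.measurable_iterate k) hA,
    Measure.restrict_apply (Y.measurable_iterate k hA), Measure.restrict_apply hA]
  have h := Y.bijOn_iterate i k hk
  rw [← (Y.image_iterate i k hk (Y.T^[k] ⁻¹' A ∩ Y.block i 0) Set.inter_subset_right
    ((Y.measurable_iterate k hA).inter (Y.measurableSet_block i 0))).2,
    Set.image_preimage_inter, h.image_eq]

theorem iUnion_block : ⋃ p : I × ℕ, Y.block p.1 p.2 = Set.univ := by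
  ext x
  simp only [Set.mem_iUnion, Set.mem_univ, iff_true]
  exact ⟨(Y.col x, Y.lev x), rfl, rfl⟩

theorem disjoint_block : Pairwise (Function.onFun Disjoint fun p : I × ℕ => Y.block p.1 p.2) := by
  intro p q hpq
  rw [Function.onFun, Set.disjoint_left]
  rintro x ⟨h1, h2⟩ ⟨h3, h4⟩
  exact hpq (Prod.ext (h1.symm.trans h3) (h2.symm.trans h4))

theorem disjoint_block_zero : Pairwise (Function.onFun Disjoint fun i : I => Y.block i 0) := by
  intro i j hij
  rw [Function.onFun, Set.disjoint_left]
  rintro x ⟨h1, h2⟩ ⟨h3, h4⟩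
  exact hij (h1.symm.trans h3)

theorem block_eq_empty {i : I} {k : ℕ} (h : Y.φ i ≤ k) : Y.block i k = ∅ := by
  ext x
  simp only [block, Set.mem_ofPred_eq, Set.mem_empty_iff_false, iff_false]
  rintro ⟨rfl, rfl⟩
  exact absurd (Y.lev_lt x) (by omega)

/-- The integral over the tower of a nonnegative function is the integral over the base of its
sums along the columns. -/
theorem lintegral_tower {F : X → ℝ≥0∞} (hF : Measurable F) :
    ∫⁻ x, F x ∂m = ∫⁻ y : Y.base, ∑ k ∈ Finset.range (Y.ret y), F (Y.T^[k] y) ∂Y.mB := by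
  have h1 : ∫⁻ x, F x ∂m =
      ∑' i, ∑ k ∈ Finset.range (Y.φ i), ∫⁻ x in Y.block i 0, F (Y.T^[k] x) ∂m := by
    rw [← setLIntegral_univ, ← Y.iUnion_block, lintegral_iUnion
      (s := fun p : I × ℕ => Y.block p.1 p.2)
      (fun p => Y.measurableSet_block p.1 p.2) Y.disjoint_block, ENNReal.tsum_prod']
    refine tsum_congr fun i => ?_
    rw [tsum_eq_sum (s := Finset.range (Y.φ i))]
    · refine Finset.sum_congr rfl fun k hk => ?_
      rw [← Y.map_iterate_restrict i k (Finset.mem_range.1 hk),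
        lintegral_map hF (Y.measurable_iterate k)]
    · intro k hk
      rw [Y.block_eq_empty (by simpa using hk)]
      simp
  rw [h1]
  have h2 := lintegral_subtype_comap Y.measurableSet_base (μ := m)
    (fun x => ∑ k ∈ Finset.range (Y.φ (Y.col x)), F (Y.T^[k] x))
  change ∫⁻ y : Y.base, ∑ k ∈ Finset.range (Y.ret y), F (Y.T^[k] y) ∂Y.mB = _ at h2
  rw [h2, base_eq_iUnion, lintegral_iUnion (fun i => Y.measurableSet_block i 0)
    Y.disjoint_block_zero]
  refine tsum_congr fun i => ?_
  rw [← lintegral_finsetSum (f := fun k x => F (Y.T^[k] x)) _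
    fun k _ => hF.comp (Y.measurable_iterate k)]
  refine setLIntegral_congr_fun (Y.measurableSet_block i 0) fun x hx => ?_
  rw [hx.1]

/-- The return map preserves the measure of the base. -/
theorem measurePreserving_TB : MeasurePreserving Y.TB Y.mB Y.mB := by
  refine ⟨Y.measurable_TB, ?_⟩
  ext A hA
  rw [Measure.map_apply Y.measurable_TB hA]
  have hA' : MeasurableSet (Subtype.val '' A) := Y.measurableSet_base.subtype_image hA
  have hAB : Subtype.val '' A ⊆ Y.base := by rintro _ ⟨x, _, rfl⟩; exact x.2
  conv_rhs => rw [mB_apply, ← Y.measurePreserving.measure_preimage hA'.nullMeasurableSet,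
    ← lintegral_indicator_one (Y.measurePreserving.measurable hA'),
    Y.lintegral_tower (measurable_one.indicator (Y.measurePreserving.measurable hA'))]
  rw [← lintegral_indicator_one (Y.measurable_TB hA)]
  refine lintegral_congr fun y => ?_
  -- before the return time the orbit is outside the base
  have hp := Y.ret_pos y
  rw [show Y.ret y = (Y.ret y - 1) + 1 by omega, Finset.sum_range_succ, Finset.sum_eq_zero,
    zero_add]
  · have e : Y.T (Y.T^[Y.ret y - 1] (y : X)) = (Y.TB y : X) := by
      rw [← Function.iterate_succ_apply' Y.T, coe_TB,
        show (Y.ret y - 1).succ = Y.ret y by omega]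
      rfl
    have e2 : (y ∈ Y.TB ⁻¹' A) ↔ Y.T^[Y.ret y - 1] (y : X) ∈ Y.T ⁻¹' (Subtype.val '' A) := by
      rw [Set.mem_preimage, Set.mem_preimage, e]; simp
    by_cases h : y ∈ Y.TB ⁻¹' A
    · rw [Set.indicator_of_mem h, Set.indicator_of_mem (e2.1 h)]; rfl
    · rw [Set.indicator_of_notMem h, Set.indicator_of_notMem (mt e2.2 h)]
  · intro k hk
    rw [Finset.mem_range] at hk
    apply Set.indicator_of_notMem
    rw [Set.mem_preimage, ← Function.iterate_succ_apply' Y.T]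
    intro hc
    have h1 : Y.lev _ = 0 := hAB hc
    rw [(Y.mem_block_iterate y (k + 1) (by unfold ret at hk; omega)).2] at h1
    omega

theorem lintegral_ret : ∫⁻ y, (Y.ret y : ℝ≥0∞) ∂Y.mB = 1 := by
  have := Y.lintegral_tower (F := fun _ => 1) measurable_const
  simpa using this.symm

theorem integrable_ret : Integrable (fun y => (Y.ret y : ℝ)) Y.mB := by
  refine ⟨(measurable_from_nat.comp Y.measurable_ret).aestronglyMeasurable, ?_⟩
  rw [hasFiniteIntegral_iff_norm]
  have : ∫⁻ y, ENNReal.ofReal ‖(Y.ret y : ℝ)‖ ∂Y.mB = 1 := by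
    rw [← Y.lintegral_ret]; simp
  rw [this]; exact ENNReal.one_lt_top

theorem integral_ret : ∫ y, (Y.ret y : ℝ) ∂Y.mB = 1 := by
  rw [integral_eq_lintegral_of_nonneg_ae (ae_of_all _ fun y => by positivity)
    Y.integrable_ret.1]
  simp [Y.lintegral_ret]

theorem measurable_sum_ret {E : Type*} [NormedAddCommGroup E] [MeasurableSpace E] [BorelSpace E]
    [SecondCountableTopology E] {F : X → E} (hF : Measurable F) :
    Measurable fun y : Y.base => ∑ k ∈ Finset.range (Y.ret y), F (Y.T^[k] y) := by
  refine measurable_of_countable_cover (c := fun x : Y.base => Y.col x) Y.measurableSet_colB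
    fun z₀ => ⟨fun y => ∑ k ∈ Finset.range (Y.ret z₀), F (Y.T^[k] y),
      Finset.measurable_sum _ fun k _ => hF.comp
        ((Y.measurable_iterate k).comp measurable_subtype_coe), fun z hz => ?_⟩
  simp only [ret, hz]

/-- The integral over the tower of a bounded function is the integral over the base of its sums
along the columns. -/
theorem integral_tower {E : Type*} [NormedAddCommGroup E] [NormedSpace ℝ E] [MeasurableSpace E]
    [BorelSpace E] [SecondCountableTopology E] {F : X → E} (hF : Measurable F) {M : ℝ}
    (hM : ∀ x, ‖F x‖ ≤ M) :
    ∫ x, F x ∂m = ∫ y : Y.base, ∑ k ∈ Finset.range (Y.ret y), F (Y.T^[k] y) ∂Y.mB := by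
  have hFi : Integrable F m :=
    Integrable.of_bound hF.aestronglyMeasurable M (ae_of_all _ hM)
  have h1 : HasSum (fun i => ∑ k ∈ Finset.range (Y.φ i), ∫ x in Y.block i 0, F (Y.T^[k] x) ∂m)
      (∫ x, F x ∂m) := by
    have := hasSum_integral_iUnion (μ := m) (f := F) (s := fun p : I × ℕ => Y.block p.1 p.2)
      (fun p => Y.measurableSet_block p.1 p.2) Y.disjoint_block hFi.integrableOn
    rw [Y.iUnion_block, setIntegral_univ] at this
    refine this.prod_fiberwise fun i => ?_
    convert hasSum_sum_of_ne_finset_zero (L := .unconditional ℕ) (s := Finset.range (Y.φ i)) ?_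
      using 1
    · refine Finset.sum_congr rfl fun k hk => ?_
      simp only
      rw [← Y.map_iterate_restrict i k (Finset.mem_range.1 hk),
        integral_map (Y.measurable_iterate k).aemeasurable hF.aestronglyMeasurable]
    · intro k hk
      simp only
      rw [Y.block_eq_empty (by simpa using hk)]
      simp
  have hG : Integrable (fun y : Y.base => ∑ k ∈ Finset.range (Y.ret y), F (Y.T^[k] y)) Y.mB := by
    refine (Y.integrable_ret.mul_const M).mono' (Y.measurable_sum_ret hF).aestronglyMeasurable
      (ae_of_all _ fun y => ?_)
    refine (norm_sum_le _ _).trans ?_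
    simpa using Finset.sum_le_sum (s := Finset.range (Y.ret y)) fun k _ => hM (Y.T^[k] y)
  have h2 := integral_subtype_comap Y.measurableSet_base (μ := m)
    (fun x => ∑ k ∈ Finset.range (Y.φ (Y.col x)), F (Y.T^[k] x))
  change ∫ y : Y.base, ∑ k ∈ Finset.range (Y.ret y), F (Y.T^[k] y) ∂Y.mB = _ at h2
  rw [h2]
  have h3 : IntegrableOn (fun x => ∑ k ∈ Finset.range (Y.φ (Y.col x)), F (Y.T^[k] x)) Y.base m := by
    rw [IntegrableOn, ← map_comap_subtype_coe Y.measurableSet_base,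
      (MeasurableEmbedding.subtype_coe Y.measurableSet_base).integrable_map_iff]
    exact hG
  rw [base_eq_iUnion] at h3 ⊢
  refine h1.unique ?_
  have h4 := hasSum_integral_iUnion (fun i => Y.measurableSet_block i 0) Y.disjoint_block_zero h3
  convert h4 using 2 with i
  rw [← integral_finsetSum _ fun k _ => ?_]
  · refine setIntegral_congr_fun (Y.measurableSet_block i 0) fun x hx => ?_
    rw [hx.1]
  · exact (Integrable.of_bound (hF.comp (Y.measurable_iterate k)).aestronglyMeasurable M
      (ae_of_all _ fun x => hM _)).integrableOn

end YoungTower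

/-! ### The transfer operator of the return map -/

namespace YoungTower

open TowerMap

variable {X I : Type*} [MeasurableSpace X] {m : Measure X} [IsProbabilityMeasure m] [Countable I]
  (Y : YoungTower m I)

theorem measurable_g : Measurable Y.g := by
  obtain ⟨κ, h0, h1, C, hC, h⟩ := Y.distortion
  have : Y.SepContinuous (fun x => Real.log (Y.g x)) :=
    Y.sepContinuous_of_col h0.le h1 (q := fun _ => C) fun x y hxy => h x y hxy
  have := Real.measurable_exp.comp (SepContinuous.measurable Y this)
  convert this using 1
  ext x
  simp [Real.exp_log (Y.g_pos x)]

theorem transferB_eq_tsum (u : Y.base → ℂ) (x : Y.base) :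
    Y.transferB u x = ∑' i, (Y.g (Y.branch i x) : ℂ) * u (Y.branch i x) :=
  ((Y.fibreEquiv x).tsum_eq (fun y : {y : Y.base // Y.TB y = x} => (Y.g y : ℂ) * u y)).symm

theorem image_TB_col (i : I) (A : Set Y.base) :
    Y.TB '' (Y.TB ⁻¹' A ∩ {x | Y.col x = i}) = A := by
  ext x
  constructor
  · rintro ⟨y, ⟨hy, _⟩, rfl⟩; exact hy
  · intro hx
    exact ⟨Y.branch i x, ⟨by simpa using hx, by simp⟩, by simp⟩

/-- The return map transports the measure with density `1 / g_m` on the `i`-th column to the measure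
of the base. -/
theorem map_TB_withDensity (i : I) :
    ((Y.mB.restrict {x | Y.col x = i}).withDensity
      (fun x => ENNReal.ofReal (Y.g x)⁻¹)).map Y.TB = Y.mB := by
  ext A hA
  rw [Measure.map_apply Y.measurable_TB hA, withDensity_apply _ (Y.measurable_TB hA),
    Measure.restrict_restrict (Y.measurable_TB hA)]
  have := Y.jacobian i (Y.TB ⁻¹' A ∩ {x | Y.col x = i}) (fun x hx => hx.2)
    ((Y.measurable_TB hA).inter (Y.measurableSet_colB i))
  rw [mB, ← this, ← mB, mB_apply]
  rw [show (fun x => (Y.TB x : X)) = Subtype.val ∘ Y.TB from rfl, Set.image_comp, image_TB_col]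

theorem measurable_branch (i : I) : Measurable (Y.branch i) := by
  intro A hA
  have e : Y.branch i ⁻¹' A = Y.TB '' (A ∩ {x | Y.col x = i}) := by
    ext x
    constructor
    · intro hx
      exact ⟨Y.branch i x, ⟨hx, by simp⟩, by simp⟩
    · rintro ⟨y, ⟨hy, hi⟩, rfl⟩
      rw [Set.mem_preimage, Y.branch_TB hi]; exact hy
  have e2 : Y.TB '' (A ∩ {x | Y.col x = i}) =
      Subtype.val ⁻¹' (Y.T^[Y.φ i] '' (Subtype.val '' (A ∩ {x | Y.col x = i}))) := by
    ext x
    simp only [Set.mem_preimage, Set.mem_image]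
    constructor
    · rintro ⟨y, hy, rfl⟩
      exact ⟨y, ⟨y, hy, rfl⟩, by rw [coe_TB, hy.2]⟩
    · rintro ⟨_, ⟨y, hy, rfl⟩, hx⟩
      exact ⟨y, hy, Subtype.ext (by rw [coe_TB, hy.2, hx])⟩
  rw [e, e2]
  refine measurable_subtype_coe (Y.measurableSet_image_return i _ ?_
    (Y.measurableSet_base.subtype_image (hA.inter (Y.measurableSet_colB i))))
  rintro _ ⟨y, hy, rfl⟩
  exact ⟨hy.2, y.2⟩

theorem measurable_g_branch (i : I) : Measurable fun x => Y.g (Y.branch i x) :=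
  Y.measurable_g.comp (Y.measurable_branch i)

/-- The inverse branch `h_i` transports the measure with density `g_m ∘ h_i` to the measure of the
`i`-th column. -/
theorem map_branch_withDensity (i : I) :
    (Y.mB.withDensity (fun x => ENNReal.ofReal (Y.g (Y.branch i x)))).map (Y.branch i) =
      Y.mB.restrict {x | Y.col x = i} := by
  ext A hA
  have hB := Y.measurable_branch i hA
  rw [Measure.map_apply (Y.measurable_branch i) hA, withDensity_apply _ hB]
  conv_lhs => rw [← Y.map_TB_withDensity i]
  have hG : Measurable fun x => ENNReal.ofReal (Y.g (Y.branch i x)) :=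
    (Y.measurable_g_branch i).ennreal_ofReal
  rw [setLIntegral_map hB hG Y.measurable_TB,
    setLIntegral_withDensity_eq_setLIntegral_mul _ (f := fun x => ENNReal.ofReal (Y.g x)⁻¹)
      Y.measurable_g.inv.ennreal_ofReal (g := fun x => ENNReal.ofReal (Y.g (Y.branch i (Y.TB x))))
      (hG.comp Y.measurable_TB) (Y.measurable_TB hB),
    Measure.restrict_restrict (Y.measurable_TB hB), Measure.restrict_apply hA, ← setLIntegral_one]
  have e : Y.TB ⁻¹' (Y.branch i ⁻¹' A) ∩ {x | Y.col x = i} = A ∩ {x | Y.col x = i} := by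
    ext x
    simp only [Set.mem_inter_iff, Set.mem_preimage, Set.mem_ofPred_eq, and_congr_left_iff]
    intro hx
    rw [Y.branch_TB hx]
  rw [e]
  refine setLIntegral_congr_fun (hA.inter (Y.measurableSet_colB i)) fun x hx => ?_
  simp only [Pi.mul_apply]
  rw [Y.branch_TB hx.2, ← ENNReal.ofReal_mul (inv_nonneg.2 (Y.g_pos x).le),
    inv_mul_cancel₀ (Y.g_pos x).ne', ENNReal.ofReal_one]

theorem integrable_branch {E : Type*} [NormedAddCommGroup E] [NormedSpace ℝ E] {w : Y.base → E}
    (hw : Integrable w Y.mB) (i : I) :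
    Integrable (fun x => Y.g (Y.branch i x) • w (Y.branch i x)) Y.mB := by
  have h : Integrable w (Y.mB.restrict {x | Y.col x = i}) := hw.restrict
  rw [← Y.map_branch_withDensity i] at h
  have h2 := h.comp_measurable (Y.measurable_branch i)
  rw [integrable_withDensity_iff_integrable_smul'
    (Y.measurable_g_branch i).ennreal_ofReal (ae_of_all _ fun _ => ENNReal.ofReal_lt_top)] at h2
  refine h2.congr (ae_of_all _ fun x => ?_)
  simp [ENNReal.toReal_ofReal (Y.g_pos _).le]

theorem integral_branch {E : Type*} [NormedAddCommGroup E] [NormedSpace ℝ E] {w : Y.base → E}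
    (hw : Integrable w Y.mB) (i : I) :
    ∫ x, Y.g (Y.branch i x) • w (Y.branch i x) ∂Y.mB = ∫ x in {x | Y.col x = i}, w x ∂Y.mB := by
  have h : Integrable w (Y.mB.restrict {x | Y.col x = i}) := hw.restrict
  rw [← Y.map_branch_withDensity i] at h ⊢
  rw [integral_map (Y.measurable_branch i).aemeasurable h.1,
    integral_withDensity_eq_integral_toReal_smul
    (Y.measurable_g_branch i).ennreal_ofReal (ae_of_all _ fun _ => ENNReal.ofReal_lt_top)]
  refine integral_congr_ae (ae_of_all _ fun x => ?_)
  simp [ENNReal.toReal_ofReal (Y.g_pos _).le]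

theorem iUnion_colB : ⋃ i, {x : Y.base | Y.col x = i} = Set.univ := by
  ext x; simp

theorem disjoint_colB : Pairwise (Function.onFun Disjoint fun i => {x : Y.base | Y.col x = i}) := by
  intro i j hij
  rw [Function.onFun, Set.disjoint_left]
  intro x h1 h2
  exact hij (h1.symm.trans h2)

theorem hasSum_integral_colB {E : Type*} [NormedAddCommGroup E] [NormedSpace ℝ E] {w : Y.base → E}
    (hw : Integrable w Y.mB) :
    HasSum (fun i => ∫ x in {x | Y.col x = i}, w x ∂Y.mB) (∫ x, w x ∂Y.mB) := by
  have := hasSum_integral_iUnion (μ := Y.mB) (f := w) Y.measurableSet_colB Y.disjoint_colB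
    hw.integrableOn
  rwa [iUnion_colB, setIntegral_univ] at this

/-- The transfer operator preserves integrals. -/
theorem integral_transferB {w : Y.base → ℂ} (hw : Integrable w Y.mB) :
    ∫ x, Y.transferB w x ∂Y.mB = ∫ x, w x ∂Y.mB := by
  have h1 : ∀ i x, (Y.g (Y.branch i x) : ℂ) * w (Y.branch i x) =
      Y.g (Y.branch i x) • w (Y.branch i x) := fun i x => (Complex.real_smul).symm
  simp only [transferB_eq_tsum, h1]
  have hs : Summable fun i => ∫ x, ‖Y.g (Y.branch i x) • w (Y.branch i x)‖ ∂Y.mB := by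
    refine (Y.hasSum_integral_colB hw.norm).summable.congr fun i => ?_
    rw [← Y.integral_branch hw.norm i]
    refine integral_congr_ae (ae_of_all _ fun x => ?_)
    simp [abs_of_pos (Y.g_pos _)]
  refine (hasSum_integral_of_summable_integral_norm
    (fun i => Y.integrable_branch hw i) hs).unique ?_
  simp only [fun i => Y.integral_branch hw i]
  exact Y.hasSum_integral_colB hw

theorem transferB_mul_comp_TB (u v : Y.base → ℂ) (x : Y.base) :
    Y.transferB (fun y => u y * v (Y.TB y)) x = Y.transferB u x * v x := by
  simp only [transferB_eq_tsum, TB_branch, ← mul_assoc]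
  exact tsum_mul_right

/-- The transfer operator is dual to the composition with the return map. -/
theorem integral_transferB_mul {u v : Y.base → ℂ}
    (h : Integrable (fun y => u y * v (Y.TB y)) Y.mB) :
    ∫ x, Y.transferB u x * v x ∂Y.mB = ∫ x, u x * v (Y.TB x) ∂Y.mB := by
  rw [← Y.integral_transferB h]
  simp only [transferB_mul_comp_TB]

/-- Every cylinder of the base has positive measure. -/
theorem mB_cylinder_pos (n : ℕ) (x : Y.base) :
    0 < Y.mB {y : Y.base | (n : ℕ∞) ≤ Y.sep (x : X) y} := by
  induction n generalizing x with
  | zero =>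
    simp only [Nat.cast_zero, zero_le, Set.ofPred_true]
    exact (Y.mB_col_pos (Y.col x)).trans_le (measure_mono (Set.subset_univ _))
  | succ n ih =>
    set A := {y : Y.base | (n : ℕ∞) ≤ Y.sep (Y.TB x : X) y}
    -- up to the column of `x`, the cylinder is the preimage of a shorter one
    have hsub : Y.TB ⁻¹' A ∩ {y | Y.col y = Y.col x} ⊆
        {y : Y.base | ((n + 1 : ℕ) : ℕ∞) ≤ Y.sep (x : X) y} := by
      rintro y ⟨h1, h2⟩
      have h2' : Y.col (y : X) = Y.col (x : X) := h2
      have h1' : (n : ℕ∞) ≤ Y.sep (Y.TB x : X) (Y.TB y) := h1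
      change ((n + 1 : ℕ) : ℕ∞) ≤ Y.sep (x : X) y
      rw [Y.sep_of_sameBlock (Y.sameBlock_base.2 h2'.symm)]
      push_cast
      exact add_le_add_left h1' 1
    refine lt_of_lt_of_le (pos_iff_ne_zero.2 fun h0 => ?_) (measure_mono hsub)
    have hA : MeasurableSet A := by
      have : A = ⋂ k ∈ Finset.range n, {y : Y.base | Y.next^[k] (y : X) ∈
          Y.block (Y.col (Y.next^[k] (Y.TB x : X))) (Y.lev (Y.next^[k] (Y.TB x : X)))} := by
        ext y
        simp only [A, Set.mem_ofPred_eq, natCast_le_sep, Set.mem_iInter, Finset.mem_range,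
          SameBlock, block, eq_comm]
      rw [this]
      refine Finset.measurableSet_biInter _ fun k _ => ?_
      exact ((Y.measurable_next.iterate k).comp measurable_subtype_coe)
        (Y.measurableSet_block _ _)
    have h1 := congrArg (fun μ : Measure Y.base => μ A) (Y.map_TB_withDensity (Y.col x))
    rw [Measure.map_apply Y.measurable_TB hA, withDensity_apply _ (Y.measurable_TB hA),
      Measure.restrict_restrict (Y.measurable_TB hA), setLIntegral_measure_zero _ _ h0] at h1
    exact (ih (Y.TB x)).ne h1

/-- A continuous function that vanishes almost everywhere vanishes. -/
theorem SepContinuous.eq_zero_of_ae {u : Y.base → ℂ} (hu : Y.SepContinuous u)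
    (h : ∀ᵐ x ∂Y.mB, u x = 0) (x : Y.base) : u x = 0 := by
  by_contra hx
  obtain ⟨N, hN⟩ := hu x ‖u x‖ (norm_pos_iff.2 hx)
  have : {y : Y.base | (N : ℕ∞) ≤ Y.sep (x : X) y} ⊆ {y | ¬ u y = 0} := by
    intro y hy hy0
    have := hN y hy
    rw [hy0, dist_zero_right] at this
    exact lt_irrefl _ this
  exact (Y.mB_cylinder_pos N x).ne' (measure_mono_null this h)

end YoungTower

/-! ### Bounds for the transfer operator on locally Hölder functions -/

namespace YoungTower

open TowerMap

variable {X I : Type*} [MeasurableSpace X] {m : Measure X} [IsProbabilityMeasure m] [Countable I]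
  (Y : YoungTower m I)

/-- The measure of the block `B_{i,0}`. -/
def wt (i : I) : ℝ := m.real (Y.block i 0)

theorem wt_nonneg (i : I) : 0 ≤ Y.wt i := measureReal_nonneg

theorem measureReal_colB (i : I) : Y.mB.real {x : Y.base | Y.col x = i} = Y.wt i := by
  simp [Measure.real, mB_col, wt]

theorem summable_wt : Summable Y.wt := by
  have := (Y.hasSum_integral_colB (integrable_const (1 : ℝ))).summable
  simpa [measureReal_colB] using this

theorem integral_g_branch (i : I) : ∫ x, Y.g (Y.branch i x) ∂Y.mB = Y.wt i := by
  have := Y.integral_branch (integrable_const (1 : ℝ)) i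
  simpa [measureReal_colB] using this

theorem integrable_g_branch (i : I) : Integrable (fun x => Y.g (Y.branch i x)) Y.mB := by
  simpa using Y.integrable_branch (integrable_const (1 : ℝ)) i

variable {ν : ℝ}

theorem exists_log_branch_bound (hν : Y.BoundedDistortion Y.g ν) :
    ∃ C > 0, ∀ i x y, |Real.log (Y.g (Y.branch i x)) - Real.log (Y.g (Y.branch i y))| ≤
      C * (ν * Y.dB ν x y) := by
  obtain ⟨C, hC, h⟩ := hν
  refine ⟨C, hC, fun i x y => ?_⟩
  rw [← Y.dB_branch i x y]
  exact h _ _ (by simp)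

theorem g_branch_le {C : ℝ} (hC : ∀ i x y, |Real.log (Y.g (Y.branch i x)) -
    Real.log (Y.g (Y.branch i y))| ≤ C * (ν * Y.dB ν x y)) (i : I) (x y : Y.base) :
    Y.g (Y.branch i x) ≤ Real.exp (C * (ν * Y.dB ν x y)) * Y.g (Y.branch i y) := by
  have h1 := (abs_le.1 (hC i x y)).2
  calc Y.g (Y.branch i x) = Real.exp (Real.log (Y.g (Y.branch i x))) :=
        (Real.exp_log (Y.g_pos _)).symm
    _ ≤ Real.exp (C * (ν * Y.dB ν x y) + Real.log (Y.g (Y.branch i y))) :=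
        Real.exp_le_exp.2 (by linarith)
    _ = _ := by rw [Real.exp_add, Real.exp_log (Y.g_pos _)]

theorem exp_sub_one_le_mul_exp {x A : ℝ} (h : 0 ≤ x) (hA : x ≤ A) :
    Real.exp x - 1 ≤ x * Real.exp A := by
  have h1 := Real.add_one_le_exp (-x)
  have h2 : Real.exp x * Real.exp (-x) = 1 := by rw [← Real.exp_add]; simp
  have h3 : Real.exp x ≤ Real.exp A := Real.exp_le_exp.2 hA
  nlinarith [Real.exp_pos x]

/-- The weight `g_m ∘ h_i` of the `i`-th inverse branch is comparable to the measure of the `i`-th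
column, and Hölder continuous with a comparable constant. -/
theorem exists_weight_bound (h0 : 0 ≤ ν) (h1 : ν ≤ 1) (hν : Y.BoundedDistortion Y.g ν) :
    ∃ K > 0, (∀ i x, Y.g (Y.branch i x) ≤ K * Y.wt i) ∧
      ∀ i x y, |Y.g (Y.branch i x) - Y.g (Y.branch i y)| ≤ K * Y.wt i * Y.dB ν x y := by
  obtain ⟨C, hC0, hC⟩ := Y.exists_log_branch_bound hν
  have hb := Y.measure_base_pos
  set K₀ := Real.exp C / m.real Y.base
  have hK0 : 0 < K₀ := by positivity
  have hle : ∀ x y, ν * Y.dB ν x y ≤ 1 := fun x y =>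
    mul_le_one₀ h1 (Y.dB_nonneg h0 x y) (Y.dB_le_one h0 h1 x y)
  have hd0 := Y.dB_nonneg h0
  have hA : ∀ i x, Y.g (Y.branch i x) ≤ K₀ * Y.wt i := by
    intro i x
    have h : ∀ y, Y.g (Y.branch i x) ≤ Real.exp C * Y.g (Y.branch i y) := fun y =>
      (Y.g_branch_le hC i x y).trans (mul_le_mul_of_nonneg_right (Real.exp_le_exp.2
        (mul_le_of_le_one_right hC0.le (hle x y))) (Y.g_pos _).le)
    have := integral_mono (integrable_const _) ((Y.integrable_g_branch i).const_mul _) h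
    rw [integral_const, integral_const_mul, integral_g_branch, mB_real_univ, smul_eq_mul] at this
    rw [div_mul_eq_mul_div, le_div_iff₀ hb]
    linarith
  have key : ∀ i x y, Y.g (Y.branch i x) - Y.g (Y.branch i y) ≤
      K₀ * (C * Real.exp C) * Y.wt i * Y.dB ν x y := by
    intro i x y
    have h2 := Y.g_branch_le hC i x y
    have h3 : C * (ν * Y.dB ν x y) ≤ C := mul_le_of_le_one_right hC0.le (hle x y)
    have h4 : 0 ≤ C * (ν * Y.dB ν x y) := by have := hd0 x y; positivity
    have h5 := exp_sub_one_le_mul_exp h4 h3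
    have h6 : C * (ν * Y.dB ν x y) ≤ C * Y.dB ν x y :=
      mul_le_mul_of_nonneg_left (mul_le_of_le_one_left (hd0 x y) h1) hC0.le
    calc Y.g (Y.branch i x) - Y.g (Y.branch i y)
        ≤ (Real.exp (C * (ν * Y.dB ν x y)) - 1) * Y.g (Y.branch i y) := by linarith
      _ ≤ (C * Y.dB ν x y * Real.exp C) * (K₀ * Y.wt i) :=
          mul_le_mul (h5.trans (mul_le_mul_of_nonneg_right h6 (Real.exp_pos _).le)) (hA i y)
            (Y.g_pos _).le (by have := hd0 x y; positivity)
      _ = _ := by ring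
  refine ⟨K₀ + K₀ * (C * Real.exp C), by positivity, fun i x => ?_, fun i x y => ?_⟩
  · refine (hA i x).trans (mul_le_mul_of_nonneg_right ?_ (Y.wt_nonneg i))
    have : 0 < K₀ * (C * Real.exp C) := by positivity
    linarith
  · have hw := Y.wt_nonneg i
    have hd := hd0 x y
    have : K₀ * (C * Real.exp C) * Y.wt i * Y.dB ν x y ≤
        (K₀ + K₀ * (C * Real.exp C)) * Y.wt i * Y.dB ν x y := by gcongr; linarith
    rw [abs_le]
    constructor
    · have h := key i y x
      rw [Y.dB_comm] at h
      linarith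
    · exact (key i x y).trans this

/-- `u` is bounded by `q i` and Hölder continuous with constant `q i` on the `i`-th column, for
each `i`, and the column bounds `q` are summable with respect to the measure. -/
structure ColBound (ν : ℝ) (u : Y.base → ℂ) (q : I → ℝ) : Prop where
  summable : Summable fun i => Y.wt i * q i
  norm_le : ∀ x, ‖u x‖ ≤ q (Y.col x)
  norm_sub_le : ∀ x y : Y.base, Y.col x = Y.col y → ‖u x - u y‖ ≤ q (Y.col x) * Y.dB ν x y

theorem ColBound.sepContinuous {Y : YoungTower m I} (h0 : 0 ≤ ν) (h1 : ν < 1) {u : Y.base → ℂ}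
    {q : I → ℝ} (h : Y.ColBound ν u q) : Y.SepContinuous u :=
  Y.sepContinuous_of_col h0 h1 fun x y hxy => by rw [dist_eq_norm]; exact h.norm_sub_le x y hxy

theorem ColBound.nonneg {Y : YoungTower m I} {u : Y.base → ℂ}
    {q : I → ℝ} (h : Y.ColBound ν u q) (x : Y.base) (i : I) : 0 ≤ q i := by
  have := h.norm_le (Y.branch i x)
  rw [col_branch] at this
  exact (norm_nonneg _).trans this

/-- `K` is a constant such that the weight `g_m ∘ h_i` of each inverse branch `h_i` is bounded by
`K m(B_{i,0})`, and Hölder continuous with constant `K m(B_{i,0})`. -/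
structure WeightBound (ν K : ℝ) : Prop where
  pos : 0 < K
  le : ∀ i x, Y.g (Y.branch i x) ≤ K * Y.wt i
  sub_le : ∀ i x y, |Y.g (Y.branch i x) - Y.g (Y.branch i y)| ≤ K * Y.wt i * Y.dB ν x y

variable {Y} {K : ℝ} {u : Y.base → ℂ} {q : I → ℝ}

theorem ColBound.norm_term_le (hK : Y.WeightBound ν K) (h : Y.ColBound ν u q) (i : I)
    (x : Y.base) : ‖(Y.g (Y.branch i x) : ℂ) * u (Y.branch i x)‖ ≤ K * (Y.wt i * q i) := by
  rw [norm_mul, Complex.norm_real, Real.norm_of_nonneg (Y.g_pos _).le, ← mul_assoc]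
  have := h.norm_le (Y.branch i x)
  rw [col_branch] at this
  exact mul_le_mul (hK.le i x) this (norm_nonneg _) (mul_nonneg hK.pos.le (Y.wt_nonneg i))

theorem ColBound.summable_term (hK : Y.WeightBound ν K) (h : Y.ColBound ν u q) (x : Y.base) :
    Summable fun i => (Y.g (Y.branch i x) : ℂ) * u (Y.branch i x) :=
  Summable.of_norm_bounded (h.summable.mul_left K) fun i => h.norm_term_le hK i x

theorem ColBound.norm_transferB_le (hK : Y.WeightBound ν K) (h : Y.ColBound ν u q) (x : Y.base) :
    ‖Y.transferB u x‖ ≤ K * ∑' i, Y.wt i * q i := by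
  rw [transferB_eq_tsum, ← tsum_mul_left]
  exact tsum_of_norm_bounded (h.summable.mul_left K).hasSum fun i => h.norm_term_le hK i x

theorem ColBound.norm_transferB_sub_le (h0 : 0 ≤ ν) (h1 : ν ≤ 1) (hK : Y.WeightBound ν K)
    (h : Y.ColBound ν u q) (x y : Y.base) :
    ‖Y.transferB u x - Y.transferB u y‖ ≤ 2 * K * (∑' i, Y.wt i * q i) * Y.dB ν x y := by
  have hd := Y.dB_nonneg h0 x y
  have hterm : ∀ i, ‖(Y.g (Y.branch i x) : ℂ) * u (Y.branch i x) -
      (Y.g (Y.branch i y) : ℂ) * u (Y.branch i y)‖ ≤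
      2 * K * Y.dB ν x y * (Y.wt i * q i) := by
    intro i
    have e : (Y.g (Y.branch i x) : ℂ) * u (Y.branch i x) -
      (Y.g (Y.branch i y) : ℂ) * u (Y.branch i y) =
      ((Y.g (Y.branch i x) - Y.g (Y.branch i y) : ℝ) : ℂ) * u (Y.branch i x) +
      (Y.g (Y.branch i y) : ℂ) * (u (Y.branch i x) - u (Y.branch i y)) := by push_cast; ring
    have hq := h.nonneg x i
    have hw := Y.wt_nonneg i
    have hKp := hK.pos
    have a1 := h.norm_le (Y.branch i x)
    have a2 := h.norm_sub_le (Y.branch i x) (Y.branch i y) (by simp)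
    rw [col_branch] at a1 a2
    rw [dB_branch] at a2
    have a3 : q i * (ν * Y.dB ν x y) ≤ q i * Y.dB ν x y :=
      mul_le_mul_of_nonneg_left (mul_le_of_le_one_left hd h1) hq
    rw [e]
    refine (norm_add_le _ _).trans ?_
    rw [norm_mul, norm_mul, Complex.norm_real, Complex.norm_real,
      Real.norm_of_nonneg (Y.g_pos _).le, Real.norm_eq_abs]
    have b1 : |Y.g (Y.branch i x) - Y.g (Y.branch i y)| * ‖u (Y.branch i x)‖ ≤
        (K * Y.wt i * Y.dB ν x y) * q i :=
      mul_le_mul (hK.sub_le i x y) a1 (norm_nonneg _) (by positivity)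
    have b2 : Y.g (Y.branch i y) * ‖u (Y.branch i x) - u (Y.branch i y)‖ ≤
        (K * Y.wt i) * (q i * Y.dB ν x y) :=
      mul_le_mul (hK.le i y) (a2.trans a3) (norm_nonneg _) (by positivity)
    linarith
  rw [transferB_eq_tsum, transferB_eq_tsum, ← (h.summable_term hK x).tsum_sub
    (h.summable_term hK y)]
  refine (tsum_of_norm_bounded (h.summable.mul_left _).hasSum hterm).trans (le_of_eq ?_)
  rw [tsum_mul_left]; ring

theorem ColBound.integrable (h0 : 0 ≤ ν) (h1 : ν < 1) (h : Y.ColBound ν u q) :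
    Integrable u Y.mB := by
  have hm : Measurable u := SepContinuous.measurable Y (h.sepContinuous h0 h1)
  by_cases hne : Nonempty Y.base
  swap
  · rw [not_nonempty_iff] at hne
    have : Y.mB = 0 := Measure.eq_zero_of_isEmpty _
    rw [this]; exact integrable_zero_measure
  obtain ⟨x₀⟩ := hne
  refine ⟨hm.aestronglyMeasurable, ?_⟩
  refine lt_of_le_of_lt (b := ENNReal.ofReal (∑' i, Y.wt i * q i)) ?_ ENNReal.ofReal_lt_top
  rw [ENNReal.ofReal_tsum_of_nonneg (fun i => mul_nonneg (Y.wt_nonneg i) (h.nonneg x₀ i))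
    h.summable, ← setLIntegral_univ, ← Y.iUnion_colB,
    lintegral_iUnion Y.measurableSet_colB Y.disjoint_colB]
  refine ENNReal.tsum_le_tsum fun i => ?_
  calc ∫⁻ x in {x : Y.base | Y.col x = i}, ‖u x‖ₑ ∂Y.mB
      ≤ ∫⁻ x in {x : Y.base | Y.col x = i}, ENNReal.ofReal (q i) ∂Y.mB := by
        refine setLIntegral_mono' (Y.measurableSet_colB i) fun x hx => ?_
        rw [← ofReal_norm]
        have hx' : Y.col (x : X) = i := hx
        exact ENNReal.ofReal_le_ofReal (hx' ▸ h.norm_le x)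
    _ = _ := by
        rw [setLIntegral_const, ENNReal.ofReal_mul (Y.wt_nonneg i), mul_comm, ← measureReal_colB,
          ofReal_measureReal]

theorem colBound_one (h0 : 0 ≤ ν) : Y.ColBound ν (fun _ => 1) (fun _ => 1) where
  summable := by simpa using Y.summable_wt
  norm_le x := by simp
  norm_sub_le x y _ := by simpa using Y.dB_nonneg h0 x y

theorem ColBound.mul (hu : Y.ColBound ν u q) (h0 : 0 ≤ ν) {v : Y.base → ℂ} {M : ℝ}
    (hv : ∀ x, ‖v x‖ ≤ M) (hv' : ∀ x y, ‖v x - v y‖ ≤ M * Y.dB ν x y) :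
    Y.ColBound ν (fun x => u x * v x) (fun i => 2 * M * q i) where
  summable := (hu.summable.mul_left (2 * M)).congr fun i => by ring
  norm_le x := by
    rw [norm_mul]
    have h1 := mul_le_mul (hu.norm_le x) (hv x) (norm_nonneg _) (hu.nonneg x _)
    have h2 : 0 ≤ q (Y.col x) * M := le_trans (by positivity) h1
    linarith
  norm_sub_le x y hxy := by
    have e : u x * v x - u y * v y = (u x - u y) * v x + u y * (v x - v y) := by ring
    rw [e]
    refine (norm_add_le _ _).trans ?_
    rw [norm_mul, norm_mul]
    have hd := Y.dB_nonneg h0 x y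
    have hq := hu.nonneg x (Y.col x)
    have h1 := mul_le_mul (hu.norm_sub_le x y hxy) (hv x) (norm_nonneg _) (by positivity)
    have h2 := mul_le_mul (hu.norm_le y) (hv' x y) (norm_nonneg _) (hu.nonneg x _)
    rw [← hxy] at h2
    linarith

variable (Y)

theorem integral_comp_TB {E : Type*} [NormedAddCommGroup E] [NormedSpace ℝ E] {w : Y.base → E}
    (hw : AEStronglyMeasurable w Y.mB) : ∫ x, w (Y.TB x) ∂Y.mB = ∫ x, w x ∂Y.mB := by
  rw [← Y.measurePreserving_TB.map_eq] at hw
  rw [← integral_map Y.measurable_TB.aemeasurable hw, Y.measurePreserving_TB.map_eq]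

theorem integrable_comp_TB {E : Type*} [NormedAddCommGroup E] {w : Y.base → E}
    (hw : Integrable w Y.mB) : Integrable (fun x => w (Y.TB x)) Y.mB :=
  Y.measurePreserving_TB.integrable_comp_of_integrable hw

/-- The weights of the inverse branches add up to `1`: the transfer operator fixes constants. By
duality with the return map this holds almost everywhere, hence everywhere by continuity. -/
theorem transferB_one (h0 : 0 ≤ ν) (h1 : ν < 1) (hν : Y.BoundedDistortion Y.g ν) (x : Y.base) :
    Y.transferB (fun _ => 1) x = 1 := by
  obtain ⟨K, hK0, hK1, hK2⟩ := Y.exists_weight_bound h0 h1.le hν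
  have hK : Y.WeightBound ν K := ⟨hK0, hK1, hK2⟩
  have hc := Y.colBound_one h0
  have hcont : Y.SepContinuous (fun x => Y.transferB (fun _ => 1) x - 1) := by
    refine Y.sepContinuous_of_col h0 h1 (q := fun _ => 2 * K * (∑' i, Y.wt i * 1))
      fun x y _ => ?_
    rw [dist_eq_norm, sub_sub_sub_cancel_right]
    exact hc.norm_transferB_sub_le h0 h1.le hK x y
  have hint : Integrable (Y.transferB (fun _ => 1)) Y.mB := by
    have hm := SepContinuous.measurable Y hcont
    have : Measurable (Y.transferB (fun _ => 1)) := by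
      convert hm.add_const 1 using 2; simp
    exact Integrable.of_bound this.aestronglyMeasurable _
      (ae_of_all _ fun x => hc.norm_transferB_le hK x)
  have hae : Y.transferB (fun _ => 1) =ᵐ[Y.mB] fun _ => (1 : ℂ) := by
    refine ae_eq_of_forall_setIntegral_eq_of_sigmaFinite (fun s _ _ => hint.integrableOn)
      (fun s _ _ => (integrable_const _).integrableOn) fun s hs _ => ?_
    have hi : Integrable (s.indicator fun _ => (1 : ℂ)) Y.mB := (integrable_const _).indicator hs
    have e1 := Y.integral_transferB_mul (u := fun _ => 1) (v := s.indicator fun _ => 1) (by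
      simp only [one_mul]
      exact Y.integrable_comp_TB hi)
    simp only [one_mul] at e1
    rw [Y.integral_comp_TB hi.1] at e1
    rw [← integral_indicator hs, ← integral_indicator hs, ← e1]
    refine integral_congr_ae (ae_of_all _ fun y => ?_)
    by_cases hy : y ∈ s <;> simp [hy]
  have := SepContinuous.eq_zero_of_ae Y hcont (hae.mono fun x hx => by rw [hx, sub_self]) x
  exact sub_eq_zero.1 this

theorem hasSum_g_branch (h0 : 0 ≤ ν) (h1 : ν < 1) (hν : Y.BoundedDistortion Y.g ν) (x : Y.base) :
    HasSum (fun i => Y.g (Y.branch i x)) 1 := by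
  obtain ⟨K, hK0, hK1, hK2⟩ := Y.exists_weight_bound h0 h1.le hν
  have h := ((Y.colBound_one h0).summable_term ⟨hK0, hK1, hK2⟩ x).hasSum
  have e := Y.transferB_eq_tsum (fun _ => 1) x
  rw [Y.transferB_one h0 h1 hν] at e
  rw [← e] at h
  rw [← Complex.hasSum_ofReal]
  simpa using h

end YoungTower

/-! ### The Banach space of Hölder functions on the base -/

namespace YoungTower

open TowerMap

variable {X I : Type*} [MeasurableSpace X] {m : Measure X} [IsProbabilityMeasure m] [Countable I]
  (Y : YoungTower m I)

/-- The space `C_θ(B)`. A function `u` is encoded by its values and its difference quotients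
`(u x - u y) / θ ^ s(x,y)` (taken to be `0` when `θ ^ s(x,y) = 0`), which form a bounded family, so
that the space is a closed subspace of an `ℓ^∞`, with norm the maximum of the supremum norm and the
Hölder seminorm. -/
def holderSubmodule (θ : ℝ) : Submodule ℂ (lp (fun _ : Y.base ⊕ (Y.base × Y.base) => ℂ) ∞) where
  carrier := {F | ∀ x y, F (.inl x) - F (.inl y) = (Y.dB θ x y : ℂ) * F (.inr (x, y)) ∧
    (Y.dB θ x y = 0 → F (.inr (x, y)) = 0)}
  zero_mem' x y := by simp
  add_mem' {F G} hF hG x y := by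
    obtain ⟨h1, h2⟩ := hF x y
    obtain ⟨h3, h4⟩ := hG x y
    simp only [lp.coeFn_add, Pi.add_apply]
    refine ⟨by linear_combination h1 + h3, fun h => by rw [h2 h, h4 h, add_zero]⟩
  smul_mem' c F hF x y := by
    obtain ⟨h1, h2⟩ := hF x y
    simp only [lp.coeFn_smul, Pi.smul_apply, smul_eq_mul]
    refine ⟨by linear_combination c * h1, fun h => by rw [h2 h, mul_zero]⟩

theorem isClosed_holderSubmodule (θ : ℝ) :
    IsClosed (Y.holderSubmodule θ : Set (lp (fun _ : Y.base ⊕ (Y.base × Y.base) => ℂ) ∞)) := by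
  have hc : ∀ z, Continuous (Y := ℂ)
      fun F : lp (fun _ : Y.base ⊕ (Y.base × Y.base) => ℂ) ∞ => F z :=
    fun z => (continuous_apply z).comp (lp.uniformContinuous_coe (p := ∞)).continuous
  have : (Y.holderSubmodule θ : Set (lp (fun _ : Y.base ⊕ (Y.base × Y.base) => ℂ) ∞)) =
      ⋂ x, ⋂ y, {F | F (.inl x) - F (.inl y) = (Y.dB θ x y : ℂ) * F (.inr (x, y)) ∧
        (Y.dB θ x y = 0 → F (.inr (x, y)) = 0)} := by
    ext F
    simp only [Set.mem_iInter]
    rfl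
  rw [this]
  refine isClosed_iInter fun x => isClosed_iInter fun y => ?_
  have h1 : Continuous (Y := ℂ) fun F : lp (fun _ : Y.base ⊕ (Y.base × Y.base) => ℂ) ∞ =>
      F (.inl x) - F (.inl y) := Continuous.sub (hc _) (hc _)
  have h2 : Continuous (Y := ℂ) fun F : lp (fun _ : Y.base ⊕ (Y.base × Y.base) => ℂ) ∞ =>
      (Y.dB θ x y : ℂ) * F (.inr (x, y)) := Continuous.mul continuous_const (hc _)
  refine (isClosed_eq h1 h2).inter ?_
  by_cases h : Y.dB θ x y = 0
  · simp only [h, forall_const]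
    exact isClosed_eq (hc _) continuous_const
  · simp only [h, false_imp_iff]
    exact isClosed_univ

/-- The Banach space `C_θ(B)`. -/
def Holder (θ : ℝ) : Type _ := Y.holderSubmodule θ

instance (θ : ℝ) : NormedAddCommGroup (Y.Holder θ) :=
  inferInstanceAs (NormedAddCommGroup (Y.holderSubmodule θ))

instance (θ : ℝ) : NormedSpace ℂ (Y.Holder θ) :=
  inferInstanceAs (NormedSpace ℂ (Y.holderSubmodule θ))

instance (θ : ℝ) : CompleteSpace (Y.Holder θ) :=
  (Y.isClosed_holderSubmodule θ).completeSpace_coe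

variable {Y} {θ : ℝ}

/-- The function encoded by an element of `C_θ(B)`. -/
def Holder.toFun (F : Y.Holder θ) (x : Y.base) : ℂ := F.1 (.inl x)

instance : CoeFun (Y.Holder θ) fun _ => Y.base → ℂ := ⟨Holder.toFun⟩

namespace Holder

@[simp] theorem add_apply (F G : Y.Holder θ) (x : Y.base) : (F + G) x = F x + G x := rfl
@[simp] theorem sub_apply (F G : Y.Holder θ) (x : Y.base) : (F - G) x = F x - G x := rfl
@[simp] theorem smul_apply (c : ℂ) (F : Y.Holder θ) (x : Y.base) : (c • F) x = c * F x := rfl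
theorem norm_apply_le (F : Y.Holder θ) (x : Y.base) : ‖F x‖ ≤ ‖F‖ :=
  lp.norm_apply_le_norm (by simp) F.1 (.inl x)

theorem norm_sub_le (h0 : 0 ≤ θ) (F : Y.Holder θ) (x y : Y.base) :
    ‖F x - F y‖ ≤ ‖F‖ * Y.dB θ x y := by
  have h : F x - F y = (Y.dB θ x y : ℂ) * F.1 (.inr (x, y)) := (F.2 x y).1
  rw [h, norm_mul, Complex.norm_real, Real.norm_of_nonneg (Y.dB_nonneg h0 x y), mul_comm]
  exact mul_le_mul_of_nonneg_right (lp.norm_apply_le_norm (by simp) F.1 _) (Y.dB_nonneg h0 x y)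

theorem ext {F G : Y.Holder θ} (h : ∀ x, F x = G x) : F = G := by
  refine Subtype.ext (lp.ext (funext fun z => ?_))
  rcases z with x | ⟨x, y⟩
  · exact h x
  · have hF := F.2 x y
    have hG := G.2 x y
    by_cases hd : Y.dB θ x y = 0
    · rw [hF.2 hd, hG.2 hd]
    · have hd' : (Y.dB θ x y : ℂ) ≠ 0 := by exact_mod_cast hd
      refine mul_left_cancel₀ hd' ?_
      rw [← hF.1, ← hG.1]
      exact congrArg₂ _ (h x) (h y)

/-- A function that is bounded by `M` and Hölder continuous with constant `M` is an element of
`C_θ(B)` of norm at most `M`. -/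
theorem exists_of_bound (h0 : 0 ≤ θ) {u : Y.base → ℂ} {M : ℝ} (hM : 0 ≤ M) (h : ∀ x, ‖u x‖ ≤ M)
    (h' : ∀ x y, ‖u x - u y‖ ≤ M * Y.dB θ x y) : ∃ F : Y.Holder θ, (∀ x, F x = u x) ∧ ‖F‖ ≤ M := by
  let w : Y.base ⊕ (Y.base × Y.base) → ℂ := Sum.elim u fun p => (u p.1 - u p.2) / Y.dB θ p.1 p.2
  have hw : ∀ z, ‖w z‖ ≤ M := by
    rintro (x | ⟨x, y⟩)
    · exact h x
    · simp only [w, Sum.elim_inr, norm_div, Complex.norm_real,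
        Real.norm_of_nonneg (Y.dB_nonneg h0 x y)]
      exact div_le_of_le_mul₀ (Y.dB_nonneg h0 x y) hM (h' x y)
  have hmem : Memℓp w ∞ := memℓp_infty ⟨M, by rintro _ ⟨z, rfl⟩; exact hw z⟩
  refine ⟨⟨⟨w, hmem⟩, fun x y => ?_⟩, fun x => rfl, lp.norm_le_of_forall_le hM hw⟩
  change u x - u y = Y.dB θ x y * ((u x - u y) / Y.dB θ x y) ∧
    (Y.dB θ x y = 0 → (u x - u y) / (Y.dB θ x y : ℂ) = 0)
  refine ⟨?_, fun hd => by simp [hd]⟩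
  by_cases hd : Y.dB θ x y = 0
  · have := h' x y
    rw [hd, mul_zero] at this
    rw [norm_le_zero_iff.1 this]; simp
  · have hd' : (Y.dB θ x y : ℂ) ≠ 0 := by exact_mod_cast hd
    field_simp

theorem norm_le_of_bound (h0 : 0 ≤ θ) (F : Y.Holder θ) {M : ℝ} (hM : 0 ≤ M) (h : ∀ x, ‖F x‖ ≤ M)
    (h' : ∀ x y, ‖F x - F y‖ ≤ M * Y.dB θ x y) : ‖F‖ ≤ M := by
  obtain ⟨G, hG, hn⟩ := exists_of_bound h0 hM h h'
  rwa [← ext (F := G) (G := F) hG]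

theorem memCBase (h0 : 0 ≤ θ) (F : Y.Holder θ) : Y.MemCBase θ F := by
  refine ⟨‖F‖ + 1, by positivity, fun x y => (norm_sub_le h0 F x y).trans ?_⟩
  exact mul_le_mul_of_nonneg_right (by linarith) (Y.dB_nonneg h0 x y)

theorem exists_of_memCBase (h0 : 0 ≤ θ) (h1 : θ ≤ 1) {u : Y.base → ℂ} (hu : Y.MemCBase θ u) :
    ∃ F : Y.Holder θ, ∀ x, F x = u x := by
  obtain ⟨C, hC, h⟩ := hu
  by_cases hne : Nonempty Y.base
  swap
  · exact ⟨0, fun x => absurd ⟨x⟩ hne⟩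
  obtain ⟨x₀⟩ := hne
  have hF := exists_of_bound h0 (M := ‖u x₀‖ + C) (u := u) (by positivity)
    (fun x => ?_) (fun x y => ?_)
  · exact ⟨hF.choose, hF.choose_spec.1⟩
  · have h2 := (h x x₀).trans (mul_le_mul_of_nonneg_left (Y.dB_le_one h0 h1 x x₀) hC.le)
    have h3 := norm_sub_norm_le (u x) (u x₀)
    linarith
  · refine (h x y).trans (mul_le_mul_of_nonneg_right ?_ (Y.dB_nonneg h0 x y))
    linarith [norm_nonneg (u x₀)]

theorem sepContinuous (h0 : 0 ≤ θ) (h1 : θ < 1) (F : Y.Holder θ) : Y.SepContinuous F :=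
  Y.sepContinuous_of_col h0 h1 (q := fun _ => ‖F‖) fun x y _ => by
    rw [dist_eq_norm]; exact norm_sub_le h0 F x y

theorem measurable (h0 : 0 ≤ θ) (h1 : θ < 1) (F : Y.Holder θ) : Measurable F :=
  SepContinuous.measurable Y (sepContinuous h0 h1 F)

theorem integrable (h0 : 0 ≤ θ) (h1 : θ < 1) (F : Y.Holder θ) : Integrable F Y.mB :=
  Integrable.of_bound (measurable h0 h1 F).aestronglyMeasurable ‖F‖
    (ae_of_all _ fun x => norm_apply_le F x)

theorem exists_one (h0 : 0 ≤ θ) : ∃ F : Y.Holder θ, ∀ x, F x = 1 := by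
  obtain ⟨F, hF, -⟩ := exists_of_bound (Y := Y) h0 zero_le_one (u := fun _ => 1) (by simp)
    (fun x y => by simpa using Y.dB_nonneg h0 x y)
  exact ⟨F, hF⟩

/-- The constant function `1`. -/
def one (h0 : 0 ≤ θ) : Y.Holder θ := (exists_one h0).choose

@[simp] theorem one_apply (h0 : 0 ≤ θ) (x : Y.base) : one h0 x = 1 := (exists_one h0).choose_spec x

theorem coe_one (h0 : 0 ≤ θ) : (one h0 : Y.Holder θ).toFun = fun _ => 1 := funext (one_apply h0)

end Holder

/-- The normalized integral `E_B` on `C_θ(B)`. -/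
def mean (h0 : 0 ≤ θ) (h1 : θ < 1) : Y.Holder θ →L[ℂ] ℂ :=
  LinearMap.mkContinuous
    { toFun := fun F => Y.EB F
      map_add' := fun F G => by
        simp only [EB, Holder.add_apply]
        rw [integral_add (Holder.integrable h0 h1 F) (Holder.integrable h0 h1 G), mul_add]
      map_smul' := fun c F => by
        simp only [EB, Holder.smul_apply, RingHom.id_apply, smul_eq_mul]
        rw [integral_const_mul]; ring } 1 fun F => by
    have hb := Y.measure_base_pos
    have := norm_integral_le_of_norm_le_const (μ := Y.mB)
      (ae_of_all _ fun x => Holder.norm_apply_le F x)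
    rw [mB_real_univ] at this
    simp only [LinearMap.coe_mk, AddHom.coe_mk, EB, norm_mul, Complex.norm_real, norm_inv,
      Real.norm_of_nonneg hb.le, one_mul]
    rw [inv_mul_le_iff₀ hb, mul_comm]
    exact this

@[simp] theorem mean_apply (h0 : 0 ≤ θ) (h1 : θ < 1) (F : Y.Holder θ) : mean h0 h1 F = Y.EB F := rfl

theorem EB_const (c : ℂ) : Y.EB (fun _ => c) = c := by
  have hb : (m.real Y.base : ℂ) ≠ 0 := by exact_mod_cast Y.measure_base_pos.ne'
  simp only [EB, integral_const, mB_real_univ, Complex.real_smul, Complex.ofReal_inv]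
  field_simp

/-- Multiplication by a function with summable column bounds followed by the transfer operator is a
bounded operator on `C_ν(B)`. -/
theorem exists_transferB_mul {ν K : ℝ} (h0 : 0 ≤ ν) (h1 : ν ≤ 1) (hK : Y.WeightBound ν K)
    {ψ : Y.base → ℂ} {q : I → ℝ} (hψ : Y.ColBound ν ψ q) :
    ∃ A : Y.Holder ν →L[ℂ] Y.Holder ν, (∀ F x, A F x = Y.transferB (fun y => ψ y * F y) x) ∧
      ‖A‖ ≤ 4 * K * ∑' i, Y.wt i * q i := by
  by_cases hne : Nonempty Y.base
  swap
  · rw [not_nonempty_iff] at hne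
    have hq : ∀ i, Y.wt i = 0 := by
      intro i
      rw [← measureReal_colB]
      have : {x : Y.base | Y.col x = i} = ∅ := Set.eq_empty_of_isEmpty _
      rw [this]; simp
    refine ⟨0, fun F x => hne.elim x, by simp [hq]⟩
  obtain ⟨x₀⟩ := hne
  have hs : 0 ≤ ∑' i, Y.wt i * q i := tsum_nonneg fun i => mul_nonneg (Y.wt_nonneg i)
    (hψ.nonneg x₀ i)
  have hKp := hK.pos
  have hF : ∀ F : Y.Holder ν, Y.ColBound ν (fun y => ψ y * F y) (fun i => 2 * ‖F‖ * q i) :=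
    fun F => hψ.mul h0 (Holder.norm_apply_le F) (Holder.norm_sub_le h0 F)
  have hsum : ∀ F : Y.Holder ν, ∑' i, Y.wt i * (2 * ‖F‖ * q i) =
      2 * ‖F‖ * ∑' i, Y.wt i * q i := by
    intro F
    rw [← tsum_mul_left]
    exact tsum_congr fun i => by ring
  have hex : ∀ F : Y.Holder ν, ∃ G : Y.Holder ν,
      (∀ x, G x = Y.transferB (fun y => ψ y * F y) x) ∧
      ‖G‖ ≤ (4 * K * ∑' i, Y.wt i * q i) * ‖F‖ := by
    intro F
    refine Holder.exists_of_bound h0 (by positivity) (fun x => ?_) (fun x y => ?_)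
    · refine ((hF F).norm_transferB_le hK x).trans ?_
      rw [hsum]
      have : 0 ≤ K * ‖F‖ * ∑' i, Y.wt i * q i := by positivity
      linarith
    · refine ((hF F).norm_transferB_sub_le h0 h1 hK x y).trans (le_of_eq ?_)
      rw [hsum]; ring
  choose A hA hAn using hex
  refine ⟨LinearMap.mkContinuous
    { toFun := A
      map_add' := fun F G => Holder.ext fun x => ?_
      map_smul' := fun c F => Holder.ext fun x => ?_ } _ hAn, hA,
    LinearMap.mkContinuous_norm_le _ (by positivity) _⟩
  · rw [Holder.add_apply, hA, hA, hA, transferB_eq_tsum, transferB_eq_tsum, transferB_eq_tsum,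
      ← ((hF F).summable_term hK x).tsum_add ((hF G).summable_term hK x)]
    refine tsum_congr fun i => ?_
    rw [Holder.add_apply]; ring
  · rw [RingHom.id_apply, Holder.smul_apply, hA, hA, transferB_eq_tsum, transferB_eq_tsum,
      ← tsum_mul_left]
    refine tsum_congr fun i => ?_
    rw [Holder.smul_apply]; ring

end YoungTower

/-! ### The spectral gap of the return map -/

namespace YoungTower

open TowerMap

variable {X I : Type*} [MeasurableSpace X] {m : Measure X} [IsProbabilityMeasure m] [Countable I]
  (Y : YoungTower m I)

/-- The cone of nonnegative functions `v` on the base such that `log v` is Hölder continuous with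
constant `A`. -/
structure Cone (ν A : ℝ) (v : Y.base → ℝ) : Prop where
  nonneg : ∀ x, 0 ≤ v x
  le : ∀ x y, v x ≤ Real.exp (A * Y.dB ν x y) * v y

variable {Y} {ν A C : ℝ} {v : Y.base → ℝ}

theorem Cone.le_exp (h0 : 0 ≤ ν) (h1 : ν ≤ 1) (hA : 0 ≤ A) (hv : Y.Cone ν A v) (x y : Y.base) :
    v x ≤ Real.exp A * v y :=
  (hv.le x y).trans (mul_le_mul_of_nonneg_right (Real.exp_le_exp.2
    (mul_le_of_le_one_right hA (Y.dB_le_one h0 h1 x y))) (hv.nonneg y))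

theorem Cone.mean_le (h0 : 0 ≤ ν) (h1 : ν ≤ 1) (hA : 0 ≤ A) (hv : Y.Cone ν A v)
    (hi : Integrable v Y.mB) (x : Y.base) :
    (m.real Y.base)⁻¹ * ∫ y, v y ∂Y.mB ≤ Real.exp A * v x := by
  rw [inv_mul_le_iff₀ Y.measure_base_pos]
  have := integral_mono hi (integrable_const _) fun y => hv.le_exp h0 h1 hA y x
  simpa [mB_real_univ] using this

theorem Cone.le_mean (h0 : 0 ≤ ν) (h1 : ν ≤ 1) (hA : 0 ≤ A) (hv : Y.Cone ν A v)
    (hi : Integrable v Y.mB) (x : Y.base) :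
    v x ≤ Real.exp A * ((m.real Y.base)⁻¹ * ∫ y, v y ∂Y.mB) := by
  have hb := Y.measure_base_pos
  have := integral_mono (integrable_const _) (hi.const_mul _) fun y => hv.le_exp h0 h1 hA x y
  rw [integral_const, integral_const_mul, mB_real_univ, smul_eq_mul] at this
  rw [← mul_le_mul_iff_right₀ hb]
  refine this.trans (le_of_eq ?_)
  field_simp

/-- The transfer operator strictly contracts the cone: a positive proportion of the mean can be
subtracted from the image without leaving the cone. -/
theorem Cone.transfer (h0 : 0 ≤ ν) (h1 : ν < 1)
    (hs : ∀ x, HasSum (fun i => Y.g (Y.branch i x)) 1)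
    (hC : ∀ i x y, |Real.log (Y.g (Y.branch i x)) - Real.log (Y.g (Y.branch i y))| ≤
      C * (ν * Y.dB ν x y)) (hC0 : 0 ≤ C) (hA : 0 < A) (hAC : ν * (A + C) ≤ A)
    (hv : Y.Cone ν A v) (hi : Integrable v Y.mB) :
    Y.Cone ν A fun x => ∑' i, Y.g (Y.branch i x) * v (Y.branch i x) -
      (A - ν * (A + C)) / (A * Real.exp (2 * A)) * ((m.real Y.base)⁻¹ * ∫ y, v y ∂Y.mB) := by
  set A' := ν * (A + C)
  set c := (m.real Y.base)⁻¹ * ∫ y, v y ∂Y.mB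
  set κ := (A - A') / (A * Real.exp (2 * A))
  have hb := Y.measure_base_pos
  have hc0 : 0 ≤ c := mul_nonneg (inv_nonneg.2 hb.le) (integral_nonneg hv.nonneg)
  have hA'0 : 0 ≤ A' := mul_nonneg h0 (by linarith)
  have hκ0 : 0 ≤ κ := div_nonneg (by linarith) (by positivity)
  have hsum : ∀ x, Summable fun i => Y.g (Y.branch i x) * v (Y.branch i x) := by
    intro x
    refine Summable.of_nonneg_of_le (fun i => mul_nonneg (Y.g_pos _).le (hv.nonneg _)) (fun i => ?_)
      ((hs x).summable.mul_right (Real.exp A * c))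
    exact mul_le_mul_of_nonneg_left (hv.le_mean h0 h1.le hA.le hi _) (Y.g_pos _).le
  set w : Y.base → ℝ := fun x => ∑' i, Y.g (Y.branch i x) * v (Y.branch i x)
  have hw1 : ∀ x y, w x ≤ Real.exp (A' * Y.dB ν x y) * w y := by
    intro x y
    rw [show Real.exp (A' * Y.dB ν x y) * w y =
      ∑' i, Real.exp (A' * Y.dB ν x y) * (Y.g (Y.branch i y) * v (Y.branch i y)) from
      tsum_mul_left.symm]
    refine (hsum x).tsum_le_tsum (fun i => ?_) ((hsum y).mul_left _)
    have e1 := Y.g_branch_le hC i x y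
    have e2 := hv.le (Y.branch i x) (Y.branch i y)
    rw [Y.dB_branch] at e2
    calc Y.g (Y.branch i x) * v (Y.branch i x)
        ≤ (Real.exp (C * (ν * Y.dB ν x y)) * Y.g (Y.branch i y)) *
          (Real.exp (A * (ν * Y.dB ν x y)) * v (Y.branch i y)) :=
          mul_le_mul e1 e2 (hv.nonneg _) (mul_nonneg (Real.exp_pos _).le (Y.g_pos _).le)
      _ = Real.exp (C * (ν * Y.dB ν x y)) * Real.exp (A * (ν * Y.dB ν x y)) *
          (Y.g (Y.branch i y) * v (Y.branch i y)) := by ring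
      _ = _ := by rw [← Real.exp_add]; congr 2; simp only [A']; ring
  have hw2 : ∀ x, Real.exp (-A) * c ≤ w x := by
    intro x
    have hle : ∀ i, Y.g (Y.branch i x) * (Real.exp (-A) * c) ≤
        Y.g (Y.branch i x) * v (Y.branch i x) := by
      intro i
      refine mul_le_mul_of_nonneg_left ?_ (Y.g_pos _).le
      rw [Real.exp_neg, inv_mul_le_iff₀ (Real.exp_pos _)]
      exact hv.mean_le h0 h1.le hA.le hi _
    have := ((hs x).mul_right (Real.exp (-A) * c)).summable.tsum_le_tsum hle (hsum x)
    rwa [((hs x).mul_right _).tsum_eq, one_mul] at this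
  have hκ1 : κ * A * Real.exp A = (A - A') * Real.exp (-A) := by
    simp only [κ]
    rw [Real.exp_neg, two_mul, Real.exp_add]
    field_simp
  refine ⟨fun x => ?_, fun x y => ?_⟩
  · have h2 : κ * c ≤ Real.exp (-A) * c := by
      refine mul_le_mul_of_nonneg_right ?_ hc0
      have e : κ * A * Real.exp A ≤ A * Real.exp (-A) := by
        rw [hκ1]
        exact mul_le_mul_of_nonneg_right (by linarith) (Real.exp_pos _).le
      have e' : κ * Real.exp A ≤ Real.exp (-A) := by
        rw [← mul_le_mul_iff_right₀ hA]; linarith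
      exact (le_mul_of_one_le_right hκ0 (Real.one_le_exp hA.le)).trans e'
    exact sub_nonneg.2 (h2.trans (hw2 x))
  · set r := Y.dB ν x y
    have hr0 : 0 ≤ r := Y.dB_nonneg h0 x y
    have hr1 : r ≤ 1 := Y.dB_le_one h0 h1.le x y
    have e1 : Real.exp (A * r) - 1 ≤ A * r * Real.exp A :=
      exp_sub_one_le_mul_exp (by positivity) (mul_le_of_le_one_right hA.le hr1)
    have e2 : (A - A') * r ≤ Real.exp (A * r) - Real.exp (A' * r) := by
      have f1 : (A - A') * r + 1 ≤ Real.exp ((A - A') * r) := Real.add_one_le_exp _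
      have f2 : 1 ≤ Real.exp (A' * r) := Real.one_le_exp (mul_nonneg hA'0 hr0)
      have f3 : Real.exp (A * r) = Real.exp (A' * r) * Real.exp ((A - A') * r) := by
        rw [← Real.exp_add]; ring_nf
      have f4 : 0 ≤ (A - A') * r := mul_nonneg (by linarith) hr0
      rw [f3]
      nlinarith
    have e3 : κ * c * (Real.exp (A * r) - 1) ≤ (Real.exp (A * r) - Real.exp (A' * r)) * w y := by
      calc κ * c * (Real.exp (A * r) - 1) ≤ κ * c * (A * r * Real.exp A) :=
            mul_le_mul_of_nonneg_left e1 (by positivity)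
        _ = (κ * A * Real.exp A) * (r * c) := by ring
        _ = (A - A') * r * (Real.exp (-A) * c) := by rw [hκ1]; ring
        _ ≤ _ := mul_le_mul e2 (hw2 y) (by positivity)
            (le_trans (mul_nonneg (by linarith) hr0) e2)
    have e4 := hw1 x y
    change w x - κ * c ≤ Real.exp (A * r) * (w y - κ * c)
    linarith

theorem EB_transferB {w : Y.base → ℂ} (hw : Integrable w Y.mB) : Y.EB (Y.transferB w) = Y.EB w := by
  rw [EB, EB, Y.integral_transferB hw]

theorem EB_ofReal (v : Y.base → ℝ) :
    Y.EB (fun x => (v x : ℂ)) = (((m.real Y.base)⁻¹ * ∫ x, v x ∂Y.mB : ℝ) : ℂ) := by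
  have : ∫ x, (v x : ℂ) ∂Y.mB = ((∫ x, v x ∂Y.mB : ℝ) : ℂ) := integral_ofReal
  rw [EB, this]; push_cast; rfl

/-- An element of `C_ν(B)` that is given by a function of the cone. -/
def IsCone (A : ℝ) (F : Y.Holder ν) : Prop := ∃ v : Y.base → ℝ, Y.Cone ν A v ∧ ∀ x, F x = v x

theorem Holder.integrable_of_eq_ofReal (h0 : 0 ≤ ν) (h1 : ν < 1) {F : Y.Holder ν}
    (h : ∀ x, F x = v x) : Integrable v Y.mB := by
  have := (Holder.integrable h0 h1 F).re
  simpa [h] using this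

theorem IsCone.transfer (h0 : 0 ≤ ν) (h1 : ν < 1)
    (hs : ∀ x, HasSum (fun i => Y.g (Y.branch i x)) 1)
    (hC : ∀ i x y, |Real.log (Y.g (Y.branch i x)) - Real.log (Y.g (Y.branch i y))| ≤
      C * (ν * Y.dB ν x y)) (hC0 : 0 ≤ C) (hA : 0 < A) (hAC : ν * (A + C) ≤ A)
    {T : Y.Holder ν →L[ℂ] Y.Holder ν} (hT : ∀ F x, T F x = Y.transferB F x) {F : Y.Holder ν}
    (hF : IsCone A F) :
    IsCone A (T F - ((((A - ν * (A + C)) / (A * Real.exp (2 * A)) : ℝ) : ℂ) * mean h0 h1 F) •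
      Holder.one h0) := by
  obtain ⟨v, hv, hFv⟩ := hF
  refine ⟨_, hv.transfer h0 h1 hs hC hC0 hA hAC (Holder.integrable_of_eq_ofReal h0 h1 hFv),
    fun x => ?_⟩
  have hFv' : (F : Y.base → ℂ) = fun x => (v x : ℂ) := funext hFv
  rw [Holder.sub_apply, Holder.smul_apply, Holder.one_apply, mul_one, hT, mean_apply, hFv',
    EB_ofReal, transferB_eq_tsum]
  push_cast
  rfl

theorem IsCone.norm_sub_mean_le (h0 : 0 ≤ ν) (h1 : ν < 1) (hA : 0 < A) {F : Y.Holder ν}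
    (hF : IsCone A F) : ‖F - mean h0 h1 F • Holder.one h0‖ ≤
      (2 * Real.exp A + A * Real.exp A * Real.exp A) * ‖mean h0 h1 F‖ := by
  obtain ⟨v, hv, hFv⟩ := hF
  have hb := Y.measure_base_pos
  have hi := Holder.integrable_of_eq_ofReal h0 h1 hFv
  set c := (m.real Y.base)⁻¹ * ∫ y, v y ∂Y.mB
  have hc0 : 0 ≤ c := mul_nonneg (inv_nonneg.2 hb.le) (integral_nonneg hv.nonneg)
  have hFv' : (F : Y.base → ℂ) = fun x => (v x : ℂ) := funext hFv
  have hm : mean h0 h1 F = (c : ℂ) := by rw [mean_apply, hFv', EB_ofReal]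
  have hle : ∀ x, v x ≤ Real.exp A * c := hv.le_mean h0 h1.le hA.le hi
  have h1A : 1 ≤ Real.exp A := Real.one_le_exp hA.le
  have hval : ∀ x, (F - mean h0 h1 F • Holder.one h0 : Y.Holder ν) x = ((v x - c : ℝ) : ℂ) := by
    intro x
    rw [Holder.sub_apply, Holder.smul_apply, Holder.one_apply, hFv, hm]; push_cast; ring
  rw [hm, Complex.norm_real, Real.norm_of_nonneg hc0, ← hm]
  refine Holder.norm_le_of_bound h0 _ (by positivity) (fun x => ?_) (fun x y => ?_)
  · rw [hval, Complex.norm_real, Real.norm_eq_abs, abs_le]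
    have := hle x
    have := hv.nonneg x
    have e : 0 ≤ A * Real.exp A * Real.exp A * c := by positivity
    constructor <;> nlinarith
  · have key : ∀ x y, v x - v y ≤ A * Real.exp A * Real.exp A * c * Y.dB ν x y := by
      intro x y
      have hr0 : 0 ≤ Y.dB ν x y := Y.dB_nonneg h0 x y
      have hr1 : Y.dB ν x y ≤ 1 := Y.dB_le_one h0 h1.le x y
      have e1 : Real.exp (A * Y.dB ν x y) - 1 ≤ A * Y.dB ν x y * Real.exp A :=
        exp_sub_one_le_mul_exp (by positivity) (mul_le_of_le_one_right hA.le hr1)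
      calc v x - v y ≤ (Real.exp (A * Y.dB ν x y) - 1) * v y := by linarith [hv.le x y]
        _ ≤ (A * Y.dB ν x y * Real.exp A) * (Real.exp A * c) :=
            mul_le_mul e1 (hle y) (hv.nonneg y) (by positivity)
        _ = _ := by ring
    rw [hval, hval, ← Complex.ofReal_sub, Complex.norm_real, Real.norm_eq_abs,
      sub_sub_sub_cancel_right]
    have hr0 : 0 ≤ Y.dB ν x y := Y.dB_nonneg h0 x y
    have e : 0 ≤ 2 * Real.exp A * c * Y.dB ν x y := by positivity
    rw [abs_le]
    have h1 := key x y
    have h2 := key y x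
    rw [Y.dB_comm y x] at h2
    constructor <;> nlinarith

theorem mean_one (h0 : 0 ≤ ν) (h1 : ν < 1) : mean h0 h1 (Holder.one h0 : Y.Holder ν) = 1 := by
  rw [mean_apply, Holder.coe_one]
  exact EB_const 1

theorem mean_transfer (h0 : 0 ≤ ν) (h1 : ν < 1) {T : Y.Holder ν →L[ℂ] Y.Holder ν}
    (hT : ∀ F x, T F x = Y.transferB F x) (F : Y.Holder ν) :
    mean h0 h1 (T F) = mean h0 h1 F := by
  rw [mean_apply, mean_apply, ← EB_transferB (Holder.integrable h0 h1 F)]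
  congr 1
  exact funext fun x => hT F x

theorem transfer_one (h0 : 0 ≤ ν) (h1 : ν < 1) (hν : Y.BoundedDistortion Y.g ν)
    {T : Y.Holder ν →L[ℂ] Y.Holder ν}
    (hT : ∀ F x, T F x = Y.transferB F x) : T (Holder.one h0) = Holder.one h0 := by
  refine Holder.ext fun x => ?_
  rw [hT, Holder.coe_one, transferB_one Y h0 h1 hν]

/-- Exponential convergence of the iterates of the transfer operator to the mean, on `C_ν(B)`. -/
theorem exists_norm_pow_transfer_sub_le (h0 : 0 ≤ ν) (h1 : ν < 1) (hν : Y.BoundedDistortion Y.g ν)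
    {T : Y.Holder ν →L[ℂ] Y.Holder ν} (hT : ∀ F x, T F x = Y.transferB F x) :
    ∃ D ρ : ℝ, 0 ≤ ρ ∧ ρ < 1 ∧ ∀ (n : ℕ) (F : Y.Holder ν),
      ‖(T ^ n) F - mean h0 h1 F • Holder.one h0‖ ≤ D * ρ ^ n * ‖F‖ := by
  obtain ⟨C, hC0, hC⟩ := Y.exists_log_branch_bound hν
  have hs := Y.hasSum_g_branch h0 h1 hν
  have hone := transfer_one h0 h1 hν hT
  have hν1 : 0 < 1 - ν := by linarith
  -- any `A` with `ν (A + C) < A` does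
  obtain ⟨A, hA, hAC⟩ : ∃ A > 0, ν * (A + C) < A := by
    refine ⟨(ν * C + 1) / (1 - ν), by positivity, ?_⟩
    have : (ν * C + 1) / (1 - ν) * (1 - ν) = ν * C + 1 := div_mul_cancel₀ _ hν1.ne'
    linarith
  set κ : ℝ := (A - ν * (A + C)) / (A * Real.exp (2 * A))
  have hκ0 : 0 < κ := div_pos (by linarith) (by positivity)
  have hκ1 : κ ≤ 1 := by
    refine div_le_one_of_le₀ ?_ (by positivity)
    have e1 : A ≤ A * Real.exp (2 * A) :=
      le_mul_of_one_le_right hA.le (Real.one_le_exp (by positivity))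
    have e2 : 0 ≤ ν * (A + C) := by positivity
    linarith
  have hpow : ∀ n, (T ^ n) (Holder.one h0) = Holder.one h0 := by
    intro n
    induction n with
    | zero => rfl
    | succ n ih => rw [pow_succ', mul_apply_eq_comp, ih, hone]
  -- remove at each step a fixed proportion of the mean
  have hiter : ∀ F : Y.Holder ν, IsCone A F → ∀ n : ℕ,
      IsCone A ((T ^ n) F - ((1 - (1 - κ : ℂ) ^ n) * mean h0 h1 F) • Holder.one h0) ∧
      mean h0 h1 ((T ^ n) F - ((1 - (1 - κ : ℂ) ^ n) * mean h0 h1 F) • Holder.one h0) =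
        (1 - κ : ℂ) ^ n * mean h0 h1 F := by
    intro F hF n
    induction n with
    | zero => simpa using hF
    | succ n ih =>
      obtain ⟨ih1, ih2⟩ := ih
      have e : (T ^ (n + 1)) F - ((1 - (1 - κ : ℂ) ^ (n + 1)) * mean h0 h1 F) • Holder.one h0 =
          T ((T ^ n) F - ((1 - (1 - κ : ℂ) ^ n) * mean h0 h1 F) • Holder.one h0) -
          ((κ : ℂ) * mean h0 h1 ((T ^ n) F - ((1 - (1 - κ : ℂ) ^ n) * mean h0 h1 F) •
            Holder.one h0)) • Holder.one h0 := by
        rw [ih2, map_sub, map_smul, hone, pow_succ' T, mul_apply_eq_comp, sub_sub,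
          ← add_smul]
        congr 2
        ring
      rw [e]
      refine ⟨ih1.transfer h0 h1 hs hC hC0.le hA hAC.le hT, ?_⟩
      rw [map_sub, map_smul, mean_transfer h0 h1 hT, mean_one, ih2, smul_eq_mul]
      ring
  set c₁ := 2 * Real.exp A + A * Real.exp A * Real.exp A
  have hc₁ : 0 < c₁ := by positivity
  have hconeF : ∀ F : Y.Holder ν, IsCone A F → ∀ n : ℕ,
      ‖(T ^ n) F - mean h0 h1 F • Holder.one h0‖ ≤ c₁ * ((1 - κ) ^ n * ‖mean h0 h1 F‖) := by
    intro F hF n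
    obtain ⟨i1, i2⟩ := hiter F hF n
    have h := i1.norm_sub_mean_le h0 h1 hA
    rw [i2, sub_sub, ← add_smul] at h
    have e : (1 - (1 - κ : ℂ) ^ n) * mean h0 h1 F + (1 - κ : ℂ) ^ n * mean h0 h1 F =
      mean h0 h1 F := by ring
    rw [e] at h
    refine h.trans (le_of_eq ?_)
    rw [norm_mul, norm_pow, ← Complex.ofReal_one, ← Complex.ofReal_sub, Complex.norm_real,
      Real.norm_of_nonneg (by linarith)]
  -- real valued functions become elements of the cone when a constant is added
  set c₂ := c₁ * (‖mean (Y := Y) h0 h1‖ * (1 + (1 + A⁻¹) * ‖(Holder.one h0 : Y.Holder ν)‖))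
  have hreal : ∀ (F : Y.Holder ν) (v : Y.base → ℝ), (∀ x, F x = v x) → ∀ n : ℕ,
      ‖(T ^ n) F - mean h0 h1 F • Holder.one h0‖ ≤ c₂ * (1 - κ) ^ n * ‖F‖ := by
    intro F v hFv n
    set c := ‖F‖ * (1 + A⁻¹)
    have hc : 0 ≤ c := by positivity
    have hAc : A * (c - ‖F‖) = ‖F‖ := by simp only [c]; field_simp; ring
    have hvb : ∀ x, |v x| ≤ ‖F‖ := by
      intro x
      have := Holder.norm_apply_le F x
      rwa [hFv, Complex.norm_real, Real.norm_eq_abs] at this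
    have hcone : IsCone A (F + (c : ℂ) • Holder.one h0) := by
      refine ⟨fun x => v x + c, ⟨fun x => ?_, fun x y => ?_⟩, fun x => ?_⟩
      · have h3 := (abs_le.1 (hvb x)).1
        have h4 : ‖F‖ ≤ c := le_mul_of_one_le_right (norm_nonneg _) (by simp [hA.le])
        linarith
      · have hd := Y.dB_nonneg h0 x y
        have h3 := Holder.norm_sub_le h0 F x y
        rw [hFv, hFv, ← Complex.ofReal_sub, Complex.norm_real, Real.norm_eq_abs] at h3
        have h4 := (abs_le.1 h3).2
        have h5 := (abs_le.1 (hvb y)).1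
        have h6 := Real.add_one_le_exp (A * Y.dB ν x y)
        have h7 : ‖F‖ ≤ A * (v y + c) := by rw [← hAc]; gcongr; linarith
        have h8 : ‖F‖ * Y.dB ν x y ≤ A * (v y + c) * Y.dB ν x y :=
          mul_le_mul_of_nonneg_right h7 hd
        have h9 : 0 ≤ v y + c := by
          have : 0 ≤ A * (v y + c) := (norm_nonneg _).trans h7
          exact nonneg_of_mul_nonneg_right this hA
        have h10 := mul_le_mul_of_nonneg_right h6 h9
        linarith
      · rw [Holder.add_apply, Holder.smul_apply, Holder.one_apply, hFv]; push_cast; ring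
    have h := hconeF _ hcone n
    have e : (T ^ n) (F + (c : ℂ) • Holder.one h0) - mean h0 h1 (F + (c : ℂ) • Holder.one h0) •
        Holder.one h0 = (T ^ n) F - mean h0 h1 F • Holder.one h0 := by
      rw [map_add, map_smul, hpow, map_add, map_smul, mean_one, smul_eq_mul, mul_one, add_smul]
      abel
    rw [e] at h
    refine h.trans ?_
    have h3 : ‖mean h0 h1 (F + (c : ℂ) • Holder.one h0)‖ ≤
        ‖mean (Y := Y) h0 h1‖ * (‖F‖ * (1 + (1 + A⁻¹) * ‖(Holder.one h0 : Y.Holder ν)‖)) := by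
      refine (ContinuousLinearMap.le_opNorm _ _).trans (mul_le_mul_of_nonneg_left ?_
        (norm_nonneg _))
      refine (norm_add_le _ _).trans (le_of_eq ?_)
      rw [norm_smul, Complex.norm_real, Real.norm_of_nonneg hc]
      simp only [c]; ring
    calc c₁ * ((1 - κ) ^ n * ‖mean h0 h1 (F + (c : ℂ) • Holder.one h0)‖)
        ≤ c₁ * ((1 - κ) ^ n * (‖mean (Y := Y) h0 h1‖ *
          (‖F‖ * (1 + (1 + A⁻¹) * ‖(Holder.one h0 : Y.Holder ν)‖)))) := by
          have : 0 ≤ 1 - κ := by linarith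
          gcongr
      _ = _ := by simp only [c₂]; ring
  refine ⟨2 * c₂, 1 - κ, by linarith, by linarith, fun n F => ?_⟩
  obtain ⟨F₁, hF₁, hn₁⟩ := Holder.exists_of_bound h0 (norm_nonneg F)
    (u := fun x => (((F x).re : ℝ) : ℂ))
    (fun x => by
      rw [Complex.norm_real]
      exact (Complex.abs_re_le_norm _).trans (Holder.norm_apply_le F x))
    (fun x y => by
      rw [← Complex.ofReal_sub, Complex.norm_real, ← Complex.sub_re]
      exact (Complex.abs_re_le_norm _).trans (Holder.norm_sub_le h0 F x y))
  obtain ⟨F₂, hF₂, hn₂⟩ := Holder.exists_of_bound h0 (norm_nonneg F)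
    (u := fun x => (((F x).im : ℝ) : ℂ))
    (fun x => by
      rw [Complex.norm_real]
      exact (Complex.abs_im_le_norm _).trans (Holder.norm_apply_le F x))
    (fun x y => by
      rw [← Complex.ofReal_sub, Complex.norm_real, ← Complex.sub_im]
      exact (Complex.abs_im_le_norm _).trans (Holder.norm_sub_le h0 F x y))
  have hF : F = F₁ + Complex.I • F₂ := by
    refine Holder.ext fun x => ?_
    rw [Holder.add_apply, Holder.smul_apply, hF₁, hF₂, mul_comm, Complex.re_add_im]
  have r1 := hreal F₁ _ hF₁ n
  have r2 := hreal F₂ _ hF₂ n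
  have hc₂ : 0 ≤ c₂ * (1 - κ) ^ n := by
    have : 0 ≤ 1 - κ := by linarith
    positivity
  have e : (T ^ n) F - mean h0 h1 F • Holder.one h0 =
      ((T ^ n) F₁ - mean h0 h1 F₁ • Holder.one h0) +
      Complex.I • ((T ^ n) F₂ - mean h0 h1 F₂ • Holder.one h0) := by
    rw [hF, map_add, map_add, map_smul, map_smul, smul_eq_mul, add_smul, smul_sub, mul_smul]
    abel
  rw [e]
  refine (norm_add_le _ _).trans ?_
  rw [norm_smul, Complex.norm_I, one_mul]
  have r3 := mul_le_mul_of_nonneg_left hn₁ hc₂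
  have r4 := mul_le_mul_of_nonneg_left hn₂ hc₂
  linarith

end YoungTower

/-! ### Perturbation of a simple isolated eigenvalue -/

section Perturbation

variable {E : Type*} [NormedAddCommGroup E] [NormedSpace ℂ E]

/-- If `T^n` converges exponentially to the projection `x ↦ P x • e`, then `I - T` is invertible
on the kernel of `P`. -/
theorem exists_resolvent_of_norm_pow_sub_le [CompleteSpace E] {T : E →L[ℂ] E} {P : E →L[ℂ] ℂ}
    {e : E} (hPe : P e = 1)
    (hTe : T e = e) (hPT : ∀ x, P (T x) = P x) {D ρ : ℝ} (hρ0 : 0 ≤ ρ) (hρ1 : ρ < 1)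
    (h : ∀ (n : ℕ) (x : E), ‖(T ^ n) x - P x • e‖ ≤ D * ρ ^ n * ‖x‖) :
    ∃ Q : E →L[ℂ] E, (∀ x, P (Q x) = P x) ∧ (∀ x, P x = 0 → Q x - T (Q x) = x) ∧
      ∀ x, P x = 0 → Q (x - T x) = x := by
  set S : E →L[ℂ] E := T - P.smulRight e
  have hS : ∀ x, S x = T x - P x • e := fun x => rfl
  have hSn : ∀ (n : ℕ) (x : E), (S ^ (n + 1)) x = (T ^ (n + 1)) x - P x • e := by
    intro n x
    induction n with
    | zero => simp [hS]
    | succ n ih =>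
      have hPn : P ((T ^ (n + 1)) x) = P x := by
        clear ih
        induction n with
        | zero => simp [hPT]
        | succ n ih => rw [pow_succ' T, mul_apply_eq_comp, hPT, ih]
      have hT2 : (T ^ (n + 1 + 1)) x = T ((T ^ (n + 1)) x) := by
        rw [pow_succ' T (n + 1), mul_apply_eq_comp]
      rw [hT2, pow_succ' S, mul_apply_eq_comp, ih, hS, map_sub, map_smul, hTe,
        map_sub, map_smul, hPn, hPe, smul_eq_mul, mul_one,
        sub_self, zero_smul, sub_zero]
  obtain ⟨n, hn⟩ : ∃ n : ℕ, D * ρ ^ (n + 1) < 1 := by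
    have ht : Tendsto (fun n : ℕ => D * ρ ^ (n + 1)) atTop (𝓝 0) := by
      simpa using ((tendsto_pow_atTop_nhds_zero_of_lt_one hρ0 hρ1).comp
        (tendsto_add_atTop_nat 1)).const_mul D
    exact (ht.eventually (gt_mem_nhds one_pos)).exists
  have hnorm : ‖S ^ (n + 1)‖ < 1 := by
    refine lt_of_le_of_lt (b := max (D * ρ ^ (n + 1)) 0) ?_ (max_lt hn one_pos)
    refine ContinuousLinearMap.opNorm_le_bound _ (le_max_right _ _) fun x => ?_
    rw [hSn]
    exact (h (n + 1) x).trans (mul_le_mul_of_nonneg_right (le_max_left _ _) (norm_nonneg x))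
  have hu : IsUnit (1 - S) := by
    have h1 : IsUnit (1 - S ^ (n + 1)) := (Units.oneSub _ hnorm).isUnit
    rw [← mul_neg_geom_sum S (n + 1)] at h1
    refine (Commute.isUnit_mul_iff ?_).1 h1 |>.1
    rw [Commute, SemiconjBy, mul_neg_geom_sum, geom_sum_mul_neg]
  obtain ⟨U, hU⟩ := hu
  have hUQ : ∀ x, (1 - S) ((↑U⁻¹ : E →L[ℂ] E) x) = x := by
    intro x
    have := U.mul_inv
    rw [hU] at this
    exact congrArg (fun A : E →L[ℂ] E => A x) this
  have hQU : ∀ x, (↑U⁻¹ : E →L[ℂ] E) ((1 - S) x) = x := by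
    intro x
    have := U.inv_mul
    rw [hU] at this
    exact congrArg (fun A : E →L[ℂ] E => A x) this
  have h1S : ∀ x, (1 - S) x = x - T x + P x • e := by
    intro x
    change x - (T x - P x • e) = _
    abel
  have hPQ : ∀ x, P ((↑U⁻¹ : E →L[ℂ] E) x) = P x := by
    intro x
    have := congrArg P (hUQ x)
    rw [h1S, map_add, map_sub, hPT, sub_self, zero_add, map_smul, hPe, smul_eq_mul, mul_one] at this
    exact this
  refine ⟨↑U⁻¹, hPQ, fun x hx => ?_, fun x hx => ?_⟩
  · have := hUQ x
    rwa [h1S, hPQ, hx, zero_smul, add_zero] at this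
  · have := hQU x
    rwa [h1S, hx, zero_smul, add_zero] at this

/-- Perturbation of the eigenvalue `1` of an operator `T` that is simple and isolated (in the sense
that `I - T` is invertible on `ker P`) along a family `R t` of operators that is differentiable at
`0` on the eigenvector `e`: for small `t`, `R t` has exactly one eigenvalue `lam t` near `1`, and an
eigenvector `e + w t` with `w t = t Q d + O(t ^ 2)`. -/
theorem exists_eigenvalue_perturbation [CompleteSpace E] {T Q : E →L[ℂ] E} {P : E →L[ℂ] ℂ}
    {e : E} (hPe : P e = 1)
    (hTe : T e = e) (hPT : ∀ x, P (T x) = P x) (hPQ : ∀ x, P (Q x) = P x)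
    (hQ : ∀ x, P x = 0 → Q x - T (Q x) = x) (hQ' : ∀ x, P x = 0 → Q (x - T x) = x)
    {R : ℝ → E →L[ℂ] E} {C : ℝ} (hC : 0 ≤ C) (hR : ∀ t, ‖R t - T‖ ≤ C * |t|) {d : E} (hd : P d = 0)
    (hRd : ∀ t : ℝ, ‖R t e - T e - (t : ℂ) • d‖ ≤ C * t ^ 2) :
    ∃ ε > 0, ∃ δ > 0, ∃ M : ℝ, ∃ w : ℝ → E, ∃ lam : ℝ → ℂ, ∀ t : ℝ, |t| < δ →
      P (w t) = 0 ∧ R t (e + w t) = lam t • (e + w t) ∧ ‖w t - (t : ℂ) • Q d‖ ≤ M * t ^ 2 ∧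
      ‖lam t - 1‖ < ε ∧ ∀ z u, u ≠ 0 → ‖z - 1‖ < ε → R t u = z • u → z = lam t := by
  set p := ‖P‖
  set k := ‖Q‖
  set a := 1 + p * ‖e‖
  have ha : 0 < a := by positivity
  have hpr : ∀ x, ‖x - P x • e‖ ≤ a * ‖x‖ := by
    intro x
    refine (norm_sub_le _ _).trans ?_
    rw [norm_smul]
    have := mul_le_mul_of_nonneg_right (P.le_opNorm x) (norm_nonneg e)
    simp only [a]; linarith
  -- `e + w` is an eigenvector of `R t`, with `P w = 0`, when `w` is a fixed point of `G t`; the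
  -- eigenvalue is then `1 + P ((R t - T) (e + w))`
  set G : ℝ → E → E := fun t w =>
    Q (((R t - T) (e + w) - P ((R t - T) (e + w)) • e) - P ((R t - T) (e + w)) • w)
  have hD : ∀ t x, ‖(R t - T) x‖ ≤ C * |t| * ‖x‖ := fun t x =>
    ((R t - T).le_opNorm x).trans (mul_le_mul_of_nonneg_right (hR t) (norm_nonneg x))
  have hPD : ∀ t x, ‖P ((R t - T) x)‖ ≤ p * (C * |t|) * ‖x‖ := fun t x =>
    (P.le_opNorm _).trans (by
      rw [mul_assoc]; exact mul_le_mul_of_nonneg_left (hD t x) (norm_nonneg _))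
  have hprD : ∀ t x, ‖(R t - T) x - P ((R t - T) x) • e‖ ≤ a * (C * |t|) * ‖x‖ := fun t x =>
    (hpr _).trans (by rw [mul_assoc]; exact mul_le_mul_of_nonneg_left (hD t x) ha.le)
  set K₀ := k * (a + p + p * (‖e‖ + 1))
  have hK₀ : 0 ≤ K₀ := by positivity
  have hLip : ∀ t w w', ‖w‖ ≤ 1 → ‖w'‖ ≤ 1 → ‖G t w - G t w'‖ ≤ K₀ * (C * |t|) * ‖w - w'‖ := by
    intro t w w' hw hw'
    have e1 : G t w - G t w' = Q (((R t - T) (w - w') - P ((R t - T) (w - w')) • e) -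
        P ((R t - T) (w - w')) • w - P ((R t - T) (e + w')) • (w - w')) := by
      simp only [G]
      rw [← map_sub]
      congr 1
      simp only [map_add, map_sub, add_smul, sub_smul, smul_sub]
      abel
    have hn : ‖e + w'‖ ≤ ‖e‖ + 1 := (norm_add_le _ _).trans (by linarith)
    have b1 := hprD t (w - w')
    have b2 : ‖P ((R t - T) (w - w')) • w‖ ≤ p * (C * |t|) * ‖w - w'‖ := by
      rw [norm_smul]
      exact (mul_le_of_le_one_right (norm_nonneg _) hw).trans (hPD t _)
    have b3 : ‖P ((R t - T) (e + w')) • (w - w')‖ ≤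
        p * (C * |t|) * (‖e‖ + 1) * ‖w - w'‖ := by
      rw [norm_smul]
      exact mul_le_mul_of_nonneg_right ((hPD t _).trans
        (mul_le_mul_of_nonneg_left hn (by positivity))) (norm_nonneg _)
    rw [e1]
    refine (Q.le_opNorm _).trans ?_
    have b4 := (norm_sub_le (((R t - T) (w - w') - P ((R t - T) (w - w')) • e) -
        P ((R t - T) (w - w')) • w) (P ((R t - T) (e + w')) • (w - w'))).trans
        (add_le_add_left (norm_sub_le _ _) _)
    calc k * _ ≤ k * (a * (C * |t|) * ‖w - w'‖ + p * (C * |t|) * ‖w - w'‖ +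
          p * (C * |t|) * (‖e‖ + 1) * ‖w - w'‖) :=
          mul_le_mul_of_nonneg_left (b4.trans (by linarith)) (norm_nonneg _)
      _ = _ := by simp only [K₀]; ring
  set K₁ := k * a * ‖e‖
  have hK₁ : 0 ≤ K₁ := by positivity
  have hG0 : ∀ t, ‖G t 0‖ ≤ K₁ * (C * |t|) := by
    intro t
    simp only [G, smul_zero, sub_zero, add_zero]
    refine (Q.le_opNorm _).trans ((mul_le_mul_of_nonneg_left (hprD t e) (norm_nonneg _)).trans
      (le_of_eq ?_))
    simp only [K₁, k]; ring
  -- the smallness conditions on `z - 1` and `t`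
  set ε := 1 / (4 * (k + 1))
  have hε : 0 < ε := by positivity
  have hkε : k * ε ≤ 1 / 4 := by
    simp only [ε]
    rw [mul_one_div, div_le_div_iff₀ (by positivity) (by norm_num)]
    linarith
  obtain ⟨δ, hδ, hδ'⟩ : ∃ δ > 0, ∀ t : ℝ, |t| < δ → K₀ * (C * |t|) ≤ 1 / 4 ∧
      K₁ * (C * |t|) ≤ 1 / 4 ∧ k * a * (C * |t|) ≤ 1 / 4 ∧ p * (C * |t|) * (‖e‖ + 1) < ε ∧
      p * (C * |t|) * (‖e‖ + 1) < 1 := by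
    have hlim : ∀ c : ℝ, Tendsto (fun t : ℝ => c * (C * |t|)) (𝓝 0) (𝓝 0) := by
      intro c
      have : Continuous fun t : ℝ => c * (C * |t|) := by fun_prop
      simpa using this.tendsto 0
    have h4 : (0 : ℝ) < 1 / 4 := by norm_num
    have hev := ((hlim K₀).eventually (ge_mem_nhds h4)).and
      (((hlim K₁).eventually (ge_mem_nhds h4)).and (((hlim (k * a)).eventually
      (ge_mem_nhds h4)).and (((hlim (p * (‖e‖ + 1))).eventually (gt_mem_nhds hε)).and
      ((hlim (p * (‖e‖ + 1))).eventually (gt_mem_nhds one_pos)))))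
    obtain ⟨δ, hδ, h⟩ := Metric.eventually_nhds_iff.1 hev
    refine ⟨δ, hδ, fun t ht => ?_⟩
    obtain ⟨h1, h2, h3, h4, h5⟩ := h (y := t) (by simpa using ht)
    exact ⟨h1, h2, h3, by linarith, by linarith⟩
  have hfix : ∀ t : ℝ, |t| < δ → ∃ w, ‖w‖ ≤ 1 ∧ G t w = w := by
    intro t ht
    obtain ⟨h1, h2, -⟩ := hδ' t ht
    have hbound : ∀ w, ‖w‖ ≤ 1 → ‖G t w‖ ≤ 1 := by
      intro w hw
      have e1 := hLip t w 0 hw (by simp)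
      rw [sub_zero] at e1
      have e2 := norm_sub_norm_le (G t w) (G t 0)
      have e3 : K₀ * (C * |t|) * ‖w‖ ≤ 1 / 4 * 1 := mul_le_mul h1 hw (norm_nonneg _) (by norm_num)
      have e4 := hG0 t
      linarith
    have hmaps : Set.MapsTo (G t) (Metric.closedBall 0 1) (Metric.closedBall 0 1) := by
      intro w hw
      rw [mem_closedBall_zero_iff] at hw ⊢
      exact hbound w hw
    have hcontr : ContractingWith (1 / 4 : ℝ≥0) (hmaps.restrict (G t) _ _) := by
      refine ⟨by rw [← NNReal.coe_lt_coe]; norm_num, LipschitzWith.of_dist_le_mul fun x y => ?_⟩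
      rw [Subtype.dist_eq, Subtype.dist_eq, Set.MapsTo.val_restrict_apply,
        Set.MapsTo.val_restrict_apply, dist_eq_norm, dist_eq_norm]
      refine (hLip t x y (mem_closedBall_zero_iff.1 x.2) (mem_closedBall_zero_iff.1 y.2)).trans ?_
      exact mul_le_mul_of_nonneg_right (h1.trans (by norm_num)) (norm_nonneg _)
    obtain ⟨w, hw, hw', -⟩ := hcontr.exists_fixedPoint' (Metric.isClosed_closedBall.isComplete)
      hmaps (x := 0) (by simp) (edist_ne_top _ _)
    exact ⟨w, mem_closedBall_zero_iff.1 hw, hw'⟩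
  have huniq : ∀ t : ℝ, |t| < δ → ∀ w w', ‖w‖ ≤ 1 → ‖w'‖ ≤ 1 → G t w = w → G t w' = w' →
      w = w' := by
    intro t ht w w' hw hw' h1 h2
    have := hLip t w w' hw hw'
    rw [h1, h2] at this
    have h3 := mul_le_mul_of_nonneg_right (hδ' t ht).1 (norm_nonneg (w - w'))
    have h4 : ‖w - w'‖ ≤ 0 := by linarith
    exact sub_eq_zero.1 (norm_le_zero_iff.1 h4)
  choose! w hw1 hwG using hfix
  refine ⟨ε, hε, δ, hδ, k * a * C + K₀ * C * (2 * K₁ * C), w,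
    fun t => 1 + P ((R t - T) (e + w t)), fun t ht => ?_⟩
  obtain ⟨s1, s2, s3, s4, s5⟩ := hδ' t ht
  have hn : ‖e + w t‖ ≤ ‖e‖ + 1 := (norm_add_le _ _).trans (by linarith [hw1 t ht])
  have hμ : ‖P ((R t - T) (e + w t))‖ ≤ p * (C * |t|) * (‖e‖ + 1) :=
    (hPD t _).trans (mul_le_mul_of_nonneg_left hn (by positivity))
  have hPpr : ∀ x, P (x - P x • e) = 0 := fun x => by
    rw [map_sub, map_smul, hPe, smul_eq_mul, mul_one, sub_self]
  have hPw : P (w t) = 0 := by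
    have h1 := congrArg P (hwG t ht)
    simp only [G] at h1
    rw [hPQ, map_sub, hPpr, zero_sub, map_smul, smul_eq_mul] at h1
    have h2 : (1 + P ((R t - T) (e + w t))) * P (w t) = 0 := by linear_combination -h1
    rcases mul_eq_zero.1 h2 with h3 | h3
    · exfalso
      have h4 : P ((R t - T) (e + w t)) = -1 := by linear_combination h3
      rw [h4, norm_neg, norm_one] at hμ
      linarith
    · exact h3
  have hsmall : ‖w t‖ ≤ 2 * K₁ * (C * |t|) := by
    have e1 := hLip t (w t) 0 (hw1 t ht) (by simp)
    rw [sub_zero, hwG t ht] at e1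
    have e2 := norm_sub_norm_le (w t) (G t 0)
    have e3 := mul_le_mul_of_nonneg_right s1 (norm_nonneg (w t))
    have e4 := hG0 t
    have e5 := norm_nonneg (w t)
    have e6 : 0 ≤ K₁ * (C * |t|) := by positivity
    linarith
  refine ⟨hPw, ?_, ?_, ?_, ?_⟩
  · have h1 := hQ (((R t - T) (e + w t) - P ((R t - T) (e + w t)) • e) -
      P ((R t - T) (e + w t)) • w t) (by
        rw [map_sub, hPpr, map_smul, hPw, smul_zero, sub_zero])
    have h2 : w t - T (w t) = ((R t - T) (e + w t) - P ((R t - T) (e + w t)) • e) -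
      P ((R t - T) (e + w t)) • w t := by
      have h3 := hwG t ht
      simp only [G] at h3
      rwa [h3] at h1
    have h3 : R t (e + w t) = T e + T (w t) + (R t - T) (e + w t) := by
      rw [sub_apply, map_add T]; abel
    rw [h3, hTe, add_smul, one_smul, smul_add]
    generalize (P ((R t - T) (e + w t))) = μ at *
    generalize (R t - T) (e + w t) = y at *
    have h4 : T (w t) = w t - (y - μ • e - μ • w t) := by rw [← h2]; abel
    rw [h4]; abel
  · have e1 := hLip t (w t) 0 (hw1 t ht) (by simp)
    rw [sub_zero, hwG t ht] at e1
    have e2 : G t 0 - (t : ℂ) • Q d = Q ((R t e - T e - (t : ℂ) • d) -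
        P (R t e - T e - (t : ℂ) • d) • e) := by
      simp only [G, smul_zero, sub_zero, add_zero]
      rw [← map_smul, ← map_sub, map_sub P (R t e - T e), map_smul P, hd, smul_zero, sub_zero]
      congr 1
      rw [sub_apply]
      abel
    have e3 : ‖G t 0 - (t : ℂ) • Q d‖ ≤ k * (a * (C * t ^ 2)) := by
      rw [e2]
      exact (Q.le_opNorm _).trans (mul_le_mul_of_nonneg_left ((hpr _).trans
        (mul_le_mul_of_nonneg_left (hRd t) ha.le)) (norm_nonneg _))
    have e4 : K₀ * (C * |t|) * ‖w t‖ ≤ K₀ * (C * |t|) * (2 * K₁ * (C * |t|)) :=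
      mul_le_mul_of_nonneg_left hsmall (by positivity)
    have e5 : w t - (t : ℂ) • Q d = (w t - G t 0) + (G t 0 - (t : ℂ) • Q d) := by abel
    rw [e5]
    refine (norm_add_le _ _).trans ?_
    have e6 : |t| * |t| = t ^ 2 := by rw [← abs_mul, ← pow_two, abs_of_nonneg (sq_nonneg t)]
    calc _ ≤ K₀ * (C * |t|) * (2 * K₁ * (C * |t|)) + k * (a * (C * t ^ 2)) :=
          add_le_add (e1.trans e4) e3
      _ = K₀ * C * (2 * K₁ * C) * (|t| * |t|) + k * a * C * t ^ 2 := by ring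
      _ = _ := by rw [e6]; ring
  · rw [add_sub_cancel_left]
    exact hμ.trans_lt s4
  · intro z u hu hz hzu
    -- decompose the eigenvector as `c e + v` with `P v = 0`
    obtain ⟨v, hv⟩ : ∃ v, v = u - P u • e := ⟨_, rfl⟩
    have hPv : P v = 0 := by rw [hv, hPpr]
    have hmain : v - T v = ((R t - T) u - P ((R t - T) u) • e) - (z - 1) • v := by
      have h1 : P ((R t - T) u) = (z - 1) * P u := by
        rw [sub_apply, map_sub, hzu, hPT, map_smul, smul_eq_mul]; ring
      have h2 : T v = T u - P u • e := by rw [hv, map_sub, map_smul, hTe]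
      rw [h1, h2, sub_apply, hzu, hv]
      simp only [sub_smul, smul_sub, one_smul, mul_smul]
      abel
    have hvQ : v = Q (((R t - T) u - P ((R t - T) u) • e) - (z - 1) • v) := by
      rw [← hmain, hQ' v hPv]
    have hvn : ‖v‖ ≤ k * (a * (C * |t|) * ‖u‖) + 1 / 4 * ‖v‖ := by
      have h1 : ‖v‖ ≤ k * (a * (C * |t|) * ‖u‖ + ε * ‖v‖) := by
        conv_lhs => rw [hvQ]
        refine (Q.le_opNorm _).trans (mul_le_mul_of_nonneg_left ?_ (norm_nonneg _))
        refine (norm_sub_le _ _).trans (add_le_add (hprD t u) ?_)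
        rw [norm_smul]
        exact mul_le_mul_of_nonneg_right hz.le (norm_nonneg _)
      have h2 := mul_le_mul_of_nonneg_right hkε (norm_nonneg v)
      linarith
    have hvn' := norm_nonneg v
    have hPu : P u ≠ 0 := by
      intro h0
      have huv : u = v := by rw [hv, h0, zero_smul, sub_zero]
      rw [← huv] at hvn
      have h2 := mul_le_mul_of_nonneg_right s3 (norm_nonneg u)
      have h3 : ‖u‖ ≤ 0 := by
        have := norm_nonneg u
        linarith
      exact hu (norm_le_zero_iff.1 h3)
    obtain ⟨y, hy⟩ : ∃ y, y = (P u)⁻¹ • v := ⟨_, rfl⟩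
    have huy : u = P u • (e + y) := by
      rw [hy, smul_add, smul_smul, mul_inv_cancel₀ hPu, one_smul, hv]; abel
    have hyn : ‖y‖ ≤ k * (a * (C * |t|) * (‖e‖ + ‖y‖)) + 1 / 4 * ‖y‖ := by
      have h1 : ‖u‖ ≤ ‖P u‖ * (‖e‖ + ‖y‖) := by
        conv_lhs => rw [huy]
        rw [norm_smul]
        exact mul_le_mul_of_nonneg_left (norm_add_le _ _) (norm_nonneg _)
      have h2 : ‖v‖ = ‖P u‖ * ‖y‖ := by
        rw [hy, norm_smul, norm_inv, mul_inv_cancel_left₀ (norm_ne_zero_iff.2 hPu)]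
      have hPu' : 0 < ‖P u‖ := norm_pos_iff.2 hPu
      rw [← mul_le_mul_iff_right₀ hPu', ← h2]
      refine hvn.trans ?_
      have h3 : k * (a * (C * |t|) * ‖u‖) ≤ k * (a * (C * |t|) * (‖P u‖ * (‖e‖ + ‖y‖))) := by
        gcongr
      rw [h2]; linarith
    have hy1 : ‖y‖ ≤ 1 := by
      have h2 := mul_le_mul_of_nonneg_right s3 (norm_nonneg y)
      have h3 : k * a * ‖e‖ * (C * |t|) ≤ 1 / 4 := s2
      have := norm_nonneg y
      linarith
    have hzy : z - 1 = P ((R t - T) (e + y)) := by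
      have h1 : P ((R t - T) u) = (z - 1) * P u := by
        rw [sub_apply, map_sub, hzu, hPT, map_smul, smul_eq_mul]; ring
      rw [huy, map_smul, map_smul, map_smul, map_add P e, hPe, hy, map_smul, hPv, smul_zero,
        add_zero, ← hy, smul_eq_mul, smul_eq_mul, mul_one] at h1
      exact mul_right_cancel₀ hPu (by linear_combination -h1)
    have hGy : G t y = y := by
      have h1 := congrArg (fun x => (P u)⁻¹ • x) hvQ
      rw [← hy, ← map_smul] at h1
      have h2 : (P u)⁻¹ • (((R t - T) u - P ((R t - T) u) • e) - (z - 1) • v) =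
          ((R t - T) (e + y) - P ((R t - T) (e + y)) • e) - P ((R t - T) (e + y)) • y := by
        have h3 : (P u)⁻¹ • u = e + y := by
          conv_lhs => rw [huy]
          rw [smul_smul, map_smul, map_add, hPe, hy, map_smul, hPv, smul_zero, add_zero,
            smul_eq_mul, mul_one, inv_mul_cancel₀ hPu, one_smul]
        rw [hzy, ← h3, hy]
        simp only [map_smul, smul_sub, smul_smul, smul_eq_mul]
        ring_nf
      rw [h2] at h1
      exact h1.symm
    have := huniq t ht y (w t) hy1 (hw1 t ht) hGy (hwG t ht)
    change z = 1 + P ((R t - T) (e + w t))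
    rw [← this, ← hzy]; ring

end Perturbation

/-! ### The operators `R(1,t)` and their eigenvalue near `1` -/

theorem norm_exp_I_mul_sub_one_le (x : ℝ) : ‖Complex.exp (Complex.I * x) - 1‖ ≤ |x| := by
  simpa using Real.norm_exp_I_mul_ofReal_sub_one_le (x := x)

theorem norm_exp_I_mul (x : ℝ) : ‖Complex.exp (Complex.I * x)‖ = 1 :=
  Complex.norm_exp_I_mul_ofReal x

theorem norm_exp_I_mul_sub_le (x y : ℝ) :
    ‖Complex.exp (Complex.I * x) - Complex.exp (Complex.I * y)‖ ≤ |x - y| := by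
  have e : Complex.exp (Complex.I * x) - Complex.exp (Complex.I * y) =
      Complex.exp (Complex.I * y) * (Complex.exp (Complex.I * (x - y : ℝ)) - 1) := by
    rw [mul_sub, ← Complex.exp_add, mul_one]; congr 2; push_cast; ring
  rw [e, norm_mul, norm_exp_I_mul, one_mul]
  exact norm_exp_I_mul_sub_one_le _

theorem norm_exp_I_mul_sub_one_sub_le (x : ℝ) :
    ‖Complex.exp (Complex.I * x) - 1 - Complex.I * x‖ ≤ 2 * x ^ 2 := by
  by_cases h : |x| ≤ 1
  · have := Complex.norm_exp_sub_one_sub_id_le (x := Complex.I * x) (by simpa using h)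
    refine this.trans ?_
    simp only [norm_mul, Complex.norm_I, Complex.norm_real, Real.norm_eq_abs, one_mul, sq_abs]
    linarith [sq_nonneg x]
  · have h1 := norm_sub_le (Complex.exp (Complex.I * x) - 1) (Complex.I * x)
    have h2 := norm_exp_I_mul_sub_one_le x
    simp only [norm_mul, Complex.norm_I, Complex.norm_real, Real.norm_eq_abs, one_mul] at h1
    rw [← sq_abs]
    nlinarith

theorem norm_exp_I_mul_sub_sub_le (x y : ℝ) :
    ‖Complex.exp (Complex.I * x) - 1 - Complex.I * x -
      (Complex.exp (Complex.I * y) - 1 - Complex.I * y)‖ ≤ |x - y| * (2 * |x| + 3 * |y|) := by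
  have e : Complex.exp (Complex.I * x) - 1 - Complex.I * x -
      (Complex.exp (Complex.I * y) - 1 - Complex.I * y) =
      Complex.exp (Complex.I * y) * (Complex.exp (Complex.I * (x - y : ℝ)) - 1 -
        Complex.I * (x - y : ℝ)) +
      (Complex.exp (Complex.I * y) - 1) * (Complex.I * (x - y : ℝ)) := by
    have : Complex.exp (Complex.I * x) =
      Complex.exp (Complex.I * y) * Complex.exp (Complex.I * (x - y : ℝ)) := by
      rw [← Complex.exp_add]; congr 1; push_cast; ring
    rw [this]; push_cast; ring
  rw [e]
  refine (norm_add_le _ _).trans ?_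
  rw [norm_mul, norm_mul, norm_mul, norm_exp_I_mul, one_mul, Complex.norm_I, one_mul,
    Complex.norm_real, Real.norm_eq_abs]
  have h1 := norm_exp_I_mul_sub_one_sub_le (x - y)
  have h2 := mul_le_mul_of_nonneg_right (norm_exp_I_mul_sub_one_le y) (abs_nonneg (x - y))
  have h3 := abs_sub x y
  rw [← sq_abs] at h1
  nlinarith [abs_nonneg (x - y)]

namespace YoungTower

open TowerMap

variable {X I : Type*} [MeasurableSpace X] {m : Measure X} [IsProbabilityMeasure m] [Countable I]
  (Y : YoungTower m I)

/-- The tail condition `m {φ > n} = O(n ^ (-β))` with `β > 2` makes the return time square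
integrable. -/
theorem integrable_ret_sq {β : ℝ} (hβ : 2 < β)
    (htail : (fun n : ℕ => m.real {x ∈ Y.base | n < Y.φ (Y.col x)}) =O[atTop]
      (fun n : ℕ => 1 / (n : ℝ) ^ β)) :
    Integrable (fun y => (Y.ret y : ℝ) ^ 2) Y.mB := by
  have hsm : Summable fun n : ℕ => (2 * n + 1 : ℝ) * m.real {x ∈ Y.base | n < Y.φ (Y.col x)} := by
    refine summable_of_isBigO_nat (g := fun n : ℕ => (n : ℝ) ^ (1 - β))
      (Real.summable_nat_rpow.2 (by linarith)) ?_
    have h1 : (fun n : ℕ => (2 * n + 1 : ℝ)) =O[atTop] fun n : ℕ => (n : ℝ) := by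
      refine IsBigO.of_bound 3 (eventually_atTop.2 ⟨1, fun n hn => ?_⟩)
      have : (1 : ℝ) ≤ n := by exact_mod_cast hn
      rw [Real.norm_of_nonneg (by positivity), Real.norm_of_nonneg (by positivity)]
      linarith
    refine (h1.mul htail).congr' EventuallyEq.rfl (eventually_atTop.2 ⟨1, fun n hn => ?_⟩)
    have : (0 : ℝ) < n := by exact_mod_cast hn
    simp only
    rw [Real.rpow_sub this, Real.rpow_one, mul_one_div]
  refine ⟨(measurable_from_nat (f := fun n : ℕ => (n : ℝ) ^ 2)).comp
    Y.measurable_ret |>.aestronglyMeasurable, ?_⟩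
  have hset : ∀ n : ℕ, Y.mB {y | n < Y.ret y} = m {x ∈ Y.base | n < Y.φ (Y.col x)} := by
    intro n
    rw [mB_apply]
    congr 1
    ext x
    constructor
    · rintro ⟨y, hy, rfl⟩; exact ⟨y.2, hy⟩
    · rintro ⟨h1, h2⟩; exact ⟨⟨x, h1⟩, h2, rfl⟩
  have hms : ∀ n : ℕ, MeasurableSet {y | n < Y.ret y} := fun n =>
    Y.measurable_ret (measurableSet_Ioi (a := n))
  have hsq : ∀ k : ℕ, ((k ^ 2 : ℕ) : ℝ≥0∞) = ∑' n : ℕ, if n < k then ((2 * n + 1 : ℕ) : ℝ≥0∞)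
      else 0 := by
    intro k
    rw [tsum_eq_sum (s := Finset.range k) (fun n hn => by simp at hn; simp; omega)]
    have : k ^ 2 = ∑ n ∈ Finset.range k, (2 * n + 1) := by
      induction k with
      | zero => simp
      | succ k ih => rw [Finset.sum_range_succ, ← ih]; ring
    rw [this, Nat.cast_sum]
    exact Finset.sum_congr rfl fun n hn => by rw [if_pos (Finset.mem_range.1 hn)]
  have : ∀ y : Y.base, ‖(Y.ret y : ℝ) ^ 2‖ₑ =
      ∑' n : ℕ, {y | n < Y.ret y}.indicator (fun _ => ((2 * n + 1 : ℕ) : ℝ≥0∞)) y := by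
    intro y
    rw [← ofReal_norm, Real.norm_of_nonneg (by positivity), ← Nat.cast_pow, ENNReal.ofReal_natCast,
      hsq]
    exact tsum_congr fun n => by by_cases h : n < Y.ret y <;> simp [h]
  rw [HasFiniteIntegral]
  simp only [this]
  rw [lintegral_tsum fun n => (measurable_const.indicator (hms n)).aemeasurable]
  simp only [lintegral_indicator_const (hms _), hset]
  refine lt_of_eq_of_lt (tsum_congr fun n => ?_) hsm.tsum_ofReal_lt_top
  rw [ENNReal.ofReal_mul (by positivity), ofReal_measureReal]
  congr 1
  rw [← ENNReal.ofReal_natCast]; push_cast; rfl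

theorem integral_colB_ret_pow (k : ℕ) (i : I) :
    ∫ y in {y : Y.base | Y.col y = i}, (Y.ret y : ℝ) ^ k ∂Y.mB = Y.wt i * (Y.φ i : ℝ) ^ k := by
  have : ∀ y ∈ {y : Y.base | Y.col y = i}, (Y.ret y : ℝ) ^ k = (Y.φ i : ℝ) ^ k := by
    intro y hy
    have hy' : Y.col (y : X) = i := hy
    rw [ret, hy']
  rw [setIntegral_congr_fun (Y.measurableSet_colB i) this]
  simp [measureReal_colB]

theorem summable_wt_mul_sq (h : Integrable (fun y => (Y.ret y : ℝ) ^ 2) Y.mB) :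
    Summable fun i => Y.wt i * (Y.φ i : ℝ) ^ 2 := by
  have := (Y.hasSum_integral_colB h).summable
  simpa only [integral_colB_ret_pow] using this

theorem summable_wt_mul : Summable fun i => Y.wt i * (Y.φ i : ℝ) := by
  have h : Integrable (fun y => (Y.ret y : ℝ) ^ 1) Y.mB := by simpa using Y.integrable_ret
  refine (Y.hasSum_integral_colB h).summable.congr fun i => ?_
  rw [integral_colB_ret_pow, pow_one]

/-- `F` is bounded by a multiple of the return time, and Hölder continuous on each column with a
constant that is a multiple of the return time. Induced functions `f_B` have this property. -/
structure RetBound (ν M : ℝ) (F : Y.base → ℝ) : Prop where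
  nonneg : 0 ≤ M
  abs_le : ∀ x, |F x| ≤ M * Y.ret x
  abs_sub_le : ∀ x y : Y.base, Y.col x = Y.col y → |F x - F y| ≤ M * Y.ret x * Y.dB ν x y

variable {Y} {ν M : ℝ} {F : Y.base → ℝ}

theorem RetBound.colBound (h : Y.RetBound ν M F) :
    Y.ColBound ν (fun x => (F x : ℂ)) fun i => M * Y.φ i where
  summable := (Y.summable_wt_mul.mul_left M).congr fun i => by ring
  norm_le x := by rw [Complex.norm_real]; exact h.abs_le x
  norm_sub_le x y hxy := by
    rw [← Complex.ofReal_sub, Complex.norm_real]; exact h.abs_sub_le x y hxy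

theorem RetBound.measurable (h0 : 0 ≤ ν) (h1 : ν < 1) (h : Y.RetBound ν M F) : Measurable F :=
  SepContinuous.measurable Y (Y.sepContinuous_of_col h0 h1 (q := fun i => M * Y.φ i)
    fun x y hxy => h.abs_sub_le x y hxy)

theorem RetBound.integrable (h0 : 0 ≤ ν) (h1 : ν < 1) (h : Y.RetBound ν M F) :
    Integrable F Y.mB :=
  (Y.integrable_ret.const_mul M).mono' (h.measurable h0 h1).aestronglyMeasurable
    (ae_of_all _ h.abs_le)

theorem RetBound.colBound_exp_sub_one (h : Y.RetBound ν M F) (t : ℝ) :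
    Y.ColBound ν (fun x => Complex.exp (Complex.I * t * F x) - 1) fun i => |t| * M * Y.φ i where
  summable := (Y.summable_wt_mul.mul_left (|t| * M)).congr fun i => by ring
  norm_le x := by
    have := norm_exp_I_mul_sub_one_le (t * F x)
    push_cast at this
    rw [← mul_assoc, abs_mul] at this
    refine this.trans ?_
    rw [mul_assoc]
    exact mul_le_mul_of_nonneg_left (h.abs_le x) (abs_nonneg t)
  norm_sub_le x y hxy := by
    have := norm_exp_I_mul_sub_le (t * F x) (t * F y)
    push_cast at this
    rw [← mul_assoc, ← mul_assoc, ← mul_sub, abs_mul] at this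
    rw [sub_sub_sub_cancel_right]
    refine this.trans ((mul_le_mul_of_nonneg_left (h.abs_sub_le x y hxy) (abs_nonneg t)).trans
      (le_of_eq ?_))
    simp only [ret]; ring

theorem RetBound.colBound_exp (h0 : 0 ≤ ν) (h : Y.RetBound ν M F) (t : ℝ) :
    Y.ColBound ν (fun x => Complex.exp (Complex.I * t * F x)) fun i => 1 + |t| * M * Y.φ i where
  summable := (Y.summable_wt.add (h.colBound_exp_sub_one t).summable).congr fun i => by ring
  norm_le x := by
    have := norm_exp_I_mul (t * F x)
    push_cast at this
    rw [← mul_assoc] at this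
    rw [this]
    have := h.nonneg
    have : 0 ≤ |t| * M * Y.φ (Y.col (x : X)) := by positivity
    linarith
  norm_sub_le x y hxy := by
    have := (h.colBound_exp_sub_one t).norm_sub_le x y hxy
    rw [sub_sub_sub_cancel_right] at this
    refine this.trans (mul_le_mul_of_nonneg_right (by linarith) (Y.dB_nonneg h0 x y))

theorem RetBound.colBound_exp_sub_one_sub (h0 : 0 ≤ ν)
    (hφ : Integrable (fun y => (Y.ret y : ℝ) ^ 2) Y.mB) (h : Y.RetBound ν M F) (t : ℝ) :
    Y.ColBound ν (fun x => Complex.exp (Complex.I * t * F x) - 1 - Complex.I * t * F x)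
      fun i => 5 * t ^ 2 * M ^ 2 * (Y.φ i : ℝ) ^ 2 where
  summable := ((Y.summable_wt_mul_sq hφ).mul_left (5 * t ^ 2 * M ^ 2)).congr fun i => by ring
  norm_le x := by
    have h1 := norm_exp_I_mul_sub_one_sub_le (t * F x)
    push_cast at h1
    rw [← mul_assoc, mul_pow] at h1
    refine h1.trans ?_
    have h2 : F x ^ 2 ≤ (M * Y.ret x) ^ 2 := sq_le_sq' (_root_.abs_le.1 (h.abs_le x)).1
      (_root_.abs_le.1 (h.abs_le x)).2
    have h3 := mul_le_mul_of_nonneg_left h2 (sq_nonneg t)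
    have h4 : 0 ≤ t ^ 2 * (M * Y.ret x) ^ 2 := by positivity
    calc 2 * (t ^ 2 * F x ^ 2) ≤ 5 * (t ^ 2 * (M * Y.ret x) ^ 2) := by linarith
      _ = _ := by simp only [ret]; ring
  norm_sub_le x y hxy := by
    have h1 := norm_exp_I_mul_sub_sub_le (t * F x) (t * F y)
    push_cast at h1
    rw [← mul_assoc, ← mul_assoc, ← mul_sub, abs_mul, abs_mul, abs_mul] at h1
    refine h1.trans ?_
    have hM := h.nonneg
    have hd := Y.dB_nonneg h0 x y
    have h2 := h.abs_sub_le x y hxy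
    have h3 := h.abs_le x
    have h4 := h.abs_le y
    rw [show Y.ret y = Y.ret x by simp only [ret, hxy]] at h4
    calc |t| * |F x - F y| * (2 * (|t| * |F x|) + 3 * (|t| * |F y|))
        ≤ |t| * (M * Y.ret x * Y.dB ν x y) *
          (2 * (|t| * (M * Y.ret x)) + 3 * (|t| * (M * Y.ret x))) := by gcongr
      _ = 5 * (|t| * |t|) * M ^ 2 * (Y.ret x : ℝ) ^ 2 * Y.dB ν x y := by ring
      _ = _ := by rw [abs_mul_abs_self]; simp only [ret]; ring

/-- `R(1,t)` preserves `C_ν(B)`. -/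
theorem memCBase_transferB_exp (h0 : 0 ≤ ν) (h1 : ν < 1) (hν : Y.BoundedDistortion Y.g ν)
    (hF : Y.RetBound ν M F) (t : ℝ) {u : Y.base → ℂ} (hu : Y.MemCBase ν u) :
    Y.MemCBase ν (Y.transferB fun x => Complex.exp (Complex.I * t * F x) * u x) := by
  obtain ⟨K, hK0, hK1, hK2⟩ := Y.exists_weight_bound h0 h1.le hν
  obtain ⟨A, hA, -⟩ := exists_transferB_mul h0 h1.le ⟨hK0, hK1, hK2⟩ (hF.colBound_exp h0 t)
  obtain ⟨U, hU⟩ := Holder.exists_of_memCBase h0 h1.le hu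
  have := Holder.memCBase h0 (A U)
  convert this using 1
  ext x
  rw [hA]
  simp only [hU]

/-- `I - T̂_B` is invertible on the functions of `C_ν(B)` with vanishing mean. -/
theorem exists_resolvent (h0 : 0 ≤ ν) (h1 : ν < 1) (hν : Y.BoundedDistortion Y.g ν) :
    ∃ T Q : Y.Holder ν →L[ℂ] Y.Holder ν, (∀ F x, T F x = Y.transferB F x) ∧
      (∀ x, mean h0 h1 (Q x) = mean h0 h1 x) ∧ (∀ x, mean h0 h1 x = 0 → Q x - T (Q x) = x) ∧
      ∀ x, mean h0 h1 x = 0 → Q (x - T x) = x := by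
  obtain ⟨K, hK0, hK1, hK2⟩ := Y.exists_weight_bound h0 h1.le hν
  obtain ⟨T, hT, -⟩ := exists_transferB_mul h0 h1.le ⟨hK0, hK1, hK2⟩ (Y.colBound_one h0)
  simp only [one_mul] at hT
  obtain ⟨D, ρ, hρ0, hρ1, hD⟩ := exists_norm_pow_transfer_sub_le h0 h1 hν hT
  obtain ⟨Q, hQ⟩ := exists_resolvent_of_norm_pow_sub_le (mean_one h0 h1) (transfer_one h0 h1 hν hT)
    (mean_transfer h0 h1 hT) hρ0 hρ1 hD
  exact ⟨T, Q, hT, hQ⟩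

theorem EB_zero_of_integral {F : Y.base → ℝ} (hF0 : ∫ x, F x ∂Y.mB = 0) :
    Y.EB (fun x => (F x : ℂ)) = 0 := by
  rw [EB_ofReal, hF0, mul_zero, Complex.ofReal_zero]

theorem exists_transferB_ofReal (h0 : 0 ≤ ν) (h1 : ν < 1) (hν : Y.BoundedDistortion Y.g ν)
    (hF : Y.RetBound ν M F) : ∃ H : Y.Holder ν, ∀ x, H x = Y.transferB (fun y => (F y : ℂ)) x := by
  obtain ⟨K, hK0, hK1, hK2⟩ := Y.exists_weight_bound h0 h1.le hν
  obtain ⟨A, hA, -⟩ := exists_transferB_mul h0 h1.le ⟨hK0, hK1, hK2⟩ hF.colBound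
  exact ⟨A (Holder.one h0), fun x => by rw [hA]; simp only [Holder.one_apply, mul_one]⟩

/-- The Poisson equation `(I - T̂_B) a = T̂_B F`. -/
theorem exists_poisson (h0 : 0 ≤ ν) (h1 : ν < 1) (hν : Y.BoundedDistortion Y.g ν)
    (hF : Y.RetBound ν M F) (hF0 : ∫ x, F x ∂Y.mB = 0) :
    ∃ a : Y.Holder ν, Y.EB a = 0 ∧
      ∀ x, a x - Y.transferB a x = Y.transferB (fun y => (F y : ℂ)) x := by
  obtain ⟨T, Q, hT, hPQ, hQ, -⟩ := exists_resolvent h0 h1 hν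
  obtain ⟨H, hH⟩ := exists_transferB_ofReal h0 h1 hν hF
  have hPH : mean h0 h1 H = 0 := by
    rw [mean_apply, show (H : Y.base → ℂ) = Y.transferB (fun y => (F y : ℂ)) from funext hH,
      EB_transferB (w := fun y => (F y : ℂ)) (hF.integrable h0 h1).ofReal, EB_zero_of_integral hF0]
  refine ⟨Q H, by rw [← mean_apply h0 h1, hPQ, hPH], fun x => ?_⟩
  rw [← hT, ← Holder.sub_apply, hQ H hPH, hH]

theorem poisson_unique (h0 : 0 ≤ ν) (h1 : ν < 1) (hν : Y.BoundedDistortion Y.g ν)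
    {a a' : Y.Holder ν} (ha : Y.EB a = 0) (ha' : Y.EB a' = 0)
    (h : ∀ x, a x - Y.transferB a x = a' x - Y.transferB a' x) : a = a' := by
  obtain ⟨T, Q, hT, hPQ, -, hQ⟩ := exists_resolvent h0 h1 hν
  rw [← mean_apply h0 h1] at ha ha'
  rw [← hQ a ha, ← hQ a' ha']
  congr 1
  refine Holder.ext fun x => ?_
  rw [Holder.sub_apply, Holder.sub_apply, hT, hT, h]

/-- For small `t`, the operator `u ↦ T̂_B (e^{itF} u)` has a unique eigenvalue `lam t` close to `1`,
with an eigenfunction `1 + i t a + O(t ^ 2)` of mean `1`, where `a` solves the Poisson equation. -/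
theorem exists_eigenvalue (h0 : 0 ≤ ν) (h1 : ν < 1) (hν : Y.BoundedDistortion Y.g ν)
    (hφ : Integrable (fun y => (Y.ret y : ℝ) ^ 2) Y.mB)
    (hF : Y.RetBound ν M F) {a : Y.Holder ν} (ha : Y.EB a = 0)
    (ha' : ∀ x, a x - Y.transferB a x = Y.transferB (fun y => (F y : ℂ)) x) :
    ∃ ε > 0, ∃ δ > 0, ∃ C : ℝ, ∃ w : ℝ → Y.Holder ν, ∃ lam : ℝ → ℂ, ∀ t : ℝ, |t| < δ →
      Y.EB (w t) = 0 ∧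
      (∀ x, Y.transferB (fun y => Complex.exp (Complex.I * t * F y) * (1 + w t y)) x =
        lam t * (1 + w t x)) ∧
      ‖w t - (Complex.I * t) • a‖ ≤ C * t ^ 2 ∧ ‖lam t - 1‖ < ε ∧
      ∀ (z : ℂ) (u : Y.base → ℂ), Y.MemCBase ν u → u ≠ 0 → ‖z - 1‖ < ε →
        (Y.transferB fun y => Complex.exp (Complex.I * t * F y) * u y) = (fun x => z * u x) →
        z = lam t := by
  obtain ⟨K, hK0, hK1, hK2⟩ := Y.exists_weight_bound h0 h1.le hν
  have hK : Y.WeightBound ν K := ⟨hK0, hK1, hK2⟩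
  obtain ⟨T, Q, hT, hPQ, hQ, hQ'⟩ := exists_resolvent h0 h1 hν
  obtain ⟨H, hH⟩ := exists_transferB_ofReal h0 h1 hν hF
  have hM := hF.nonneg
  have hone := transfer_one h0 h1 hν hT
  have hHa : H = a - T a := by
    refine Holder.ext fun x => ?_
    rw [hH, Holder.sub_apply, hT, ha']
  rw [← mean_apply h0 h1] at ha
  have hQH : Q H = a := by rw [hHa, hQ' a ha]
  have hPH : mean h0 h1 H = 0 := by rw [hHa, map_sub, mean_transfer h0 h1 hT, sub_self]
  have hop := fun t : ℝ => exists_transferB_mul h0 h1.le hK (hF.colBound_exp_sub_one t)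
  choose A hA hAn using hop
  set S₁ := ∑' i, Y.wt i * (Y.φ i : ℝ)
  set S₂ := ∑' i, Y.wt i * (Y.φ i : ℝ) ^ 2
  have hS₁ : 0 ≤ S₁ := tsum_nonneg fun i => mul_nonneg (Y.wt_nonneg i) (by positivity)
  have hS₂ : 0 ≤ S₂ := tsum_nonneg fun i => mul_nonneg (Y.wt_nonneg i) (by positivity)
  have hRapp : ∀ t U x, (T + A t) U x =
      Y.transferB (fun y => Complex.exp (Complex.I * t * F y) * U y) x := by
    intro t U x
    rw [add_apply, Holder.add_apply, hT, hA, transferB_eq_tsum, transferB_eq_tsum,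
      transferB_eq_tsum, ← Summable.tsum_add]
    · exact tsum_congr fun i => by ring
    · have := ((Y.colBound_one h0).mul h0 (Holder.norm_apply_le U)
        (Holder.norm_sub_le h0 U)).summable_term hK x
      simpa only [one_mul] using this
    · exact ((hF.colBound_exp_sub_one t).mul h0 (Holder.norm_apply_le U)
        (Holder.norm_sub_le h0 U)).summable_term hK x
  have hR : ∀ t : ℝ, ‖T + A t - T‖ ≤ (4 * K * (M * S₁) + 10 * K * (M ^ 2 * S₂)) * |t| := by
    intro t
    rw [add_sub_cancel_left]
    refine (hAn t).trans ?_
    have e : ∑' i, Y.wt i * (|t| * M * (Y.φ i : ℝ)) = |t| * M * S₁ := by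
      simp only [S₁]; rw [← tsum_mul_left]; exact tsum_congr fun i => by ring
    rw [e]
    have : 0 ≤ 10 * K * (M ^ 2 * S₂) * |t| := by positivity
    linarith
  have hRd : ∀ t : ℝ, ‖(T + A t) (Holder.one h0) - T (Holder.one h0) -
      (t : ℂ) • (Complex.I • H)‖ ≤ (4 * K * (M * S₁) + 10 * K * (M ^ 2 * S₂)) * t ^ 2 := by
    intro t
    have hc := hF.colBound_exp_sub_one_sub h0 hφ t
    have hval : ∀ x, ((T + A t) (Holder.one h0) - T (Holder.one h0) -
        (t : ℂ) • (Complex.I • H) : Y.Holder ν) x =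
        Y.transferB (fun x => Complex.exp (Complex.I * t * F x) - 1 - Complex.I * t * F x) x := by
      intro x
      rw [add_apply, add_sub_cancel_left, Holder.sub_apply, Holder.smul_apply, Holder.smul_apply,
        hA, hH, transferB_eq_tsum, transferB_eq_tsum, transferB_eq_tsum, ← mul_assoc,
        ← tsum_mul_left, ← Summable.tsum_sub]
      · refine tsum_congr fun i => ?_
        rw [Holder.one_apply]; ring
      · simpa only [Holder.one_apply, mul_one] using
          (hF.colBound_exp_sub_one t).summable_term hK x
      · exact (hF.colBound.summable_term hK x).mul_left _
    have e : ∑' i, Y.wt i * (5 * t ^ 2 * M ^ 2 * (Y.φ i : ℝ) ^ 2) = 5 * t ^ 2 * M ^ 2 * S₂ := by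
      simp only [S₂]; rw [← tsum_mul_left]; exact tsum_congr fun i => by ring
    have e2 : 10 * K * (M ^ 2 * S₂) * t ^ 2 ≤
        (4 * K * (M * S₁) + 10 * K * (M ^ 2 * S₂)) * t ^ 2 := by
      refine mul_le_mul_of_nonneg_right ?_ (sq_nonneg t)
      have : 0 ≤ 4 * K * (M * S₁) := by positivity
      linarith
    refine (Holder.norm_le_of_bound h0 _ (M := 10 * K * (M ^ 2 * S₂) * t ^ 2) (by positivity)
      (fun x => ?_) (fun x y => ?_)).trans e2
    · rw [hval]
      refine (hc.norm_transferB_le hK x).trans ?_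
      rw [e]
      have : 0 ≤ 5 * K * (M ^ 2 * S₂) * t ^ 2 := by positivity
      linarith
    · rw [hval, hval]
      refine (hc.norm_transferB_sub_le h0 h1.le hK x y).trans (le_of_eq ?_)
      rw [e]; ring
  obtain ⟨ε, hε, δ, hδ, C, w, lam, hmain⟩ := exists_eigenvalue_perturbation (mean_one h0 h1) hone
    (mean_transfer h0 h1 hT) hPQ hQ hQ' (R := fun t => T + A t)
    (C := 4 * K * (M * S₁) + 10 * K * (M ^ 2 * S₂)) (by positivity) hR
    (d := Complex.I • H) (by rw [map_smul, hPH, smul_zero]) hRd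
  refine ⟨ε, hε, δ, hδ, C, w, lam, fun t ht => ?_⟩
  obtain ⟨m1, m2, m3, m4, m5⟩ := hmain t ht
  refine ⟨m1, fun x => ?_, ?_, m4, fun z u hu hu0 hz hzu => ?_⟩
  · have := congrArg (fun G : Y.Holder ν => G x) m2
    simp only [hRapp] at this
    simpa [mul_add] using this
  · rw [map_smul, hQH, smul_smul, mul_comm] at m3
    exact m3
  · obtain ⟨U, hU⟩ := Holder.exists_of_memCBase h0 h1.le hu
    have hUu : (U : Y.base → ℂ) = u := funext hU
    refine m5 z U (fun h => hu0 ?_) hz (Holder.ext fun x => ?_)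
    · rw [← hUu, h]; rfl
    · rw [hRapp, Holder.smul_apply, hU]
      have := congrFun hzu x
      simpa only [hU] using this

end YoungTower

/-! ### Expansion of the eigenvalue -/

theorem tendsto_one_add_pow_exp {z : ℕ → ℂ} {p : ℕ → ℕ} {c : ℂ}
    (hp : Tendsto p atTop atTop) (h : Tendsto (fun n => (p n : ℂ) * z n) atTop (𝓝 c)) :
    Tendsto (fun n => (1 + z n) ^ p n) atTop (𝓝 (Complex.exp c)) := by
  have hpinv : Tendsto (fun n => ((p n : ℂ))⁻¹) atTop (𝓝 0) :=
    (tendsto_inv_atTop_nhds_zero_nat (𝕜 := ℂ)).comp hp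
  have hz : Tendsto z atTop (𝓝 0) := by
    have := hpinv.mul h
    rw [zero_mul] at this
    refine this.congr' ?_
    filter_upwards [hp.eventually_gt_atTop 0] with n hn
    have : (p n : ℂ) ≠ 0 := by exact_mod_cast hn.ne'
    field_simp
  have hlog : Tendsto (fun n => (p n : ℂ) * Complex.log (1 + z n)) atTop (𝓝 c) := by
    have h1 : Tendsto (fun n => (p n : ℂ) * Complex.log (1 + z n) - p n * z n) atTop (𝓝 0) := by
      have h2 : Tendsto (fun n => ‖(p n : ℂ) * z n‖ * ‖z n‖) atTop (𝓝 0) := by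
        simpa using h.norm.mul hz.norm
      refine squeeze_zero_norm' ?_ h2
      have hz' : ∀ᶠ n in atTop, ‖z n‖ ≤ 1 / 2 :=
        (by simpa using hz.norm : Tendsto (fun n => ‖z n‖) atTop (𝓝 0)).eventually
          (ge_mem_nhds (by norm_num))
      filter_upwards [hz'] with n hn
      rw [← mul_sub, norm_mul, norm_mul, mul_assoc]
      refine mul_le_mul_of_nonneg_left ?_ (norm_nonneg _)
      have h3 := Complex.norm_log_one_add_sub_self_le (lt_of_le_of_lt hn (by norm_num))
      have h4 : (1 - ‖z n‖)⁻¹ ≤ 2 := by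
        rw [inv_le_comm₀ (by linarith) (by norm_num)]; linarith
      have h5 := mul_le_mul_of_nonneg_left h4 (sq_nonneg ‖z n‖)
      nlinarith
    simpa using h1.add h
  refine (Complex.continuous_exp.tendsto c |>.comp hlog).congr' ?_
  have hz' : ∀ᶠ n in atTop, ‖z n‖ < 1 :=
    (by simpa using hz.norm : Tendsto (fun n => ‖z n‖) atTop (𝓝 0)).eventually
      (gt_mem_nhds one_pos)
  filter_upwards [hz'] with n hn
  have hne : 1 + z n ≠ 0 := by
    intro h0
    have : z n = -1 := by linear_combination h0
    rw [this, norm_neg, norm_one] at hn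
    exact lt_irrefl _ hn
  rw [Function.comp_apply, Complex.exp_nat_mul, Complex.exp_log hne]

/-- Second order Taylor expansion of `t ↦ e^{itc}` at `0`. -/
theorem tendsto_exp_I_mul_sub_div_sq (c : ℝ) :
    Tendsto (fun t : ℝ => (Complex.exp (Complex.I * t * c) - 1 - Complex.I * t * c) / (t : ℂ) ^ 2)
      (𝓝[≠] 0) (𝓝 (-(c : ℂ) ^ 2 / 2)) := by
  rw [tendsto_iff_norm_sub_tendsto_zero]
  have hlim : Tendsto (fun t : ℝ => |t| * |c| ^ 3) (𝓝[≠] 0) (𝓝 0) := by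
    have : Continuous fun t : ℝ => |t| * |c| ^ 3 := by fun_prop
    simpa using (this.tendsto 0).mono_left nhdsWithin_le_nhds
  have hsmall : ∀ᶠ t : ℝ in 𝓝[≠] 0, |t| * |c| ≤ 1 := by
    have : Continuous fun t : ℝ => |t| * |c| := by fun_prop
    have h0 := (this.tendsto 0).mono_left (nhdsWithin_le_nhds (s := {0}ᶜ))
    rw [abs_zero, zero_mul] at h0
    exact h0.eventually (ge_mem_nhds one_pos)
  refine squeeze_zero' (Eventually.of_forall fun t => norm_nonneg _) ?_ hlim
  filter_upwards [hsmall, self_mem_nhdsWithin] with t ht ht0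
  have ht0' : (t : ℂ) ≠ 0 := by exact_mod_cast ht0
  have hn : ‖Complex.I * t * c‖ = |t| * |c| := by simp
  have hb := Complex.exp_bound (x := Complex.I * t * c) (by rw [hn]; exact ht) (n := 3)
    (by norm_num)
  have e : Complex.exp (Complex.I * t * c) -
      ∑ m ∈ Finset.range 3, (Complex.I * t * c) ^ m / (m.factorial : ℂ) =
      ((Complex.exp (Complex.I * t * c) - 1 - Complex.I * t * c) / (t : ℂ) ^ 2 -
        -(c : ℂ) ^ 2 / 2) * (t : ℂ) ^ 2 := by
    simp only [Finset.sum_range_succ, Finset.sum_range_zero, Nat.factorial]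
    field_simp
    push_cast
    ring_nf
    simp only [Complex.I_sq]
    ring
  rw [e, norm_mul, hn, norm_pow, Complex.norm_real, Real.norm_eq_abs] at hb
  have ht2 : 0 < |t| ^ 2 := pow_pos (abs_pos.2 ht0) 2
  rw [← mul_le_mul_iff_left₀ ht2]
  refine hb.trans ?_
  have h3 : ((Nat.succ 3 : ℕ) : ℝ) * (((Nat.factorial 3 : ℕ) : ℝ) * (3 : ℕ))⁻¹ ≤ 1 := by
    norm_num [Nat.factorial]
  calc (|t| * |c|) ^ 3 * (((Nat.succ 3 : ℕ) : ℝ) * (((Nat.factorial 3 : ℕ) : ℝ) * (3 : ℕ))⁻¹)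
      ≤ (|t| * |c|) ^ 3 * 1 := mul_le_mul_of_nonneg_left h3 (by positivity)
    _ = _ := by ring

namespace YoungTower

open TowerMap

variable {X I : Type*} [MeasurableSpace X] {m : Measure X} [IsProbabilityMeasure m] [Countable I]
  {Y : YoungTower m I} {ν M : ℝ} {F : Y.base → ℝ}

theorem RetBound.sq_le (hF : Y.RetBound ν M F) (x : Y.base) :
    F x ^ 2 ≤ M ^ 2 * (Y.ret x : ℝ) ^ 2 := by
  rw [← mul_pow]
  exact sq_le_sq' (_root_.abs_le.1 (hF.abs_le x)).1 (_root_.abs_le.1 (hF.abs_le x)).2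

theorem RetBound.integrable_sq (h0 : 0 ≤ ν) (h1 : ν < 1)
    (hφ : Integrable (fun y => (Y.ret y : ℝ) ^ 2) Y.mB) (hF : Y.RetBound ν M F) :
    Integrable (fun x => F x ^ 2) Y.mB :=
  (hφ.const_mul (M ^ 2)).mono' ((hF.measurable h0 h1).pow_const 2).aestronglyMeasurable
    (ae_of_all _ fun x => by rw [Real.norm_of_nonneg (sq_nonneg _)]; exact hF.sq_le x)

theorem EB_add {u v : Y.base → ℂ} (hu : Integrable u Y.mB) (hv : Integrable v Y.mB) :
    Y.EB (fun x => u x + v x) = Y.EB u + Y.EB v := by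
  rw [EB, integral_add hu hv, mul_add]; rfl

theorem EB_sub {u v : Y.base → ℂ} (hu : Integrable u Y.mB) (hv : Integrable v Y.mB) :
    Y.EB (fun x => u x - v x) = Y.EB u - Y.EB v := by
  rw [EB, integral_sub hu hv, mul_sub]; rfl

theorem EB_const_mul (c : ℂ) (u : Y.base → ℂ) : Y.EB (fun x => c * u x) = c * Y.EB u := by
  rw [EB, EB, integral_const_mul]; ring

theorem norm_EB_le {u : Y.base → ℂ} {v : Y.base → ℝ} (hv : Integrable v Y.mB)
    (h : ∀ x, ‖u x‖ ≤ v x) : ‖Y.EB u‖ ≤ (m.real Y.base)⁻¹ * ∫ x, v x ∂Y.mB := by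
  have hb := Y.measure_base_pos
  rw [EB, norm_mul, Complex.norm_real, Real.norm_of_nonneg (inv_nonneg.2 hb.le)]
  exact mul_le_mul_of_nonneg_left (norm_integral_le_of_norm_le hv (ae_of_all _ h))
    (inv_nonneg.2 hb.le)

theorem RetBound.integrable_exp (h0 : 0 ≤ ν) (h1 : ν < 1) (hF : Y.RetBound ν M F) (t : ℝ) :
    Integrable (fun x => Complex.exp (Complex.I * t * F x)) Y.mB :=
  (hF.colBound_exp h0 t).integrable h0 h1

/-- `λ = E_B (e^{itF}) - t ^ 2 E_B (a F) + O(t ^ 3)` for the eigenvalue `λ` of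
`u ↦ T̂_B (e^{itF} u)` with eigenfunction `1 + i t a + O(t ^ 2)`. -/
theorem norm_eigenvalue_sub_le (h0 : 0 ≤ ν) (h1 : ν < 1)
    (hφ : Integrable (fun y => (Y.ret y : ℝ) ^ 2) Y.mB) (hF : Y.RetBound ν M F) {a w : Y.Holder ν}
    {t C : ℝ} {lam : ℂ} (hC : 0 ≤ C) (hw : Y.EB w = 0)
    (heig : ∀ x, Y.transferB (fun y => Complex.exp (Complex.I * t * F y) * (1 + w y)) x =
      lam * (1 + w x)) (hwa : ‖w - (Complex.I * t) • a‖ ≤ C * t ^ 2) :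
    ‖lam - (Y.EB (fun x => Complex.exp (Complex.I * t * F x)) -
      (t : ℂ) ^ 2 * Y.EB (fun x => a x * (F x : ℂ)))‖ ≤
      (m.real Y.base)⁻¹ * (M * C + 2 * M ^ 2 * ‖a‖) *
        (∫ x, (Y.ret x : ℝ) ^ 2 ∂Y.mB) * |t| ^ 3 := by
  have hM := hF.nonneg
  have hiw := Holder.integrable h0 h1 w
  have hE := hF.integrable_exp h0 h1 t
  have hEw : Integrable (fun x => Complex.exp (Complex.I * t * F x) * w x) Y.mB :=
    ((hF.colBound_exp h0 t).mul h0 (Holder.norm_apply_le w) (Holder.norm_sub_le h0 w)).integrable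
      h0 h1
  have haF : Integrable (fun x => a x * (F x : ℂ)) Y.mB := by
    have := (hF.colBound.mul h0 (Holder.norm_apply_le a) (Holder.norm_sub_le h0 a)).integrable h0 h1
    simpa only [mul_comm] using this
  -- the mean of the eigenvalue equation, as `T̂_B` preserves means and `w` has mean `0`
  have e1 : lam = Y.EB (fun x => Complex.exp (Complex.I * t * F x)) +
      Y.EB (fun x => Complex.exp (Complex.I * t * F x) * w x) := by
    rw [← EB_add hE hEw]
    have h2 : Integrable (fun y => Complex.exp (Complex.I * t * F y) * (1 + w y)) Y.mB :=
      (hE.add hEw).congr (ae_of_all _ fun x => by simp only [Pi.add_apply]; ring)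
    have h3 := EB_transferB h2
    rw [show Y.transferB (fun y => Complex.exp (Complex.I * t * F y) * (1 + w y)) =
      fun x => lam * (1 + w x) from funext heig, EB_const_mul,
      EB_add (integrable_const _) hiw, EB_const, hw, add_zero, mul_one] at h3
    rw [h3]
    congr 1
    ext x; ring
  have hid : ∀ x, Complex.exp (Complex.I * t * F x) * w x - w x + (t : ℂ) ^ 2 * (a x * (F x : ℂ)) =
      (Complex.exp (Complex.I * t * F x) - 1) * (w - (Complex.I * t) • a : Y.Holder ν) x +
      (Complex.exp (Complex.I * t * F x) - 1 - Complex.I * t * F x) * (Complex.I * t * a x) := by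
    intro x
    rw [Holder.sub_apply, Holder.smul_apply]
    linear_combination ((t : ℂ) ^ 2 * a x * F x) * Complex.I_sq
  have e2 : lam - (Y.EB (fun x => Complex.exp (Complex.I * t * F x)) -
      (t : ℂ) ^ 2 * Y.EB (fun x => a x * (F x : ℂ))) =
      Y.EB (fun x => Complex.exp (Complex.I * t * F x) * w x - w x +
        (t : ℂ) ^ 2 * (a x * (F x : ℂ))) := by
    have hd : Integrable (fun x => Complex.exp (Complex.I * t * F x) * w x - w x) Y.mB :=
      hEw.sub hiw
    rw [EB_add hd (haF.const_mul _), EB_sub hEw hiw, EB_const_mul, hw, e1]; ring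
  rw [e2]
  refine (norm_EB_le (hφ.const_mul ((M * C + 2 * M ^ 2 * ‖a‖) * |t| ^ 3)) fun x => ?_).trans
    (le_of_eq ?_)
  · rw [hid]
    refine (norm_add_le _ _).trans ?_
    rw [norm_mul, norm_mul]
    have b1 := (hF.colBound_exp_sub_one t).norm_le x
    have b2 := (Holder.norm_apply_le (w - (Complex.I * t) • a) x).trans hwa
    have b3 := norm_exp_I_mul_sub_one_sub_le (t * F x)
    push_cast at b3
    rw [← mul_assoc] at b3
    have b4 : ‖Complex.I * t * a x‖ ≤ |t| * ‖a‖ := by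
      rw [norm_mul, norm_mul, Complex.norm_I, one_mul, Complex.norm_real, Real.norm_eq_abs]
      exact mul_le_mul_of_nonneg_left (Holder.norm_apply_le a x) (abs_nonneg t)
    have b5 : 2 * (t * F x) ^ 2 ≤ 2 * M ^ 2 * t ^ 2 * (Y.ret x : ℝ) ^ 2 := by
      rw [mul_pow]
      have := mul_le_mul_of_nonneg_left (hF.sq_le x) (sq_nonneg t)
      linarith
    have hr : (1 : ℝ) ≤ Y.ret x := by exact_mod_cast Y.ret_pos x
    have hr2 : (Y.ret x : ℝ) ≤ (Y.ret x : ℝ) ^ 2 := by nlinarith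
    have ht : t ^ 2 = |t| ^ 2 := (sq_abs t).symm
    have c1 := mul_le_mul b1 b2 (norm_nonneg _) (by positivity)
    have c2 := mul_le_mul (b3.trans b5) b4 (norm_nonneg _) (by positivity)
    rw [ht] at c1 c2
    have c3 : |t| * M * (Y.ret x : ℝ) * (C * |t| ^ 2) ≤
        |t| * M * (Y.ret x : ℝ) ^ 2 * (C * |t| ^ 2) := by
      gcongr
    refine (add_le_add c1 c2).trans ((add_le_add_left c3 _).trans (le_of_eq ?_))
    ring
  · rw [integral_const_mul]; ring

/-- `E_B (e^{itF}) = 1 - t ^ 2 E_B (F ^ 2) / 2 + o(t ^ 2)` when `F` has vanishing integral. -/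
theorem tendsto_EB_exp_sub_one_div_sq (h0 : 0 ≤ ν) (h1 : ν < 1)
    (hφ : Integrable (fun y => (Y.ret y : ℝ) ^ 2) Y.mB) (hF : Y.RetBound ν M F)
    (hF0 : ∫ x, F x ∂Y.mB = 0) :
    Tendsto (fun t : ℝ => (Y.EB (fun x => Complex.exp (Complex.I * t * F x)) - 1) / (t : ℂ) ^ 2)
      (𝓝[≠] 0) (𝓝 (-(((m.real Y.base)⁻¹ * ∫ x, F x ^ 2 ∂Y.mB : ℝ) : ℂ) / 2)) := by
  have hm := hF.measurable h0 h1
  have hlim : Tendsto (fun t : ℝ => ∫ x, (Complex.exp (Complex.I * t * F x) - 1 -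
      Complex.I * t * F x) / (t : ℂ) ^ 2 ∂Y.mB) (𝓝[≠] 0)
      (𝓝 (∫ x, -(F x : ℂ) ^ 2 / 2 ∂Y.mB)) := by
    refine tendsto_integral_filter_of_dominated_convergence (fun x => 2 * F x ^ 2)
      (Eventually.of_forall fun t => ?_) ?_ ((hF.integrable_sq h0 h1 hφ).const_mul 2)
      (ae_of_all _ fun x => tendsto_exp_I_mul_sub_div_sq (F x))
    · exact Measurable.aestronglyMeasurable (by fun_prop)
    · filter_upwards [self_mem_nhdsWithin] with t ht
      refine ae_of_all _ fun x => ?_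
      have ht2 : 0 < t ^ 2 := sq_pos_of_ne_zero ht
      have := norm_exp_I_mul_sub_one_sub_le (t * F x)
      push_cast at this
      rw [← mul_assoc] at this
      rw [norm_div, norm_pow, Complex.norm_real, Real.norm_eq_abs, sq_abs, div_le_iff₀ ht2]
      refine this.trans (le_of_eq (by ring))
  have hlim2 := hlim.const_mul (((m.real Y.base)⁻¹ : ℝ) : ℂ)
  have e : (((m.real Y.base)⁻¹ : ℝ) : ℂ) * ∫ x, -(F x : ℂ) ^ 2 / 2 ∂Y.mB =
      -(((m.real Y.base)⁻¹ * ∫ x, F x ^ 2 ∂Y.mB : ℝ) : ℂ) / 2 := by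
    have : ∫ x, -(F x : ℂ) ^ 2 / 2 ∂Y.mB = -((∫ x, F x ^ 2 ∂Y.mB : ℝ) : ℂ) / 2 := by
      rw [integral_div, integral_neg]
      congr 2
      rw [← integral_complex_ofReal]
      push_cast; rfl
    rw [this]; push_cast; ring
  rw [e] at hlim2
  refine hlim2.congr' ?_
  filter_upwards with t
  have hE := hF.integrable_exp h0 h1 t
  have hi : Integrable (fun x => Complex.I * t * (F x : ℂ)) Y.mB :=
    (hF.integrable h0 h1).ofReal.const_mul _
  have : Y.EB (fun x => Complex.exp (Complex.I * t * F x)) - 1 =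
      Y.EB (fun x => Complex.exp (Complex.I * t * F x) - 1 - Complex.I * t * F x) := by
    have hd : Integrable (fun x => Complex.exp (Complex.I * t * F x) - 1) Y.mB :=
      hE.sub (integrable_const 1)
    rw [EB_sub hd hi, EB_sub hE (integrable_const 1), EB_const,
      EB_const_mul, EB_zero_of_integral hF0, mul_zero, sub_zero]
  rw [this, EB, integral_div]
  ring

/-! ### The martingale-coboundary decomposition and the variance -/

/-- The function `F + α - α ∘ T_B`. When `α` solves the Poisson equation of `F`, it is annihilated
by the transfer operator, hence orthogonal to all functions of `T_B`. -/
def martingalePart (F α : Y.base → ℝ) (x : Y.base) : ℝ := F x + α x - α (Y.TB x)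

/-- The solution of the Poisson equation of a real function is real, since its conjugate is another
solution. -/
theorem poisson_real (h0 : 0 ≤ ν) (h1 : ν < 1) (hν : Y.BoundedDistortion Y.g ν)
    {a : Y.Holder ν} (ha : Y.EB a = 0)
    (ha' : ∀ x, a x - Y.transferB a x = Y.transferB (fun y => (F y : ℂ)) x) (x : Y.base) :
    a x = ((a x).re : ℂ) := by
  obtain ⟨a', h', -⟩ := Holder.exists_of_bound h0 (norm_nonneg a)
    (u := fun x => (starRingEnd ℂ) (a x))
    (fun x => by rw [Complex.norm_conj]; exact Holder.norm_apply_le a x)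
    (fun x y => by rw [← map_sub, Complex.norm_conj]; exact Holder.norm_sub_le h0 a x y)
  have hconj : ∀ u : Y.base → ℂ, ∀ x, Y.transferB (fun y => (starRingEnd ℂ) (u y)) x =
      (starRingEnd ℂ) (Y.transferB u x) := by
    intro u x
    rw [transferB_eq_tsum, transferB_eq_tsum, Complex.conj_tsum]
    refine tsum_congr fun i => ?_
    rw [map_mul, Complex.conj_ofReal]
  have hfun : a'.toFun = fun x => (starRingEnd ℂ) (a x) := funext h'
  have : a = a' := by
    refine poisson_unique h0 h1 hν ha ?_ fun x => ?_
    · have : ∫ x, (starRingEnd ℂ) (a x) ∂Y.mB = (starRingEnd ℂ) (∫ x, a x ∂Y.mB) := integral_conj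
      rw [hfun, EB, this, ← Complex.conj_ofReal, ← map_mul]
      have h := congrArg (starRingEnd ℂ) ha
      rw [map_zero] at h
      exact h
    · rw [hfun, hconj, ← map_sub, ha', ← hconj]
      simp only [Complex.conj_ofReal]
  have h2 := h' x
  rw [← this] at h2
  exact (Complex.conj_eq_iff_re.1 h2.symm).symm

theorem transferB_martingalePart (h0 : 0 ≤ ν) (h1 : ν < 1) (hν : Y.BoundedDistortion Y.g ν)
    (hF : Y.RetBound ν M F) {a : Y.Holder ν} {α : Y.base → ℝ} (hα : ∀ x, a x = (α x : ℂ))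
    (ha' : ∀ x, a x - Y.transferB a x = Y.transferB (fun y => (F y : ℂ)) x) (x : Y.base) :
    Y.transferB (fun y => (martingalePart F α y : ℂ)) x = 0 := by
  obtain ⟨K, hK0, hK1, hK2⟩ := Y.exists_weight_bound h0 h1.le hν
  have hK : Y.WeightBound ν K := ⟨hK0, hK1, hK2⟩
  have s1 := hF.colBound.summable_term hK x
  have s2 : Summable fun i => (Y.g (Y.branch i x) : ℂ) * a (Y.branch i x) := by
    have := ((Y.colBound_one h0).mul h0 (Holder.norm_apply_le a)
      (Holder.norm_sub_le h0 a)).summable_term hK x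
    simpa only [one_mul] using this
  have s3 : Summable fun i => (Y.g (Y.branch i x) : ℂ) * a x :=
    (Complex.hasSum_ofReal.2 (Y.hasSum_g_branch h0 h1 hν x)).summable.mul_right _
  have e3 : ∑' i, (Y.g (Y.branch i x) : ℂ) * a x = a x := by
    rw [tsum_mul_right, (Complex.hasSum_ofReal.2 (Y.hasSum_g_branch h0 h1 hν x)).tsum_eq,
      Complex.ofReal_one, one_mul]
  have e4 := ha' x
  rw [transferB_eq_tsum, transferB_eq_tsum] at e4
  rw [transferB_eq_tsum]
  have : ∀ i, (Y.g (Y.branch i x) : ℂ) * (martingalePart F α (Y.branch i x) : ℂ) =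
      (Y.g (Y.branch i x) : ℂ) * F (Y.branch i x) + (Y.g (Y.branch i x) : ℂ) * a (Y.branch i x) -
        (Y.g (Y.branch i x) : ℂ) * a x := by
    intro i
    simp only [martingalePart, TB_branch, hα]
    push_cast; ring
  simp only [this]
  rw [(s1.add s2).tsum_sub s3, s1.tsum_add s2, e3, ← e4]
  ring

/-- The martingale part is orthogonal to the functions of `T_B`. -/
theorem integral_martingalePart_mul {ψ v : Y.base → ℝ}
    (hψ : ∀ x, Y.transferB (fun y => (ψ y : ℂ)) x = 0)
    (hi : Integrable (fun x => ψ x * v (Y.TB x)) Y.mB) :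
    ∫ x, ψ x * v (Y.TB x) ∂Y.mB = 0 := by
  have h := Y.integral_transferB_mul (u := fun y => (ψ y : ℂ)) (v := fun y => (v y : ℂ))
    ((hi.ofReal (𝕜 := ℂ)).congr (ae_of_all _ fun x => Complex.ofReal_mul _ _))
  simp only [hψ, zero_mul, integral_zero] at h
  have h2 : ((∫ x, ψ x * v (Y.TB x) ∂Y.mB : ℝ) : ℂ) = 0 := by
    rw [← integral_complex_ofReal, h]
    push_cast; rfl
  exact_mod_cast h2

theorem Holder.measurable_of_eq_ofReal (h0 : 0 ≤ ν) (h1 : ν < 1) {a : Y.Holder ν} {α : Y.base → ℝ}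
    (hα : ∀ x, a x = (α x : ℂ)) : Measurable α := by
  have := Complex.measurable_re.comp (Holder.measurable h0 h1 a)
  convert this using 1
  ext x; simp [hα]

theorem Holder.abs_le_of_eq_ofReal {a : Y.Holder ν} {α : Y.base → ℝ}
    (hα : ∀ x, a x = (α x : ℂ)) (x : Y.base) : |α x| ≤ ‖a‖ := by
  have := Holder.norm_apply_le a x
  rwa [hα, Complex.norm_real] at this

theorem measurable_martingalePart (h0 : 0 ≤ ν) (h1 : ν < 1) (hF : Y.RetBound ν M F)
    {a : Y.Holder ν} {α : Y.base → ℝ} (hα : ∀ x, a x = (α x : ℂ)) :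
    Measurable (martingalePart F α) := by
  have hm := Holder.measurable_of_eq_ofReal h0 h1 hα
  exact ((hF.measurable h0 h1).add hm).sub (hm.comp Y.measurable_TB)

theorem abs_martingalePart_le (hF : Y.RetBound ν M F)
    {a : Y.Holder ν} {α : Y.base → ℝ} (hα : ∀ x, a x = (α x : ℂ)) (x : Y.base) :
    |martingalePart F α x| ≤ (M + 2 * ‖a‖) * Y.ret x := by
  have h1 := hF.abs_le x
  have h2 := Holder.abs_le_of_eq_ofReal hα x
  have h3 := Holder.abs_le_of_eq_ofReal hα (Y.TB x)
  have hr : (1 : ℝ) ≤ Y.ret x := by exact_mod_cast Y.ret_pos x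
  have h4 := abs_sub (F x + α x) (α (Y.TB x))
  have h5 := abs_add_le (F x) (α x)
  have h6 : ‖a‖ ≤ ‖a‖ * Y.ret x := le_mul_of_one_le_right (norm_nonneg _) hr
  simp only [martingalePart]
  linarith

theorem integrable_martingalePart_sq (h0 : 0 ≤ ν) (h1 : ν < 1)
    (hφ : Integrable (fun y => (Y.ret y : ℝ) ^ 2) Y.mB) (hF : Y.RetBound ν M F)
    {a : Y.Holder ν} {α : Y.base → ℝ} (hα : ∀ x, a x = (α x : ℂ)) :
    Integrable (fun x => martingalePart F α x ^ 2) Y.mB := by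
  refine (hφ.const_mul ((M + 2 * ‖a‖) ^ 2)).mono'
    ((measurable_martingalePart h0 h1 hF hα).pow_const 2).aestronglyMeasurable
    (ae_of_all _ fun x => ?_)
  rw [Real.norm_of_nonneg (sq_nonneg _), ← mul_pow]
  exact sq_le_sq' (_root_.abs_le.1 (abs_martingalePart_le hF hα x)).1
    (_root_.abs_le.1 (abs_martingalePart_le hF hα x)).2

/-- The Green–Kubo formula for the variance of the martingale part. -/
theorem integral_martingalePart_sq (h0 : 0 ≤ ν) (h1 : ν < 1) (hν : Y.BoundedDistortion Y.g ν)
    (hφ : Integrable (fun y => (Y.ret y : ℝ) ^ 2) Y.mB) (hF : Y.RetBound ν M F)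
    {a : Y.Holder ν} {α : Y.base → ℝ} (hα : ∀ x, a x = (α x : ℂ))
    (ha' : ∀ x, a x - Y.transferB a x = Y.transferB (fun y => (F y : ℂ)) x) :
    ∫ x, martingalePart F α x ^ 2 ∂Y.mB =
      ∫ x, F x ^ 2 ∂Y.mB + 2 * ∫ x, α x * F x ∂Y.mB := by
  have hm := Holder.measurable_of_eq_ofReal h0 h1 hα
  have hb := Holder.abs_le_of_eq_ofReal hα
  have hψm := measurable_martingalePart h0 h1 hF hα
  have hψ2 := integrable_martingalePart_sq h0 h1 hφ hF hα
  have hψi : Integrable (martingalePart F α) Y.mB :=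
    (Y.integrable_ret.const_mul (M + 2 * ‖a‖)).mono' hψm.aestronglyMeasurable
      (ae_of_all _ (abs_martingalePart_le hF hα))
  have hψα : Integrable (fun x => martingalePart F α x * α (Y.TB x)) Y.mB :=
    hψi.mul_bdd (c := ‖a‖) (hm.comp Y.measurable_TB).aestronglyMeasurable
      (ae_of_all _ fun x => hb _)
  have hFα : Integrable (fun x => α x * F x) Y.mB :=
    (hF.integrable h0 h1).bdd_mul (c := ‖a‖) hm.aestronglyMeasurable (ae_of_all _ hb)
  have hα2 : Integrable (fun x => α x ^ 2) Y.mB := by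
    refine Integrable.of_bound (hm.pow_const 2).aestronglyMeasurable (‖a‖ ^ 2)
      (ae_of_all _ fun x => ?_)
    rw [Real.norm_of_nonneg (sq_nonneg _)]
    exact sq_le_sq' (abs_le.1 (hb x)).1 (abs_le.1 (hb x)).2
  have horth := integral_martingalePart_mul (transferB_martingalePart h0 h1 hν hF hα ha') hψα
  have hα2' := Y.integrable_comp_TB hα2
  have hF2 := hF.integrable_sq h0 h1 hφ
  have e1 : ∫ x, (martingalePart F α x ^ 2 + 2 * (martingalePart F α x * α (Y.TB x)) +
      α (Y.TB x) ^ 2) ∂Y.mB = ∫ x, (F x ^ 2 + 2 * (α x * F x) + α x ^ 2) ∂Y.mB := by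
    congr 1
    ext x
    simp only [martingalePart]; ring
  have i1 : Integrable (fun x => martingalePart F α x ^ 2 +
      2 * (martingalePart F α x * α (Y.TB x))) Y.mB := hψ2.add (hψα.const_mul 2)
  have i2 : Integrable (fun x => F x ^ 2 + 2 * (α x * F x)) Y.mB := hF2.add (hFα.const_mul 2)
  rw [integral_add i1 hα2', integral_add hψ2 (hψα.const_mul 2),
    integral_const_mul, horth, integral_add i2 hα2,
    integral_add hF2 (hFα.const_mul 2), integral_const_mul,
    Y.integral_comp_TB (w := fun x => α x ^ 2) hα2.1] at e1
  linarith

end YoungTower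

/-! ### The central limit theorem for the induced map -/

namespace YoungTower

open TowerMap

variable {X I : Type*} [MeasurableSpace X] {m : Measure X} [IsProbabilityMeasure m] [Countable I]
  {Y : YoungTower m I} {ν M : ℝ} {F : Y.base → ℝ}

theorem measurable_birkB (hF : Measurable F) (n : ℕ) : Measurable (Y.birkB F n) :=
  Finset.measurable_sum _ fun k _ => hF.comp (Y.measurable_TB.iterate k)

theorem norm_exp_I_mul_mul (t x : ℝ) : ‖Complex.exp (Complex.I * t * x)‖ = 1 := by
  have := norm_exp_I_mul (t * x)
  push_cast at this
  rwa [← mul_assoc] at this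

/-- Along an eigenfunction, the characteristic function of a Birkhoff sum of the induced map is
a power of the eigenvalue. -/
theorem integral_exp_birkB_mul (h0 : 0 ≤ ν) (h1 : ν < 1) (hF : Y.RetBound ν M F) {w : Y.Holder ν}
    {t : ℝ} {lam : ℂ}
    (heig : ∀ x, Y.transferB (fun y => Complex.exp (Complex.I * t * F y) * (1 + w y)) x =
      lam * (1 + w x)) (n : ℕ) :
    ∫ x, (1 + w x) * Complex.exp (Complex.I * t * Y.birkB F n x) ∂Y.mB =
      lam ^ n * ∫ x, (1 + w x) ∂Y.mB := by
  have hFm := hF.measurable h0 h1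
  have hw := Holder.measurable h0 h1 w
  induction n with
  | zero => simp [birkB]
  | succ n ih =>
    have hSm := measurable_birkB hFm n
    have hi : Integrable (fun y => Complex.exp (Complex.I * t * F y) * (1 + w y) *
        Complex.exp (Complex.I * t * Y.birkB F n (Y.TB y))) Y.mB := by
      have hT := Y.measurable_TB
      refine Integrable.of_bound (Measurable.aestronglyMeasurable (by fun_prop)) (1 + ‖w‖)
        (ae_of_all _ fun x => ?_)
      rw [norm_mul, norm_mul, norm_exp_I_mul_mul, norm_exp_I_mul_mul, one_mul, mul_one]
      refine (norm_add_le _ _).trans ?_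
      rw [norm_one]
      exact add_le_add_right (Holder.norm_apply_le w x) 1
    have h := Y.integral_transferB_mul
      (v := fun y => Complex.exp (Complex.I * t * Y.birkB F n y)) hi
    simp only [heig, mul_assoc lam, integral_const_mul, ih] at h
    rw [pow_succ', mul_assoc, h]
    congr 1
    ext x
    rw [birkB_succ]
    push_cast
    rw [mul_add (Complex.I * (t : ℂ)), Complex.exp_add]
    ring

/-- The characteristic function of a Birkhoff sum of the induced map is a power of the eigenvalue,
up to an error controlled by the distance of the eigenfunction to `1`. -/
theorem norm_integral_exp_birkB_sub_le (h0 : 0 ≤ ν) (h1 : ν < 1) (hF : Y.RetBound ν M F)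
    {w : Y.Holder ν} {t : ℝ} {lam : ℂ} (hw : Y.EB w = 0)
    (heig : ∀ x, Y.transferB (fun y => Complex.exp (Complex.I * t * F y) * (1 + w y)) x =
      lam * (1 + w x)) (n : ℕ) :
    ‖∫ x, Complex.exp (Complex.I * t * Y.birkB F n x) ∂Y.mB - lam ^ n * m.real Y.base‖ ≤
      ‖w‖ * m.real Y.base := by
  have hSm := measurable_birkB (hF.measurable h0 h1) n
  have hwm := Holder.measurable h0 h1 w
  have hb := Y.measure_base_pos
  have hw0 : ∫ x, w x ∂Y.mB = 0 := by
    rw [EB, mul_eq_zero] at hw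
    refine hw.resolve_left ?_
    exact_mod_cast (inv_pos.2 hb).ne'
  have h1' : ∫ x, (1 + w x) ∂Y.mB = m.real Y.base := by
    rw [integral_add (integrable_const _) (Holder.integrable h0 h1 w), hw0, add_zero]
    simp [mB_real_univ]
  have he : Integrable (fun x => Complex.exp (Complex.I * t * Y.birkB F n x)) Y.mB :=
    Integrable.of_bound (Measurable.aestronglyMeasurable (by fun_prop)) 1
      (ae_of_all _ fun x => (norm_exp_I_mul_mul _ _).le)
  have hb2 : ∀ x, ‖w x * Complex.exp (Complex.I * t * Y.birkB F n x)‖ ≤ ‖w‖ := fun x => by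
    rw [norm_mul, norm_exp_I_mul_mul, mul_one]; exact Holder.norm_apply_le w x
  have hwe : Integrable (fun x => w x * Complex.exp (Complex.I * t * Y.birkB F n x)) Y.mB :=
    Integrable.of_bound (Measurable.aestronglyMeasurable (by fun_prop)) ‖w‖ (ae_of_all _ hb2)
  have h := integral_exp_birkB_mul h0 h1 hF heig n
  rw [h1'] at h
  simp only [add_mul, one_mul] at h
  rw [integral_add he hwe] at h
  rw [← h, sub_add_cancel_left, norm_neg]
  refine (norm_integral_le_of_norm_le_const (ae_of_all _ hb2)).trans ?_
  rw [mB_real_univ]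

/-- `λ(t) = 1 - V t ^ 2 / (2 m(B)) + o(t ^ 2)`, where `V` is the integral of the square of the
martingale part of `F`. -/
theorem tendsto_eigenvalue_sub_one_div_sq (h0 : 0 ≤ ν) (h1 : ν < 1)
    (hν : Y.BoundedDistortion Y.g ν) (hφ : Integrable (fun y => (Y.ret y : ℝ) ^ 2) Y.mB)
    (hF : Y.RetBound ν M F) (hF0 : ∫ x, F x ∂Y.mB = 0) {a : Y.Holder ν} {α : Y.base → ℝ}
    (hα : ∀ x, a x = (α x : ℂ))
    (ha' : ∀ x, a x - Y.transferB a x = Y.transferB (fun y => (F y : ℂ)) x)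
    {K : ℝ} {lam : ℝ → ℂ}
    (hlam : ∀ᶠ t : ℝ in 𝓝 0, ‖lam t - (Y.EB (fun x => Complex.exp (Complex.I * t * F x)) -
      (t : ℂ) ^ 2 * Y.EB (fun x => a x * (F x : ℂ)))‖ ≤ K * |t| ^ 3) :
    Tendsto (fun t : ℝ => (lam t - 1) / (t : ℂ) ^ 2) (𝓝[≠] 0)
      (𝓝 (-(((m.real Y.base)⁻¹ * ∫ x, martingalePart F α x ^ 2 ∂Y.mB : ℝ) : ℂ) / 2)) := by
  have e1 := tendsto_EB_exp_sub_one_div_sq h0 h1 hφ hF hF0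
  have e2 : Tendsto (fun t : ℝ => (lam t - (Y.EB (fun x => Complex.exp (Complex.I * t * F x)) -
      (t : ℂ) ^ 2 * Y.EB (fun x => a x * (F x : ℂ)))) / (t : ℂ) ^ 2) (𝓝[≠] 0) (𝓝 0) := by
    have hlim : Tendsto (fun t : ℝ => K * |t|) (𝓝[≠] 0) (𝓝 0) := by
      have : Continuous fun t : ℝ => K * |t| := by fun_prop
      simpa using (this.tendsto 0).mono_left nhdsWithin_le_nhds
    refine squeeze_zero_norm' ?_ hlim
    filter_upwards [hlam.filter_mono nhdsWithin_le_nhds, self_mem_nhdsWithin] with t ht ht0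
    have ht2 : 0 < |t| ^ 2 := pow_pos (abs_pos.2 ht0) 2
    rw [norm_div, norm_pow, Complex.norm_real, Real.norm_eq_abs, div_le_iff₀ ht2]
    exact ht.trans (le_of_eq (by ring))
  have hEaF : Y.EB (fun x => a x * (F x : ℂ)) =
      (((m.real Y.base)⁻¹ * ∫ x, α x * F x ∂Y.mB : ℝ) : ℂ) := by
    rw [← EB_ofReal]
    congr 1
    ext x
    rw [hα]; push_cast; rfl
  have e3 := (e2.add e1).sub_const (Y.EB (fun x => a x * (F x : ℂ)))
  have e4 : 0 + -(((m.real Y.base)⁻¹ * ∫ x, F x ^ 2 ∂Y.mB : ℝ) : ℂ) / 2 -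
      Y.EB (fun x => a x * (F x : ℂ)) =
      -(((m.real Y.base)⁻¹ * ∫ x, martingalePart F α x ^ 2 ∂Y.mB : ℝ) : ℂ) / 2 := by
    rw [hEaF, integral_martingalePart_sq h0 h1 hν hφ hF hα ha']
    push_cast; ring
  rw [e4] at e3
  refine e3.congr' ?_
  filter_upwards [self_mem_nhdsWithin] with t ht
  have : (t : ℂ) ≠ 0 := by exact_mod_cast ht
  field_simp
  ring

theorem tendsto_natFloor_mul_div {b : ℝ} (hb : 0 < b) :
    Tendsto (fun N : ℕ => (⌊b * N⌋₊ : ℝ) / N) atTop (𝓝 b) :=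
  (tendsto_nat_floor_mul_div_atTop hb.le).comp tendsto_natCast_atTop_atTop

theorem tendsto_natFloor_mul {b : ℝ} (hb : 0 < b) :
    Tendsto (fun N : ℕ => ⌊b * (N : ℝ)⌋₊) atTop atTop :=
  tendsto_nat_floor_atTop.comp (tendsto_natCast_atTop_atTop.const_mul_atTop hb)

theorem tendsto_div_sqrt (s : ℝ) : Tendsto (fun N : ℕ => s / √(N : ℝ)) atTop (𝓝 0) :=
  (Real.tendsto_sqrt_atTop.comp tendsto_natCast_atTop_atTop).const_div_atTop s

/-- Nagaev's method: convergence of the characteristic functions of the Birkhoff sums of the induced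
map, over a time which is a proportion `m(B)` of the normalizing time. -/
theorem tendsto_integral_exp_birkB (h0 : 0 ≤ ν) (h1 : ν < 1)
    (hν : Y.BoundedDistortion Y.g ν) (hφ : Integrable (fun y => (Y.ret y : ℝ) ^ 2) Y.mB)
    (hF : Y.RetBound ν M F) (hF0 : ∫ x, F x ∂Y.mB = 0) {a : Y.Holder ν} {α : Y.base → ℝ}
    (ha : Y.EB a = 0) (hα : ∀ x, a x = (α x : ℂ))
    (ha' : ∀ x, a x - Y.transferB a x = Y.transferB (fun y => (F y : ℂ)) x) {s : ℝ} (hs : s ≠ 0) :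
    Tendsto (fun N : ℕ => ∫ x, Complex.exp (Complex.I * (s / √(N : ℝ) : ℝ) *
      Y.birkB F ⌊m.real Y.base * N⌋₊ x) ∂Y.mB) atTop
      (𝓝 (m.real Y.base *
        Complex.exp (-((∫ x, martingalePart F α x ^ 2 ∂Y.mB : ℝ) : ℂ) * s ^ 2 / 2))) := by
  obtain ⟨ε, -, δ, hδ, C, w, lam, H⟩ := exists_eigenvalue h0 h1 hν hφ hF ha ha'
  have hb := Y.measure_base_pos
  set b := m.real Y.base
  set V := ∫ x, martingalePart F α x ^ 2 ∂Y.mB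
  have hball : ∀ᶠ t : ℝ in 𝓝 0, |t| < δ := by
    filter_upwards [Metric.ball_mem_nhds (0 : ℝ) hδ] with t ht
    simpa using ht
  have hC : ∀ t : ℝ, |t| < δ → ‖w t - (Complex.I * t) • a‖ ≤ |C| * t ^ 2 := fun t ht =>
    (H t ht).2.2.1.trans (mul_le_mul_of_nonneg_right (le_abs_self C) (sq_nonneg t))
  have hexp := tendsto_eigenvalue_sub_one_div_sq h0 h1 hν hφ hF hF0 hα ha'
    (hball.mono fun t ht => norm_eigenvalue_sub_le h0 h1 hφ hF (abs_nonneg C) (H t ht).1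
      (H t ht).2.1 (hC t ht))
  have ht0 := tendsto_div_sqrt s
  have hne : ∀ᶠ N : ℕ in atTop, s / √(N : ℝ) ≠ 0 := by
    filter_upwards [eventually_gt_atTop 0] with N hN
    have : 0 < √(N : ℝ) := Real.sqrt_pos.2 (by exact_mod_cast hN)
    exact div_ne_zero hs this.ne'
  have ht0' : Tendsto (fun N : ℕ => s / √(N : ℝ)) atTop (𝓝[≠] 0) :=
    tendsto_nhdsWithin_iff.2 ⟨ht0, hne⟩
  have hp := tendsto_natFloor_mul hb
  have hpz : Tendsto (fun N : ℕ => (⌊b * (N : ℝ)⌋₊ : ℂ) * (lam (s / √(N : ℝ)) - 1)) atTop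
      (𝓝 (-(V : ℂ) * s ^ 2 / 2)) := by
    have h2 : Tendsto (fun N : ℕ => (((⌊b * (N : ℝ)⌋₊ : ℝ) / N * s ^ 2 : ℝ) : ℂ)) atTop
        (𝓝 ((b * s ^ 2 : ℝ) : ℂ)) :=
      (Complex.continuous_ofReal.tendsto _).comp ((tendsto_natFloor_mul_div hb).mul_const _)
    have h3 := h2.mul (hexp.comp ht0')
    have e : ((b * s ^ 2 : ℝ) : ℂ) * (-((b⁻¹ * V : ℝ) : ℂ) / 2) = -(V : ℂ) * s ^ 2 / 2 := by
      have : (b : ℂ) ≠ 0 := by exact_mod_cast hb.ne'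
      push_cast
      field_simp
    rw [e] at h3
    refine h3.congr' ?_
    filter_upwards [eventually_gt_atTop 0] with N hN
    have hN' : (0 : ℝ) < N := by exact_mod_cast hN
    have hsq : ((s / √(N : ℝ) : ℝ) : ℂ) ^ 2 = ((s ^ 2 / N : ℝ) : ℂ) := by
      rw [← Complex.ofReal_pow, div_pow, Real.sq_sqrt hN'.le]
    have hN2 : (N : ℂ) ≠ 0 := by exact_mod_cast hN.ne'
    have hs2 : (s : ℂ) ≠ 0 := by exact_mod_cast hs
    simp only [Function.comp_apply]
    rw [hsq]
    push_cast
    field_simp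
  have hpow := tendsto_one_add_pow_exp hp hpz
  simp only [add_sub_cancel] at hpow
  have hmain := hpow.mul_const (b : ℂ)
  have herr : Tendsto (fun N : ℕ => ∫ x, Complex.exp (Complex.I * (s / √(N : ℝ) : ℝ) *
      Y.birkB F ⌊b * N⌋₊ x) ∂Y.mB - lam (s / √(N : ℝ)) ^ ⌊b * (N : ℝ)⌋₊ * b) atTop (𝓝 0) := by
    have hg : Tendsto (fun t : ℝ => (|C| * t ^ 2 + |t| * ‖a‖) * b) (𝓝 0) (𝓝 0) := by
      have : Continuous fun t : ℝ => (|C| * t ^ 2 + |t| * ‖a‖) * b := by fun_prop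
      simpa using this.tendsto 0
    refine squeeze_zero_norm' ?_ (hg.comp ht0)
    filter_upwards [ht0.eventually hball] with N hN
    refine (norm_integral_exp_birkB_sub_le h0 h1 hF (H _ hN).1 (H _ hN).2.1 _).trans ?_
    refine mul_le_mul_of_nonneg_right ?_ hb.le
    have h5 := norm_le_norm_sub_add (w (s / √(N : ℝ))) ((Complex.I * (s / √(N : ℝ) : ℝ)) • a)
    rw [norm_smul, norm_mul, Complex.norm_I, one_mul, Complex.norm_real, Real.norm_eq_abs] at h5
    exact h5.trans (add_le_add_left (hC _ hN) _)
  have := herr.add hmain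
  simp only [sub_add_cancel, zero_add] at this
  rwa [mul_comm] at this

/-! ### Variance of the Birkhoff sums of the induced map -/

theorem memLp_birkB {ψ : Y.base → ℝ} (hψ : MemLp ψ 2 Y.mB) (n : ℕ) :
    MemLp (Y.birkB ψ n) 2 Y.mB :=
  memLp_finsetSum _ fun k _ => hψ.comp_measurePreserving (Y.measurePreserving_TB.iterate k)

/-- The functions `ψ ∘ T_B ^ k` are orthogonal when `T̂_B ψ = 0`. -/
theorem integral_birkB_sq {ψ : Y.base → ℝ} (hψ : MemLp ψ 2 Y.mB)
    (hT : ∀ x, Y.transferB (fun y => (ψ y : ℂ)) x = 0) (n : ℕ) :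
    ∫ x, Y.birkB ψ n x ^ 2 ∂Y.mB = n * ∫ x, ψ x ^ 2 ∂Y.mB := by
  induction n with
  | zero => simp [birkB]
  | succ n ih =>
    have hS := memLp_birkB hψ n
    have hS' : MemLp (fun x => Y.birkB ψ n (Y.TB x)) 2 Y.mB :=
      hS.comp_measurePreserving Y.measurePreserving_TB
    have i1 := hψ.integrable_sq
    have i2 : Integrable (fun x => ψ x * Y.birkB ψ n (Y.TB x)) Y.mB := hψ.integrable_mul hS'
    have i3 := hS'.integrable_sq
    have e : ∀ x, Y.birkB ψ (n + 1) x ^ 2 =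
        ψ x ^ 2 + 2 * (ψ x * Y.birkB ψ n (Y.TB x)) + Y.birkB ψ n (Y.TB x) ^ 2 := by
      intro x; rw [birkB_succ]; ring
    have i4 : Integrable (fun x => ψ x ^ 2 + 2 * (ψ x * Y.birkB ψ n (Y.TB x))) Y.mB :=
      i1.add (i2.const_mul 2)
    simp only [e]
    rw [integral_add i4 i3, integral_add i1 (i2.const_mul 2), integral_const_mul,
      integral_martingalePart_mul hT i2,
      Y.integral_comp_TB (w := fun x => Y.birkB ψ n x ^ 2) hS.integrable_sq.1, ih]
    push_cast; ring

/-- The Birkhoff sums of `F` and of its martingale part differ by a bounded function. -/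
theorem birkB_martingalePart (F α : Y.base → ℝ) (n : ℕ) (x : Y.base) :
    Y.birkB (martingalePart F α) n x = Y.birkB F n x + α x - α (Y.TB^[n] x) := by
  induction n generalizing x with
  | zero => simp [birkB]
  | succ n ih =>
    rw [birkB_succ, birkB_succ, ih, Function.iterate_succ_apply, martingalePart]; ring

/-- The variance of the Birkhoff sums of the induced map grows at most linearly. -/
theorem exists_integral_birkB_sq_le (h0 : 0 ≤ ν) (h1 : ν < 1) (hν : Y.BoundedDistortion Y.g ν)
    (hφ : Integrable (fun y => (Y.ret y : ℝ) ^ 2) Y.mB) (hF : Y.RetBound ν M F)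
    (hF0 : ∫ x, F x ∂Y.mB = 0) :
    ∃ C : ℝ, 0 ≤ C ∧ ∀ n : ℕ, Integrable (fun x => Y.birkB F n x ^ 2) Y.mB ∧
      ∫ x, Y.birkB F n x ^ 2 ∂Y.mB ≤ C * (n + 1) := by
  obtain ⟨a, ha, ha'⟩ := exists_poisson h0 h1 hν hF hF0
  have hα := poisson_real h0 h1 hν ha ha'
  set α : Y.base → ℝ := fun x => (a x).re
  have hψm := measurable_martingalePart h0 h1 hF hα
  have hψ : MemLp (martingalePart F α) 2 Y.mB :=
    (memLp_two_iff_integrable_sq hψm.aestronglyMeasurable).2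
      (integrable_martingalePart_sq h0 h1 hφ hF hα)
  have hFm := hF.measurable h0 h1
  have hF2 : MemLp F 2 Y.mB :=
    (memLp_two_iff_integrable_sq hFm.aestronglyMeasurable).2 (hF.integrable_sq h0 h1 hφ)
  set V := ∫ x, martingalePart F α x ^ 2 ∂Y.mB
  have hV : 0 ≤ V := integral_nonneg fun x => sq_nonneg _
  have hb := Y.measure_base_pos
  refine ⟨2 * V + 8 * ‖a‖ ^ 2 * m.real Y.base, by positivity, fun n =>
    ⟨(memLp_birkB hF2 n).integrable_sq, ?_⟩⟩
  have hle : ∀ x, Y.birkB F n x ^ 2 ≤ 2 * Y.birkB (martingalePart F α) n x ^ 2 + 8 * ‖a‖ ^ 2 := by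
    intro x
    have e := birkB_martingalePart F α n x
    have b1 := abs_le.1 (Holder.abs_le_of_eq_ofReal hα x)
    have b2 := abs_le.1 (Holder.abs_le_of_eq_ofReal hα (Y.TB^[n] x))
    have h3 : (α (Y.TB^[n] x) - α x) ^ 2 ≤ (2 * ‖a‖) ^ 2 :=
      sq_le_sq' (by linarith) (by linarith)
    have h4 : Y.birkB F n x = Y.birkB (martingalePart F α) n x + (α (Y.TB^[n] x) - α x) := by
      rw [e]; ring
    rw [h4]
    linarith [add_sq_le (a := Y.birkB (martingalePart F α) n x) (b := α (Y.TB^[n] x) - α x)]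
  have hi := (memLp_birkB hψ n).integrable_sq
  have h5 := integral_mono (memLp_birkB hF2 n).integrable_sq
    ((hi.const_mul 2).add (integrable_const (8 * ‖a‖ ^ 2))) hle
  refine h5.trans ?_
  have h6 : ∫ x, (2 * Y.birkB (martingalePart F α) n x ^ 2 + 8 * ‖a‖ ^ 2) ∂Y.mB =
      2 * (n * V) + 8 * ‖a‖ ^ 2 * m.real Y.base := by
    rw [integral_add (hi.const_mul 2) (integrable_const _), integral_const_mul,
      integral_birkB_sq hψ (transferB_martingalePart h0 h1 hν hF hα ha')]
    rw [integral_const, smul_eq_mul, mB_real_univ, mul_comm (m.real Y.base)]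
  refine h6.le.trans ?_
  have : 0 ≤ 8 * ‖a‖ ^ 2 * m.real Y.base * n := by positivity
  nlinarith

end YoungTower

/-! ### From the induced map to the tower -/

namespace TowerMap

variable {X I : Type*} (Y : TowerMap X I)

/-- Birkhoff sums over a long time are split in blocks of length `l`. -/
theorem abs_birk_mul_add_le {f : X → ℝ} {A : ℝ} (hA : ∀ x, |f x| ≤ A) (q l r : ℕ) (x : X) :
    |Y.birk f (q * l + r) x| ≤ ∑ j ∈ Finset.range q, |Y.birk f l (Y.T^[j * l] x)| + r * A := by
  have h : Y.birk f (q * l) x = ∑ j ∈ Finset.range q, Y.birk f l (Y.T^[j * l] x) := by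
    induction q with
    | zero => simp [birk]
    | succ q ih => rw [add_mul, one_mul, birk_add, ih, Finset.sum_range_succ]
  rw [birk_add, h]
  exact (abs_add_le _ _).trans (add_le_add (Finset.abs_sum_le_sum_abs _ _) (Y.abs_birk_le hA r _))

/-- Control of the oscillation of the Birkhoff sums over the window of times `[n, n + q * l]`. -/
theorem abs_birk_sub_birk_window_le {f : X → ℝ} {A : ℝ} (hA : ∀ x, |f x| ≤ A) {n k q l : ℕ}
    (hl : 0 < l) (hnk : n ≤ k) (hk : k ≤ n + q * l) (x : X) :
    |Y.birk f k x - Y.birk f n x| ≤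
      ∑ j ∈ Finset.range q, |Y.birk f l (Y.T^[n + j * l] x)| + l * A := by
  obtain ⟨d, rfl⟩ := Nat.exists_eq_add_of_le hnk
  have hA0 : 0 ≤ A := (abs_nonneg _).trans (hA x)
  rw [birk_add, add_sub_cancel_left]
  have hd : d = d / l * l + d % l := (Nat.div_add_mod' d l).symm
  have h1 := Y.abs_birk_mul_add_le hA (d / l) l (d % l) (Y.T^[n] x)
  rw [← hd] at h1
  simp only [← Function.iterate_add_apply] at h1
  refine h1.trans (add_le_add ?_ ?_)
  · simp only [add_comm n]
    refine Finset.sum_le_sum_of_subset_of_nonneg ?_ fun _ _ _ => abs_nonneg _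
    refine Finset.range_subset_range.2 ?_
    exact Nat.div_le_of_le_mul (by rw [mul_comm]; omega)
  · exact mul_le_mul_of_nonneg_right (by exact_mod_cast (Nat.mod_lt d hl).le) hA0

theorem birkB_ret_sub (c : ℝ) (n : ℕ) (x : Y.base) :
    Y.birkB (fun y => Y.ret y - c) n x = Y.retSum n x - n * c := by
  simp [birkB, retSum, Finset.sum_sub_distrib]

end TowerMap

theorem norm_exp_I_mul_mul_sub_le (t x y : ℝ) :
    ‖Complex.exp (Complex.I * t * x) - Complex.exp (Complex.I * t * y)‖ ≤ |t| * |x - y| := by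
  have := norm_exp_I_mul_sub_le (t * x) (t * y)
  push_cast at this
  rwa [← mul_sub, abs_mul, ← mul_assoc, ← mul_assoc] at this

namespace YoungTower

open TowerMap

variable {X I : Type*} [MeasurableSpace X] {m : Measure X} [IsProbabilityMeasure m] [Countable I]
  {Y : YoungTower m I} {ν A : ℝ} {f : X → ℝ}

theorem measurable_birk (hf : Measurable f) (n : ℕ) : Measurable (Y.birk f n) :=
  Finset.measurable_sum _ fun k _ => hf.comp (Y.measurable_iterate k)

theorem measurable_birk_base (hf : Measurable f) (n : ℕ) :
    Measurable fun x : Y.base => Y.birk f n x :=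
  (measurable_birk hf n).comp measurable_subtype_coe

theorem measurable_retSum (n : ℕ) : Measurable (Y.retSum n) :=
  Finset.measurable_sum _ fun k _ => Y.measurable_ret.comp (Y.measurable_TB.iterate k)

/-- `C` is the constant of a linear bound for the second moments of the Birkhoff sums of `f_B` and
of the centred return time `φ - 1 / m(B)` under the return map. -/
structure VarianceBound (Y : YoungTower m I) (f : X → ℝ) (C : ℝ) : Prop where
  nonneg : 0 ≤ C
  integrable_birkB : ∀ n : ℕ, Integrable (fun x => Y.birkB (Y.fB f) n x ^ 2) Y.mB
  birkB_le : ∀ n : ℕ, ∫ x, Y.birkB (Y.fB f) n x ^ 2 ∂Y.mB ≤ C * (n + 1)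
  integrable_retSum : ∀ n : ℕ,
    Integrable (fun x => (Y.retSum n x - n * (m.real Y.base)⁻¹) ^ 2) Y.mB
  retSum_le : ∀ n : ℕ, ∫ x, (Y.retSum n x - n * (m.real Y.base)⁻¹) ^ 2 ∂Y.mB ≤ C * (n + 1)

theorem measureReal_base_le_one : m.real Y.base ≤ 1 := measureReal_le_one

theorem abs_natFloor_mul_inv_sub_le {b : ℝ} (hb : 0 < b) (N : ℕ) :
    |(⌊b * (N : ℝ)⌋₊ : ℝ) * b⁻¹ - N| ≤ b⁻¹ := by
  have h1 := Nat.floor_le (a := b * (N : ℝ)) (by positivity)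
  have h2 := (Nat.lt_floor_add_one (b * (N : ℝ))).le
  have e : (⌊b * (N : ℝ)⌋₊ : ℝ) * b⁻¹ - N = ((⌊b * (N : ℝ)⌋₊ : ℝ) - b * N) * b⁻¹ := by
    field_simp
  rw [e, abs_mul, abs_of_pos (inv_pos.2 hb)]
  refine mul_le_of_le_one_left (inv_pos.2 hb).le ?_
  rw [abs_le]; constructor <;> linarith

theorem natFloor_mul_le {b : ℝ} (hb : 0 < b) (hb1 : b ≤ 1) (N : ℕ) :
    (⌊b * (N : ℝ)⌋₊ : ℝ) ≤ N :=
  (Nat.floor_le (by positivity)).trans (mul_le_of_le_one_left (by positivity) hb1)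

/-- The return time `Φ_n`, with `n` close to `m(B) N`, is at distance `O(√N)` of `N`. -/
theorem VarianceBound.integral_retSum_sub_sq_le {C : ℝ} (h : VarianceBound Y f C) (N : ℕ) :
    Integrable (fun x => ((Y.retSum ⌊m.real Y.base * N⌋₊ x : ℝ) - N) ^ 2) Y.mB ∧
    ∫ x, ((Y.retSum ⌊m.real Y.base * N⌋₊ x : ℝ) - N) ^ 2 ∂Y.mB ≤
      2 * (C + (m.real Y.base)⁻¹) * (N + 1) := by
  have hb := Y.measure_base_pos
  have hb1 : m.real Y.base ≤ 1 := measureReal_base_le_one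
  set b := m.real Y.base with hbdef
  set p := ⌊b * (N : ℝ)⌋₊
  have hpN : (p : ℝ) ≤ N := natFloor_mul_le hb hb1 N
  have h1 := abs_natFloor_mul_inv_sub_le hb N
  have hle : ∀ x, ((Y.retSum p x : ℝ) - N) ^ 2 ≤
      2 * ((Y.retSum p x : ℝ) - p * b⁻¹) ^ 2 + 2 * b⁻¹ ^ 2 := by
    intro x
    have e : (Y.retSum p x : ℝ) - N = ((Y.retSum p x : ℝ) - p * b⁻¹) + (p * b⁻¹ - N) := by ring
    have h2 : ((p : ℝ) * b⁻¹ - N) ^ 2 ≤ b⁻¹ ^ 2 := sq_le_sq' (abs_le.1 h1).1 (abs_le.1 h1).2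
    rw [e]
    linarith [add_sq_le (a := (Y.retSum p x : ℝ) - p * b⁻¹) (b := p * b⁻¹ - N)]
  have hi := (((h.integrable_retSum p).const_mul 2).add
    (integrable_const (μ := Y.mB) (2 * b⁻¹ ^ 2)))
  have hi' : Integrable (fun x => ((Y.retSum p x : ℝ) - N) ^ 2) Y.mB := by
    refine hi.mono' (((measurable_from_nat.comp (measurable_retSum p)).sub_const _).pow_const
      2).aestronglyMeasurable (ae_of_all _ fun x => ?_)
    rw [Real.norm_of_nonneg (sq_nonneg _)]
    exact hle x
  refine ⟨hi', (integral_mono hi' hi hle).trans ?_⟩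
  have e : ∫ x, (2 * ((Y.retSum p x : ℝ) - p * b⁻¹) ^ 2 + 2 * b⁻¹ ^ 2) ∂Y.mB =
      2 * ∫ x, ((Y.retSum p x : ℝ) - p * b⁻¹) ^ 2 ∂Y.mB + 2 * b⁻¹ := by
    rw [integral_add ((h.integrable_retSum p).const_mul 2) (integrable_const _),
      integral_const_mul, integral_const, smul_eq_mul, mB_real_univ, ← hbdef]
    congr 1
    field_simp
  refine e.le.trans ?_
  have h3 := h.retSum_le p
  have h4 : C * ((p : ℝ) + 1) ≤ C * (N + 1) :=
    mul_le_mul_of_nonneg_left (by linarith) h.nonneg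
  have h5 : b⁻¹ ≤ b⁻¹ * (N + 1) := le_mul_of_one_le_right (inv_pos.2 hb).le (by simp)
  linarith

/-- The second moment of `S_N f` on the base is `O(N)`: compare `N` with a return time. -/
theorem VarianceBound.integral_birk_sq_le {C : ℝ} (h : VarianceBound Y f C) (hf : Measurable f)
    (hA : ∀ x, |f x| ≤ A) (N : ℕ) :
    ∫ x : Y.base, Y.birk f N x ^ 2 ∂Y.mB ≤
      (2 * C + 4 * A ^ 2 * (C + (m.real Y.base)⁻¹)) * (N + 1) := by
  have hb := Y.measure_base_pos
  have hb1 : m.real Y.base ≤ 1 := measureReal_base_le_one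
  have hpN := natFloor_mul_le hb hb1 N
  obtain ⟨i1, h1⟩ := h.integral_retSum_sub_sq_le N
  set p := ⌊m.real Y.base * (N : ℝ)⌋₊
  have hle : ∀ x : Y.base, Y.birk f N x ^ 2 ≤
      2 * Y.birkB (Y.fB f) p x ^ 2 + 2 * A ^ 2 * ((Y.retSum p x : ℝ) - N) ^ 2 := by
    intro x
    have e := Y.birk_retSum f p x
    have h2 := Y.abs_birk_sub_birk_le hA N (Y.retSum p x) x
    have h3 : (Y.birk f N x - Y.birk f (Y.retSum p x) x) ^ 2 ≤
        A ^ 2 * ((Y.retSum p x : ℝ) - N) ^ 2 := by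
      rw [← sq_abs]
      refine (pow_le_pow_left₀ (abs_nonneg _) h2 2).trans (le_of_eq ?_)
      rw [mul_pow, sq_abs]; ring
    have e2 : Y.birk f N x = Y.birkB (Y.fB f) p x +
        (Y.birk f N x - Y.birk f (Y.retSum p x) x) := by rw [← e]; ring
    rw [e2]
    linarith [add_sq_le (a := Y.birkB (Y.fB f) p x)
      (b := Y.birk f N x - Y.birk f (Y.retSum p x) x)]
  have i2 := (h.integrable_birkB p).const_mul 2
  have i3 := i1.const_mul (2 * A ^ 2)
  have hi : Integrable (fun x : Y.base => Y.birk f N x ^ 2) Y.mB := by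
    refine (i2.add i3).mono' ((measurable_birk_base hf N).pow_const 2).aestronglyMeasurable
      (ae_of_all _ fun x => ?_)
    rw [Real.norm_of_nonneg (sq_nonneg _)]
    exact hle x
  refine (integral_mono hi (i2.add i3) hle).trans ?_
  have e : ∫ x, (2 * Y.birkB (Y.fB f) p x ^ 2 + 2 * A ^ 2 * ((Y.retSum p x : ℝ) - N) ^ 2) ∂Y.mB =
      2 * ∫ x, Y.birkB (Y.fB f) p x ^ 2 ∂Y.mB +
        2 * A ^ 2 * ∫ x, ((Y.retSum p x : ℝ) - N) ^ 2 ∂Y.mB := by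
    rw [integral_add i2 i3, integral_const_mul, integral_const_mul]
  refine e.le.trans ?_
  have h3 := h.birkB_le p
  have h4 : C * ((p : ℝ) + 1) ≤ C * (N + 1) :=
    mul_le_mul_of_nonneg_left (by linarith) h.nonneg
  have h5 := mul_le_mul_of_nonneg_left h1 (by positivity : 0 ≤ 2 * A ^ 2)
  linarith

/-- `∫ |S_k f| dm = O(√k)`. On the column over `y`, the sum `S_k f` is `S_k f(y) + O(φ(y))`, and
`φ |S_k f|` is bounded by the mean of `√k φ ^ 2` and `(S_k f) ^ 2 / √k`. -/
theorem VarianceBound.exists_integral_abs_birk_le {C : ℝ} (h : VarianceBound Y f C)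
    (hφ : Integrable (fun y => (Y.ret y : ℝ) ^ 2) Y.mB) (hf : Measurable f)
    (hA : ∀ x, |f x| ≤ A) (hA0 : 0 ≤ A) :
    ∃ D : ℝ, 0 ≤ D ∧ ∀ k : ℕ, 0 < k → ∫ x, |Y.birk f k x| ∂m ≤ D * √(k : ℝ) := by
  have hb := Y.measure_base_pos
  set I₂ := ∫ y, (Y.ret y : ℝ) ^ 2 ∂Y.mB
  have hI : 0 ≤ I₂ := integral_nonneg fun _ => sq_nonneg _
  have hC := h.nonneg
  set C₃ := 2 * C + 4 * A ^ 2 * (C + (m.real Y.base)⁻¹)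
  have hC₃ : 0 ≤ C₃ := by positivity
  refine ⟨I₂ / 2 + C₃ + 2 * A * I₂, by positivity, fun k hk => ?_⟩
  have hk1 : (1 : ℝ) ≤ k := by exact_mod_cast hk
  set r := √(k : ℝ)
  have hr : 1 ≤ r := Real.one_le_sqrt.2 hk1
  have hrk : r ^ 2 = k := Real.sq_sqrt (by positivity)
  have hSm := measurable_birk_base (Y := Y) hf k
  have hbd : ∀ x, ‖|Y.birk f k x|‖ ≤ k * A := fun x => by
    rw [norm_abs_eq_norm]; exact Y.abs_birk_le hA k x
  have e := Y.integral_tower (F := fun x => |Y.birk f k x|) (measurable_birk hf k).abs hbd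
  rw [e]
  have iS : Integrable (fun x : Y.base => Y.birk f k x ^ 2) Y.mB := by
    refine Integrable.of_bound (hSm.pow_const 2).aestronglyMeasurable ((k * A) ^ 2)
      (ae_of_all _ fun x => ?_)
    rw [Real.norm_of_nonneg (sq_nonneg _)]
    have := abs_le.1 (Y.abs_birk_le hA k (x : X))
    exact sq_le_sq' this.1 this.2
  have i1 : Integrable (fun y => (r / 2 + 2 * A) * (Y.ret y : ℝ) ^ 2) Y.mB := hφ.const_mul _
  have i2 : Integrable (fun y : Y.base => (2 * r)⁻¹ * Y.birk f k y ^ 2) Y.mB := iS.const_mul _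
  have hle : ∀ y : Y.base, ∑ j ∈ Finset.range (Y.ret y), |Y.birk f k (Y.T^[j] y)| ≤
      (r / 2 + 2 * A) * (Y.ret y : ℝ) ^ 2 + (2 * r)⁻¹ * Y.birk f k y ^ 2 := by
    intro y
    have h1 : ∀ j ∈ Finset.range (Y.ret y), |Y.birk f k (Y.T^[j] y)| ≤
        |Y.birk f k y| + 2 * Y.ret y * A := by
      intro j hj
      have h2 := Y.abs_birk_iterate_sub_le hA k j (y : X)
      have h3 := abs_sub_abs_le_abs_sub (Y.birk f k (Y.T^[j] y)) (Y.birk f k y)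
      have h4 : (j : ℝ) ≤ Y.ret y := by exact_mod_cast (Finset.mem_range.1 hj).le
      have h5 : 2 * (j : ℝ) * A ≤ 2 * Y.ret y * A := by gcongr
      linarith
    refine (Finset.sum_le_card_nsmul _ _ _ h1).trans ?_
    rw [Finset.card_range, nsmul_eq_mul]
    have h6 : (Y.ret y : ℝ) * |Y.birk f k y| ≤
        r / 2 * (Y.ret y : ℝ) ^ 2 + (2 * r)⁻¹ * Y.birk f k y ^ 2 := by
      rw [← sq_abs (Y.birk f k y)]
      have h7 : r / 2 * (Y.ret y : ℝ) ^ 2 + (2 * r)⁻¹ * |Y.birk f k y| ^ 2 -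
          (Y.ret y : ℝ) * |Y.birk f k y| =
          (2 * r)⁻¹ * (r * Y.ret y - |Y.birk f k y|) ^ 2 := by
        field_simp; ring
      have : 0 ≤ (2 * r)⁻¹ * (r * Y.ret y - |Y.birk f k y|) ^ 2 := by positivity
      linarith
    calc (Y.ret y : ℝ) * (|Y.birk f k y| + 2 * Y.ret y * A)
        = (Y.ret y : ℝ) * |Y.birk f k y| + 2 * A * (Y.ret y : ℝ) ^ 2 := by ring
      _ ≤ _ := by linarith
  refine (integral_mono_of_nonneg (ae_of_all _ fun y => Finset.sum_nonneg fun _ _ => abs_nonneg _)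
    (i1.add i2) (ae_of_all _ hle)).trans ?_
  have e2 : ∫ y : Y.base, ((r / 2 + 2 * A) * (Y.ret y : ℝ) ^ 2 +
      (2 * r)⁻¹ * Y.birk f k y ^ 2) ∂Y.mB =
      (r / 2 + 2 * A) * I₂ + (2 * r)⁻¹ * ∫ y : Y.base, Y.birk f k y ^ 2 ∂Y.mB := by
    rw [integral_add i1 i2, integral_const_mul, integral_const_mul]
  refine e2.le.trans ?_
  have h8 := mul_le_mul_of_nonneg_left (h.integral_birk_sq_le hf hA k)
    (by positivity : 0 ≤ (2 * r)⁻¹)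
  have h9 : (2 * r)⁻¹ * (C₃ * (k + 1)) ≤ C₃ * r := by
    have : (k : ℝ) + 1 ≤ 2 * r * r := by nlinarith
    calc (2 * r)⁻¹ * (C₃ * (k + 1)) ≤ (2 * r)⁻¹ * (C₃ * (2 * r * r)) := by gcongr
      _ = C₃ * r := by field_simp
  have h10 : 2 * A * I₂ ≤ 2 * A * I₂ * r := le_mul_of_one_le_right (by positivity) hr
  linarith

end YoungTower

/-! ### The central limit theorem for the tower -/

namespace YoungTower

open TowerMap

variable {X I : Type*} [MeasurableSpace X] {m : Measure X} [IsProbabilityMeasure m] [Countable I]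
  {Y : YoungTower m I} {ν A : ℝ} {f : X → ℝ}

theorem integral_base_le {F : X → ℝ} (hF : Integrable F m) (h0 : ∀ x, 0 ≤ F x) :
    ∫ x : Y.base, F x ∂Y.mB ≤ ∫ x, F x ∂m := by
  have h := integral_subtype_comap Y.measurableSet_base (μ := m) F
  change ∫ y : Y.base, F y ∂Y.mB = _ at h
  rw [h]
  exact setIntegral_le_integral hF (ae_of_all _ h0)

theorem integrable_birk (hf : Measurable f) (hA : ∀ x, |f x| ≤ A) (n : ℕ) :
    Integrable (Y.birk f n) m :=
  Integrable.of_bound (measurable_birk hf n).aestronglyMeasurable (n * A)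
    (ae_of_all _ fun x => Y.abs_birk_le hA n x)

/-- The expected oscillation of the Birkhoff sums over a window of times. -/
theorem integral_window_le {D : ℝ} (hD : ∀ k : ℕ, 0 < k → ∫ x, |Y.birk f k x| ∂m ≤ D * √(k : ℝ))
    (hf : Measurable f) (hA : ∀ x, |f x| ≤ A) (hA0 : 0 ≤ A) (n q : ℕ) {l : ℕ} (hl : 0 < l) :
    Integrable (fun x : Y.base => ∑ j ∈ Finset.range q, |Y.birk f l (Y.T^[n + j * l] x)| + l * A)
      Y.mB ∧
    ∫ x : Y.base, (∑ j ∈ Finset.range q, |Y.birk f l (Y.T^[n + j * l] x)| + l * A) ∂Y.mB ≤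
      q * (D * √(l : ℝ)) + l * A := by
  have hm : Measurable fun x : X =>
      ∑ j ∈ Finset.range q, |Y.birk f l (Y.T^[n + j * l] x)| + l * A :=
    (Finset.measurable_sum _ fun j _ => ((measurable_birk hf l).comp
      (Y.measurable_iterate _)).abs).add_const _
  have hi : ∀ j, Integrable (fun x => |Y.birk f l (Y.T^[n + j * l] x)|) m := fun j =>
    ((Y.measurePreserving.iterate (n + j * l)).integrable_comp_of_integrable
      (integrable_birk hf hA l)).abs
  have hs : Integrable (fun x => ∑ j ∈ Finset.range q, |Y.birk f l (Y.T^[n + j * l] x)|) m :=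
    integrable_finsetSum _ fun j _ => hi j
  have hbd : ∀ x, |∑ j ∈ Finset.range q, |Y.birk f l (Y.T^[n + j * l] x)| + l * A| ≤
      q * (l * A) + l * A := by
    intro x
    rw [abs_of_nonneg (add_nonneg (Finset.sum_nonneg fun _ _ => abs_nonneg _) (by positivity))]
    refine add_le_add_left ((Finset.sum_le_card_nsmul _ _ (l * A)
      fun j _ => Y.abs_birk_le hA l _).trans ?_) _
    rw [Finset.card_range, nsmul_eq_mul]
  refine ⟨Integrable.of_bound (hm.comp measurable_subtype_coe).aestronglyMeasurable _
    (ae_of_all _ fun x => hbd x), ?_⟩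
  refine (integral_base_le (hs.add (integrable_const _)) fun x => ?_).trans ?_
  · exact add_nonneg (Finset.sum_nonneg fun _ _ => abs_nonneg _) (by positivity)
  · have e : ∫ x, (∑ j ∈ Finset.range q, |Y.birk f l (Y.T^[n + j * l] x)| + l * A) ∂m =
        q * ∫ x, |Y.birk f l x| ∂m + l * A := by
      rw [integral_add hs (integrable_const _), integral_finsetSum _ fun j _ => hi j]
      have : ∀ j ∈ Finset.range q, ∫ x, |Y.birk f l (Y.T^[n + j * l] x)| ∂m =
          ∫ x, |Y.birk f l x| ∂m := by
        intro j _
        have hp := Y.measurePreserving.iterate (n + j * l)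
        have := integral_map (μ := m) hp.measurable.aemeasurable (f := fun x => |Y.birk f l x|)
          (measurable_birk hf l).abs.aestronglyMeasurable
        rw [hp.map_eq] at this
        exact this.symm
      rw [Finset.sum_congr rfl this]
      simp
    exact e.le.trans (add_le_add_left (mul_le_mul_of_nonneg_left (hD l hl) (by positivity)) _)

/-- The characteristic functions of `S_N f` and of `S_{Φ_p} f`, `p = ⌊m(B) N⌋`, are close: the times
`N` and `Φ_p` are within `w` of each other up to a set of measure `O(N / w ^ 2)`, and the
oscillation of the Birkhoff sums on such a window is controlled by blocks of length `l`. -/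
theorem VarianceBound.norm_integral_exp_sub_le {C : ℝ} (h : VarianceBound Y f C) {D : ℝ}
    (hD : ∀ k : ℕ, 0 < k → ∫ x, |Y.birk f k x| ∂m ≤ D * √(k : ℝ))
    (hf : Measurable f) (hA : ∀ x, |f x| ≤ A) (hA0 : 0 ≤ A) (hfB : Measurable (Y.fB f))
    (t : ℝ) (N : ℕ) {w l : ℕ} (hw : 0 < w) (hl : 0 < l) :
    ‖∫ x : Y.base, Complex.exp (Complex.I * t * Y.birk f N x) ∂Y.mB -
      ∫ x, Complex.exp (Complex.I * t * Y.birkB (Y.fB f) ⌊m.real Y.base * N⌋₊ x) ∂Y.mB‖ ≤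
      2 / (w : ℝ) ^ 2 * (2 * (C + (m.real Y.base)⁻¹) * (N + 1)) +
        2 * |t| * ((2 * w / l + 1) * (D * √(l : ℝ)) + l * A) := by
  obtain ⟨i1, h1⟩ := h.integral_retSum_sub_sq_le N
  set p := ⌊m.real Y.base * (N : ℝ)⌋₊
  set q := 2 * w / l + 1 with hq
  obtain ⟨i2, h2⟩ := integral_window_le hD hf hA hA0 (N - w) q hl
  set W : X → ℝ := fun x => ∑ j ∈ Finset.range q, |Y.birk f l (Y.T^[N - w + j * l] x)| + l * A
  have hW : ∀ x, 0 ≤ W x := fun x =>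
    add_nonneg (Finset.sum_nonneg fun _ _ => abs_nonneg _) (by positivity)
  have m1 := measurable_birk_base (Y := Y) hf N
  have m2 := measurable_birkB hfB p
  have e1 : Integrable (fun x : Y.base => Complex.exp (Complex.I * t * Y.birk f N x)) Y.mB :=
    Integrable.of_bound (Measurable.aestronglyMeasurable (by fun_prop)) 1
      (ae_of_all _ fun x => (norm_exp_I_mul_mul _ _).le)
  have e2 : Integrable (fun x => Complex.exp (Complex.I * t * Y.birkB (Y.fB f) p x)) Y.mB :=
    Integrable.of_bound (Measurable.aestronglyMeasurable (by fun_prop)) 1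
      (ae_of_all _ fun x => (norm_exp_I_mul_mul _ _).le)
  rw [← integral_sub e1 e2]
  have hw0 : (0 : ℝ) < w := by exact_mod_cast hw
  have hl0 : (0 : ℝ) < l := by exact_mod_cast hl
  have hpt : ∀ x : Y.base, ‖Complex.exp (Complex.I * t * Y.birk f N x) -
      Complex.exp (Complex.I * t * Y.birkB (Y.fB f) p x)‖ ≤
      2 / (w : ℝ) ^ 2 * ((Y.retSum p x : ℝ) - N) ^ 2 + 2 * |t| * W x := by
    intro x
    have hWx := hW x
    rw [← Y.birk_retSum f p x]
    by_cases hc : |(Y.retSum p x : ℝ) - N| ≤ w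
    · -- both times lie in the window `[N - w, N - w + q * l]`
      have hc1 : N - w ≤ Y.retSum p x := by
        have : (N : ℝ) ≤ (Y.retSum p x + w : ℕ) := by push_cast; linarith [(abs_le.1 hc).1]
        have : N ≤ Y.retSum p x + w := by exact_mod_cast this
        omega
      have hc2 : Y.retSum p x ≤ N + w := by
        have : (Y.retSum p x : ℝ) ≤ (N + w : ℕ) := by push_cast; linarith [(abs_le.1 hc).2]
        exact_mod_cast this
      have hql : 2 * w ≤ q * l := by
        rw [hq, mul_comm _ l]; exact (Nat.lt_mul_div_succ (2 * w) hl).le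
      have w1 := Y.abs_birk_sub_birk_window_le hA (q := q) hl (Nat.sub_le N w) (by omega) (x : X)
      have w2 := Y.abs_birk_sub_birk_window_le hA (q := q) hl hc1 (by omega) (x : X)
      have w3 : |Y.birk f N x - Y.birk f (Y.retSum p x) x| ≤ 2 * W x := by
        rw [abs_le] at w1 w2 ⊢
        constructor <;> simp only [W] <;> linarith [w1.1, w1.2, w2.1, w2.2]
      have w4 := mul_le_mul_of_nonneg_left w3 (abs_nonneg t)
      have w5 : 0 ≤ 2 / (w : ℝ) ^ 2 * ((Y.retSum p x : ℝ) - N) ^ 2 := by positivity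
      linarith [norm_exp_I_mul_mul_sub_le t (Y.birk f N x) (Y.birk f (Y.retSum p x) x)]
    · rw [not_le] at hc
      have w1 : (w : ℝ) ^ 2 ≤ ((Y.retSum p x : ℝ) - N) ^ 2 := by
        rw [← sq_abs ((Y.retSum p x : ℝ) - N)]
        exact pow_le_pow_left₀ hw0.le hc.le 2
      have w2 : 2 ≤ 2 / (w : ℝ) ^ 2 * ((Y.retSum p x : ℝ) - N) ^ 2 := by
        rw [div_mul_eq_mul_div, le_div_iff₀ (by positivity)]
        linarith
      have w3 := norm_sub_le (Complex.exp (Complex.I * t * Y.birk f N x))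
        (Complex.exp (Complex.I * t * Y.birk f (Y.retSum p x) x))
      rw [norm_exp_I_mul_mul, norm_exp_I_mul_mul] at w3
      have w4 : 0 ≤ 2 * |t| * W x := by positivity
      linarith
  have i3 := i1.const_mul (2 / (w : ℝ) ^ 2)
  have i4 := i2.const_mul (2 * |t|)
  refine (norm_integral_le_of_norm_le (i3.add i4) (ae_of_all _ hpt)).trans ?_
  have e : ∫ x : Y.base, (2 / (w : ℝ) ^ 2 * ((Y.retSum p x : ℝ) - N) ^ 2 + 2 * |t| * W x) ∂Y.mB =
      2 / (w : ℝ) ^ 2 * ∫ x, ((Y.retSum p x : ℝ) - N) ^ 2 ∂Y.mB +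
        2 * |t| * ∫ x : Y.base, W x ∂Y.mB := by
    rw [integral_add i3 i4, integral_const_mul, integral_const_mul]
  refine e.le.trans (add_le_add (mul_le_mul_of_nonneg_left h1 (by positivity))
    (mul_le_mul_of_nonneg_left (h2.trans ?_) (by positivity)))
  have hDl : 0 ≤ D * √(l : ℝ) := (integral_nonneg fun _ => abs_nonneg _).trans (hD l hl)
  have hq' : (q : ℝ) ≤ 2 * w / l + 1 := by
    rw [hq]; push_cast
    have := Nat.cast_div_le (α := ℝ) (m := 2 * w) (n := l)
    push_cast at this
    linarith
  exact add_le_add_left (mul_le_mul_of_nonneg_right hq' hDl) _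

/-- The exponents `3/5` and `2/5` of the window and of the blocks make all the terms of
`norm_integral_exp_sub_le` tend to `0`. -/
theorem VarianceBound.tendsto_integral_exp_sub {C : ℝ} (h : VarianceBound Y f C)
    (hφ : Integrable (fun y => (Y.ret y : ℝ) ^ 2) Y.mB)
    (hf : Measurable f) (hA : ∀ x, |f x| ≤ A) (hA0 : 0 ≤ A) (hfB : Measurable (Y.fB f)) (s : ℝ) :
    Tendsto (fun N : ℕ =>
      ∫ x : Y.base, Complex.exp (Complex.I * (s / √(N : ℝ) : ℝ) * Y.birk f N x) ∂Y.mB -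
      ∫ x, Complex.exp (Complex.I * (s / √(N : ℝ) : ℝ) *
        Y.birkB (Y.fB f) ⌊m.real Y.base * N⌋₊ x) ∂Y.mB) atTop (𝓝 0) := by
  obtain ⟨D, hD0, hD⟩ := h.exists_integral_abs_birk_le hφ hf hA hA0
  have hb := Y.measure_base_pos
  set E := C + (m.real Y.base)⁻¹
  have hE : 0 ≤ E := add_nonneg h.nonneg (inv_pos.2 hb).le
  have hq : Tendsto (fun N : ℕ => ((N : ℝ) ^ (1 / 10 : ℝ))⁻¹) atTop (𝓝 0) :=
    ((tendsto_rpow_atTop (by norm_num)).comp tendsto_natCast_atTop_atTop).inv_tendsto_atTop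
  have hlim : Tendsto (fun N : ℕ => (8 * E + 2 * |s| * (10 * D + 2 * A)) *
      ((N : ℝ) ^ (1 / 10 : ℝ))⁻¹) atTop (𝓝 0) := by
    simpa using hq.const_mul (8 * E + 2 * |s| * (10 * D + 2 * A))
  refine squeeze_zero_norm' ?_ hlim
  filter_upwards [eventually_ge_atTop 1] with N hN
  have hN1 : (1 : ℝ) ≤ N := by exact_mod_cast hN
  -- in terms of `q = N ^ (1 / 10)`, the window is `q ^ 6` and the blocks have length `q ^ 4`
  set q := (N : ℝ) ^ (1 / 10 : ℝ) with hqdef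
  have hq1 : 1 ≤ q := Real.one_le_rpow hN1 (by norm_num)
  have hq0 : 0 < q := by linarith
  have hqN : (N : ℝ) = q ^ 10 := by
    rw [hqdef, ← Real.rpow_natCast, ← Real.rpow_mul (by positivity)]; norm_num
  have hsqrt : √(N : ℝ) = q ^ 5 := by
    rw [hqN, show q ^ 10 = (q ^ 5) ^ 2 by ring, Real.sqrt_sq (by positivity)]
  have hw1 : q ^ 6 ≤ ⌈q ^ 6⌉₊ := Nat.le_ceil _
  have hw2 : (⌈q ^ 6⌉₊ : ℝ) ≤ 2 * q ^ 6 := by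
    have := (Nat.ceil_lt_add_one (by positivity : 0 ≤ q ^ 6)).le
    linarith [one_le_pow₀ hq1 (n := 6)]
  have hl1 : q ^ 4 ≤ ⌈q ^ 4⌉₊ := Nat.le_ceil _
  have hl2 : (⌈q ^ 4⌉₊ : ℝ) ≤ 2 * q ^ 4 := by
    have := (Nat.ceil_lt_add_one (by positivity : 0 ≤ q ^ 4)).le
    linarith [one_le_pow₀ hq1 (n := 4)]
  have hmain := h.norm_integral_exp_sub_le hD hf hA hA0 hfB (s / √(N : ℝ)) N
    (w := ⌈q ^ 6⌉₊) (l := ⌈q ^ 4⌉₊) (Nat.ceil_pos.2 (by positivity))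
    (Nat.ceil_pos.2 (by positivity))
  refine hmain.trans ?_
  set w : ℝ := (⌈q ^ 6⌉₊ : ℝ)
  set l : ℝ := (⌈q ^ 4⌉₊ : ℝ)
  have hs1 : √l ≤ 2 * q ^ 2 := by
    rw [Real.sqrt_le_left (by positivity)]
    nlinarith [pow_pos hq0 4]
  have hs0 : 0 ≤ √l := Real.sqrt_nonneg l
  have hwl : 2 * w / l + 1 ≤ 5 * q ^ 2 := by
    have h3 : 2 * w / l ≤ 2 * (2 * q ^ 6) / q ^ 4 := by gcongr
    have h4 : 2 * (2 * q ^ 6) / q ^ 4 = 4 * q ^ 2 := by field_simp; ring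
    linarith [one_le_pow₀ hq1 (n := 2)]
  have t1 : 2 / w ^ 2 * (2 * E * (N + 1)) ≤ 8 * E * q⁻¹ := by
    have h3 : 2 / w ^ 2 ≤ 2 / (q ^ 6) ^ 2 := by gcongr
    have h4 : 2 * E * ((N : ℝ) + 1) ≤ 4 * E * q ^ 10 := by
      rw [← hqN]; nlinarith
    calc 2 / w ^ 2 * (2 * E * (N + 1)) ≤ 2 / (q ^ 6) ^ 2 * (4 * E * q ^ 10) := by gcongr
      _ = 8 * E * (q⁻¹ * q⁻¹) := by field_simp; ring
      _ ≤ 8 * E * (q⁻¹ * 1) := by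
        gcongr
        exact inv_le_one_of_one_le₀ hq1
      _ = 8 * E * q⁻¹ := by ring
  have t2 : 2 * |s / √(N : ℝ)| * ((2 * w / l + 1) * (D * √l) + l * A) ≤
      2 * |s| * (10 * D + 2 * A) * q⁻¹ := by
    rw [abs_div, hsqrt, abs_of_pos (pow_pos hq0 5)]
    calc 2 * (|s| / q ^ 5) * ((2 * w / l + 1) * (D * √l) + l * A)
        ≤ 2 * (|s| / q ^ 5) * (5 * q ^ 2 * (D * (2 * q ^ 2)) + 2 * q ^ 4 * A) := by gcongr
      _ = 2 * |s| * (10 * D + 2 * A) * q⁻¹ := by field_simp; ring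
  linarith

/-- Replacing `u` by `T̂_B u` changes little the integral of `u` against the oscillating function
`e^{itS_N f}`, as `S_N f ∘ T_B` and `S_N f` differ by a function that does not depend on `N`. -/
theorem norm_integral_mul_exp_sub_transferB_le
    (hφ : Integrable (fun y => (Y.ret y : ℝ) ^ 2) Y.mB) (hf : Measurable f)
    (hA : ∀ x, |f x| ≤ A) {u : Y.base → ℂ} {K : ℝ} (hu : Integrable u Y.mB)
    (huK : ∀ x, ‖u x‖ ≤ K * Y.ret x) (t : ℝ) (N : ℕ) :
    ‖∫ x, u x * Complex.exp (Complex.I * t * Y.birk f N x) ∂Y.mB -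
      ∫ x, Y.transferB u x * Complex.exp (Complex.I * t * Y.birk f N x) ∂Y.mB‖ ≤
      |t| * (2 * A * K * ∫ y, (Y.ret y : ℝ) ^ 2 ∂Y.mB) := by
  have m1 := measurable_birk_base (Y := Y) hf N
  have hT := Y.measurable_TB
  have i1 : Integrable (fun x => u x * Complex.exp (Complex.I * t * Y.birk f N x)) Y.mB :=
    hu.mul_bdd (c := 1) (Measurable.aestronglyMeasurable (by fun_prop))
      (ae_of_all _ fun x => (norm_exp_I_mul_mul _ _).le)
  have m2 : Measurable fun x : Y.base => Y.birk f N (Y.TB x) := m1.comp hT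
  have i2 : Integrable (fun x => u x * Complex.exp (Complex.I * t * Y.birk f N (Y.TB x))) Y.mB :=
    hu.mul_bdd (c := 1) (Measurable.aestronglyMeasurable (by fun_prop))
      (ae_of_all _ fun x => (norm_exp_I_mul_mul _ _).le)
  rw [Y.integral_transferB_mul (v := fun x => Complex.exp (Complex.I * t * Y.birk f N x)) i2,
    ← integral_sub i1 i2]
  refine (norm_integral_le_of_norm_le (hφ.const_mul (|t| * (2 * A * K)))
    (ae_of_all _ fun x => ?_)).trans (le_of_eq (by rw [integral_const_mul]; ring))
  rw [← mul_sub, norm_mul]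
  have h1 := norm_exp_I_mul_mul_sub_le t (Y.birk f N x) (Y.birk f N (Y.TB x))
  have h2 := Y.abs_birk_iterate_sub_le hA N (Y.ret x) (x : X)
  rw [abs_sub_comm] at h2
  have h3 : Y.birk f N (Y.T^[Y.ret x] x) = Y.birk f N (Y.TB x) := by rw [coe_TB]; rfl
  rw [h3] at h2
  have h4 := h1.trans (mul_le_mul_of_nonneg_left h2 (abs_nonneg t))
  refine (mul_le_mul (huK x) h4 (norm_nonneg _) ((norm_nonneg _).trans (huK x))).trans
    (le_of_eq (by ring))

/-- The distribution of `S_N f` under the density `φ` on the base converges together with its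
distribution under the normalized measure of the base: the spectral gap provides a solution `u` of
`T̂_B φ - 1 / m(B) = u - T̂_B u`. -/
theorem tendsto_integral_ret_mul_exp_sub (h0 : 0 ≤ ν) (h1 : ν < 1)
    (hν : Y.BoundedDistortion Y.g ν)
    (hφ : Integrable (fun y => (Y.ret y : ℝ) ^ 2) Y.mB) (hf : Measurable f)
    (hA : ∀ x, |f x| ≤ A) {t : ℕ → ℝ} (ht : Tendsto t atTop (𝓝 0)) :
    Tendsto (fun N : ℕ =>
      ∫ x : Y.base, (Y.ret x : ℂ) * Complex.exp (Complex.I * t N * Y.birk f N x) ∂Y.mB -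
      (((m.real Y.base)⁻¹ : ℝ) : ℂ) *
        ∫ x : Y.base, Complex.exp (Complex.I * t N * Y.birk f N x) ∂Y.mB)
      atTop (𝓝 0) := by
  have hret : Y.RetBound ν 1 fun x => Y.ret x := by
    refine ⟨zero_le_one, fun x => by simp, fun x y hxy => ?_⟩
    have : Y.ret x = Y.ret y := by simp only [ret, hxy]
    rw [this, sub_self, abs_zero]
    exact mul_nonneg (by positivity) (Y.dB_nonneg h0 x y)
  obtain ⟨T, Q, hT, -, hQ, -⟩ := exists_resolvent h0 h1 hν
  obtain ⟨H, hH⟩ := exists_transferB_ofReal h0 h1 hν hret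
  simp only [Complex.ofReal_natCast] at hH
  have hri : Integrable (fun x => (Y.ret x : ℂ)) Y.mB := by
    simpa using Y.integrable_ret.ofReal (𝕜 := ℂ)
  have hHT : Y.transferB (fun x => (Y.ret x : ℂ)) = H := (funext hH).symm
  have hHm : Y.EB H = (((m.real Y.base)⁻¹ : ℝ) : ℂ) := by
    rw [← hHT, EB_transferB hri]
    have := EB_ofReal (Y := Y) (fun x => (Y.ret x : ℝ))
    simp only [Complex.ofReal_natCast] at this
    rw [this, Y.integral_ret, mul_one]
  set c : ℂ := (((m.real Y.base)⁻¹ : ℝ) : ℂ)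
  set u : Y.Holder ν := Q (H - c • Holder.one h0)
  have hu : ∀ x, H x = c + (u x - Y.transferB u x) := by
    intro x
    have h2 : mean h0 h1 (H - c • Holder.one h0) = 0 := by
      rw [map_sub, map_smul, mean_one, mean_apply, hHm, smul_eq_mul, mul_one, sub_self]
    have h3 := congrArg (fun G : Y.Holder ν => G x) (hQ _ h2)
    simp only [Holder.sub_apply, Holder.smul_apply, Holder.one_apply, hT, mul_one] at h3
    rw [h3]; ring
  have hTu : Y.transferB u = T u := (funext (hT u)).symm
  have hlim : Tendsto (fun N => |t N| * (2 * A * 1 * ∫ y, (Y.ret y : ℝ) ^ 2 ∂Y.mB) +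
      |t N| * (2 * A * ‖u‖ * ∫ y, (Y.ret y : ℝ) ^ 2 ∂Y.mB)) atTop (𝓝 0) := by
    have h2 : Tendsto (fun N => |t N|) atTop (𝓝 0) := by simpa using ht.abs
    simpa using (h2.mul_const _).add (h2.mul_const _)
  refine squeeze_zero_norm (fun N => ?_) hlim
  have b1 := norm_integral_mul_exp_sub_transferB_le hφ hf hA (K := 1) hri
    (fun x => by simp) (t N) N
  have b2 := norm_integral_mul_exp_sub_transferB_le hφ hf hA (K := ‖u‖)
    (Holder.integrable h0 h1 u)
    (fun x => (Holder.norm_apply_le u x).trans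
      (le_mul_of_one_le_right (norm_nonneg _) (by exact_mod_cast Y.ret_pos x))) (t N) N
  have m1 := measurable_birk_base (Y := Y) hf N
  have i0 : Integrable (fun x : Y.base => Complex.exp (Complex.I * t N * Y.birk f N x)) Y.mB :=
    Integrable.of_bound (Measurable.aestronglyMeasurable (by fun_prop)) 1
      (ae_of_all _ fun x => (norm_exp_I_mul_mul _ _).le)
  have i1 : ∀ G : Y.Holder ν,
      Integrable (fun x => G x * Complex.exp (Complex.I * t N * Y.birk f N x)) Y.mB := fun G =>
    i0.bdd_mul (c := ‖G‖) (Holder.measurable h0 h1 G).aestronglyMeasurable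
      (ae_of_all _ fun x => Holder.norm_apply_le G x)
  have e : ∫ x, Y.transferB (fun x => (Y.ret x : ℂ)) x *
      Complex.exp (Complex.I * t N * Y.birk f N x) ∂Y.mB =
      c * ∫ x : Y.base, Complex.exp (Complex.I * t N * Y.birk f N x) ∂Y.mB +
      (∫ x, u x * Complex.exp (Complex.I * t N * Y.birk f N x) ∂Y.mB -
        ∫ x, Y.transferB u x * Complex.exp (Complex.I * t N * Y.birk f N x) ∂Y.mB) := by
    have i2 : Integrable (fun x => u x * Complex.exp (Complex.I * t N * Y.birk f N x) -
        T u x * Complex.exp (Complex.I * t N * Y.birk f N x)) Y.mB := (i1 u).sub (i1 (T u))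
    rw [hTu, ← integral_sub (i1 u) (i1 (T u)), ← integral_const_mul,
      ← integral_add (i0.const_mul c) i2]
    congr 1
    ext x
    rw [hHT, hu x, hT]; ring
  refine (le_of_eq ?_).trans ((norm_add_le _ _).trans (add_le_add b1 b2))
  rw [e]
  congr 1
  ring

/-- The integral over the tower is close to the integral over the base with the density `φ`, since
`S_N f` is almost constant on the orbit segments that climb the tower. -/
theorem norm_integral_exp_sub_integral_ret_mul_le
    (hφ : Integrable (fun y => (Y.ret y : ℝ) ^ 2) Y.mB) (hf : Measurable f)
    (hA : ∀ x, |f x| ≤ A) (hA0 : 0 ≤ A) (t : ℝ) (N : ℕ) :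
    ‖∫ x, Complex.exp (Complex.I * t * Y.birk f N x) ∂m -
      ∫ x : Y.base, (Y.ret x : ℂ) * Complex.exp (Complex.I * t * Y.birk f N x) ∂Y.mB‖ ≤
      |t| * (2 * A * ∫ y, (Y.ret y : ℝ) ^ 2 ∂Y.mB) := by
  have m0 := measurable_birk (Y := Y) hf N
  have m1 := measurable_birk_base (Y := Y) hf N
  have mF : Measurable fun x => Complex.exp (Complex.I * t * Y.birk f N x) := by fun_prop
  rw [Y.integral_tower mF (M := 1) fun x => (norm_exp_I_mul_mul _ _).le]
  have hri : Integrable (fun x => (Y.ret x : ℂ)) Y.mB := by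
    simpa using Y.integrable_ret.ofReal (𝕜 := ℂ)
  have i1 : Integrable (fun y : Y.base => ∑ k ∈ Finset.range (Y.ret y),
      Complex.exp (Complex.I * t * Y.birk f N (Y.T^[k] y))) Y.mB := by
    refine Y.integrable_ret.mono' (Y.measurable_sum_ret mF).aestronglyMeasurable
      (ae_of_all _ fun y => (norm_sum_le _ _).trans (le_of_eq ?_))
    simp [norm_exp_I_mul_mul]
  have i2 : Integrable (fun x : Y.base =>
      (Y.ret x : ℂ) * Complex.exp (Complex.I * t * Y.birk f N x)) Y.mB :=
    hri.mul_bdd (c := 1) (Measurable.aestronglyMeasurable (by fun_prop))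
      (ae_of_all _ fun x => (norm_exp_I_mul_mul _ _).le)
  rw [← integral_sub i1 i2]
  refine (norm_integral_le_of_norm_le (hφ.const_mul (|t| * (2 * A)))
    (ae_of_all _ fun y => ?_)).trans (le_of_eq (by rw [integral_const_mul]; ring))
  have e : ∑ k ∈ Finset.range (Y.ret y), Complex.exp (Complex.I * t * Y.birk f N (Y.T^[k] y)) -
      (Y.ret y : ℂ) * Complex.exp (Complex.I * t * Y.birk f N y) =
      ∑ k ∈ Finset.range (Y.ret y), (Complex.exp (Complex.I * t * Y.birk f N (Y.T^[k] y)) -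
        Complex.exp (Complex.I * t * Y.birk f N y)) := by
    rw [Finset.sum_sub_distrib]; simp
  rw [e]
  refine (norm_sum_le _ _).trans ((Finset.sum_le_card_nsmul _ _ (|t| * (2 * Y.ret y * A))
    fun k hk => ?_).trans (le_of_eq ?_))
  · refine (norm_exp_I_mul_mul_sub_le _ _ _).trans (mul_le_mul_of_nonneg_left ?_ (abs_nonneg t))
    refine (Y.abs_birk_iterate_sub_le hA N k (y : X)).trans ?_
    have : (k : ℝ) ≤ Y.ret y := by exact_mod_cast (Finset.mem_range.1 hk).le
    gcongr
  · rw [Finset.card_range, nsmul_eq_mul]; ring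

/-- Convergence of the characteristic functions in the central limit theorem on the tower. -/
theorem tendsto_integral_exp_birk (h0 : 0 ≤ ν) (h1 : ν < 1)
    (hν : Y.BoundedDistortion Y.g ν) (hφ : Integrable (fun y => (Y.ret y : ℝ) ^ 2) Y.mB)
    (hf : Measurable f) (hA : ∀ x, |f x| ≤ A) (hA0 : 0 ≤ A) {M : ℝ}
    (hF : Y.RetBound ν M (Y.fB f)) (hF0 : ∫ x, Y.fB f x ∂Y.mB = 0)
    {a : Y.Holder ν} {α : Y.base → ℝ} (ha : Y.EB a = 0) (hα : ∀ x, a x = (α x : ℂ))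
    (ha' : ∀ x, a x - Y.transferB a x = Y.transferB (fun y => (Y.fB f y : ℂ)) x)
    {s : ℝ} (hs : s ≠ 0) :
    Tendsto (fun N : ℕ => ∫ x, Complex.exp (Complex.I * (s / √(N : ℝ) : ℝ) * Y.birk f N x) ∂m) atTop
      (𝓝 (Complex.exp (-((∫ x, martingalePart (Y.fB f) α x ^ 2 ∂Y.mB : ℝ) : ℂ) * s ^ 2 / 2))) := by
  have hb := Y.measure_base_pos
  obtain ⟨C₁, hC₁, hB₁⟩ := exists_integral_birkB_sq_le h0 h1 hν hφ hF hF0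
  have hR : Y.RetBound ν (1 + (m.real Y.base)⁻¹) fun x => Y.ret x - (m.real Y.base)⁻¹ := by
    have hbi := (inv_pos.2 hb).le
    refine ⟨by positivity, fun x => ?_, fun x y hxy => ?_⟩
    · have hr : (1 : ℝ) ≤ Y.ret x := by exact_mod_cast Y.ret_pos x
      have := le_mul_of_one_le_right hbi hr
      rw [abs_le]; constructor <;> nlinarith
    · have : Y.ret x = Y.ret y := by simp only [ret, hxy]
      rw [this, sub_self, abs_zero]
      exact mul_nonneg (by positivity) (Y.dB_nonneg h0 x y)
  have hR0 : ∫ x, ((Y.ret x : ℝ) - (m.real Y.base)⁻¹) ∂Y.mB = 0 := by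
    rw [integral_sub Y.integrable_ret (integrable_const _), Y.integral_ret, integral_const,
      smul_eq_mul, mB_real_univ, mul_inv_cancel₀ hb.ne', sub_self]
  obtain ⟨C₂, hC₂, hB₂⟩ := exists_integral_birkB_sq_le h0 h1 hν hφ hR hR0
  simp only [birkB_ret_sub] at hB₂
  have hV : VarianceBound Y f (C₁ + C₂) :=
    ⟨by positivity, fun n => (hB₁ n).1,
      fun n => (hB₁ n).2.trans (mul_le_mul_of_nonneg_right (by linarith) (by positivity)),
      fun n => (hB₂ n).1,
      fun n => (hB₂ n).2.trans (mul_le_mul_of_nonneg_right (by linarith) (by positivity))⟩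
  have t1 := tendsto_integral_exp_birkB h0 h1 hν hφ hF hF0 ha hα ha' hs
  have t2 := (hV.tendsto_integral_exp_sub hφ hf hA hA0 (hF.measurable h0 h1) s).add t1
  simp only [sub_add_cancel, zero_add] at t2
  have ht := tendsto_div_sqrt s
  have t3 := (tendsto_integral_ret_mul_exp_sub h0 h1 hν hφ hf hA ht).add
    (t2.const_mul (((m.real Y.base)⁻¹ : ℝ) : ℂ))
  simp only [sub_add_cancel, zero_add] at t3
  have t4 : Tendsto (fun N : ℕ =>
      ∫ x, Complex.exp (Complex.I * (s / √(N : ℝ) : ℝ) * Y.birk f N x) ∂m -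
      ∫ x : Y.base, (Y.ret x : ℂ) *
        Complex.exp (Complex.I * (s / √(N : ℝ) : ℝ) * Y.birk f N x) ∂Y.mB) atTop (𝓝 0) := by
    refine squeeze_zero_norm
      (fun N => norm_integral_exp_sub_integral_ret_mul_le hφ hf hA hA0 _ N) ?_
    have h2 : Tendsto (fun N : ℕ => |s / √(N : ℝ)|) atTop (𝓝 0) := by simpa using ht.abs
    simpa using h2.mul_const _
  have t5 := t4.add t3
  simp only [sub_add_cancel, zero_add] at t5
  have e : (((m.real Y.base)⁻¹ : ℝ) : ℂ) * (m.real Y.base *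
      Complex.exp (-((∫ x, martingalePart (Y.fB f) α x ^ 2 ∂Y.mB : ℝ) : ℂ) * s ^ 2 / 2)) =
      Complex.exp (-((∫ x, martingalePart (Y.fB f) α x ^ 2 ∂Y.mB : ℝ) : ℂ) * s ^ 2 / 2) := by
    have : ((m.real Y.base : ℝ) : ℂ) ≠ 0 := by exact_mod_cast hb.ne'
    push_cast
    field_simp
  rwa [e] at t5

end YoungTower

/-! ### Conclusion -/

namespace YoungTower

open TowerMap

variable {X I : Type*} [MeasurableSpace X] {m : Measure X} [IsProbabilityMeasure m] [Countable I]
  {Y : YoungTower m I} {ν A : ℝ} {f : X → ℝ}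

theorem retBound_fB (hA : ∀ x, |f x| ≤ A) (hA0 : 0 ≤ A) {C : ℝ} (hC0 : 0 ≤ C)
    (hC : ∀ x y, |f x - f y| ≤ C * epow ν (Y.sep x y)) (h0 : 0 ≤ ν) :
    Y.RetBound ν (A + C) (Y.fB f) where
  nonneg := by positivity
  abs_le x := (Y.abs_fB_le hA x).trans
    (mul_le_mul_of_nonneg_right (by linarith) (by positivity))
  abs_sub_le x y hxy := (Y.abs_fB_sub_le hC hxy).trans
    (mul_le_mul_of_nonneg_right (mul_le_mul_of_nonneg_right (by linarith) (by positivity))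
      (Y.dB_nonneg h0 x y))

theorem integral_fB (hf : Measurable f) (hA : ∀ x, |f x| ≤ A) :
    ∫ x, Y.fB f x ∂Y.mB = ∫ x, f x ∂m :=
  (Y.integral_tower hf hA).symm

theorem integral_eq_zero_of_EB {u : Y.base → ℂ} (h : Y.EB u = 0) : ∫ x, u x ∂Y.mB = 0 := by
  rw [EB, mul_eq_zero] at h
  exact h.resolve_left (by exact_mod_cast (inv_pos.2 Y.measure_base_pos).ne')

theorem isResolventSolution_of_poisson (h0 : 0 ≤ ν) {a : Y.Holder ν} (ha : Y.EB a = 0)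
    (ha' : ∀ x, a x - Y.transferB a x = Y.transferB (fun y => (Y.fB f y : ℂ)) x) :
    Y.IsResolventSolution ν f a :=
  ⟨Holder.memCBase h0 a, integral_eq_zero_of_EB ha, ha'⟩

theorem isResolventSolution_unique (h0 : 0 ≤ ν) (h1 : ν < 1) (hν : Y.BoundedDistortion Y.g ν)
    {a : Y.Holder ν} (ha : Y.EB a = 0)
    (ha' : ∀ x, a x - Y.transferB a x = Y.transferB (fun y => (Y.fB f y : ℂ)) x)
    {a' : Y.base → ℂ} (h : Y.IsResolventSolution ν f a') : a' = a := by
  obtain ⟨hC, hz, he⟩ := h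
  obtain ⟨U, hU⟩ := Holder.exists_of_memCBase h0 h1.le hC
  have hUa : (U : Y.base → ℂ) = a' := funext hU
  rw [← hUa] at hz he ⊢
  rw [poisson_unique h0 h1 hν (a := U) (a' := a) (by rw [EB, hz, mul_zero]) ha
    fun x => (he x).trans (ha' x).symm]

/-- The central limit theorem for the tower. -/
theorem tendstoInDistribution_birk {V : ℝ} {σ : ℝ≥0} (hσ : (σ : ℝ) ^ 2 = V) (hf : Measurable f)
    (h : ∀ s : ℝ, s ≠ 0 → Tendsto (fun N : ℕ => ∫ x, Complex.exp (Complex.I * (s / √(N : ℝ) : ℝ) *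
      Y.birk f N x) ∂m) atTop (𝓝 (Complex.exp (-(V : ℂ) * s ^ 2 / 2)))) :
    TendstoInDistribution (fun (n : ℕ) (x : X) => (√(n : ℝ))⁻¹ * Y.birk f n x) atTop
      (id : ℝ → ℝ) (fun _ => m) (gaussianReal 0 (σ ^ 2)) := by
  have hm : ∀ n : ℕ, Measurable fun x : X => (√(n : ℝ))⁻¹ * Y.birk f n x := fun n =>
    (measurable_birk hf n).const_mul _
  refine ⟨fun n => (hm n).aemeasurable, aemeasurable_id, ?_⟩
  refine ProbabilityMeasure.tendsto_iff_tendsto_charFun.2 fun s => ?_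
  change Tendsto (fun n : ℕ => charFun (m.map fun x : X => (√(n : ℝ))⁻¹ * Y.birk f n x) s) atTop
    (𝓝 (charFun ((gaussianReal 0 (σ ^ 2)).map id) s))
  rw [Measure.map_id, charFun_gaussianReal]
  by_cases hs : s = 0
  · subst hs
    have : ∀ n : ℕ, IsProbabilityMeasure (m.map fun x : X => (√(n : ℝ))⁻¹ * Y.birk f n x) :=
      fun n => Measure.isProbabilityMeasure_map (hm n).aemeasurable
    simp
  · have e : Complex.exp (s * ((0 : ℝ) : ℂ) * Complex.I - ((σ ^ 2 : ℝ≥0) : ℝ) * s ^ 2 / 2) =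
        Complex.exp (-(V : ℂ) * s ^ 2 / 2) := by
      rw [← hσ]; congr 1; push_cast; ring
    rw [e]
    refine (h s hs).congr fun n => ?_
    rw [charFun_apply_real, integral_map (hm n).aemeasurable
      (Measurable.aestronglyMeasurable (by fun_prop))]
    congr 1
    ext x
    congr 1
    push_cast
    ring

/-- When the variance vanishes, `F` is the coboundary `α ∘ T_B - α`: the martingale part is
continuous for the separation distance, and every cylinder has positive measure. -/
theorem martingalePart_eq_zero (h0 : 0 < ν) (h1 : ν < 1) {M : ℝ} {F : Y.base → ℝ}
    (hφ : Integrable (fun y => (Y.ret y : ℝ) ^ 2) Y.mB) (hF : Y.RetBound ν M F)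
    {a : Y.Holder ν} {α : Y.base → ℝ} (hα : ∀ x, a x = (α x : ℂ))
    (hV : ∫ x, martingalePart F α x ^ 2 ∂Y.mB = 0) (x : Y.base) : martingalePart F α x = 0 := by
  have hae := (integral_eq_zero_iff_of_nonneg (fun x => sq_nonneg _)
    (integrable_martingalePart_sq h0.le h1 hφ hF hα)).1 hV
  have hαsub : ∀ x y, |α x - α y| ≤ ‖a‖ * Y.dB ν x y := by
    intro x y
    have := Holder.norm_sub_le h0.le a x y
    rwa [hα, hα, ← Complex.ofReal_sub, Complex.norm_real] at this
  have hcont : Y.SepContinuous (fun x => (martingalePart F α x : ℂ)) := by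
    refine Y.sepContinuous_of_col h0.le h1 (q := fun i => M * Y.φ i + ‖a‖ + ‖a‖ * ν⁻¹)
      fun x y hxy => ?_
    rw [Complex.dist_eq, ← Complex.ofReal_sub, Complex.norm_real, Real.norm_eq_abs]
    have b1 := hF.abs_sub_le x y hxy
    have b2 := hαsub x y
    have b3 := hαsub (Y.TB x) (Y.TB y)
    have e : Y.dB ν (Y.TB x) (Y.TB y) = ν⁻¹ * Y.dB ν x y := by
      rw [Y.dB_of_col_eq hxy]; field_simp
    rw [e] at b3
    have e2 : martingalePart F α x - martingalePart F α y =
        (F x - F y) + (α x - α y) - (α (Y.TB x) - α (Y.TB y)) := by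
      simp only [martingalePart]; ring
    rw [e2]
    have b4 := abs_sub ((F x - F y) + (α x - α y)) (α (Y.TB x) - α (Y.TB y))
    have b5 := abs_add_le (F x - F y) (α x - α y)
    have e3 : (M * (Y.φ (Y.col x) : ℝ) + ‖a‖ + ‖a‖ * ν⁻¹) * Y.dB ν x y =
        M * Y.ret x * Y.dB ν x y + ‖a‖ * Y.dB ν x y + ‖a‖ * (ν⁻¹ * Y.dB ν x y) := by
      simp only [ret]; ring
    rw [e3]
    linarith
  have hae' : (fun x => (martingalePart F α x : ℂ)) =ᵐ[Y.mB] 0 := by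
    filter_upwards [hae] with x hx
    have : martingalePart F α x = 0 := by simpa using hx
    simp [this]
  have := SepContinuous.eq_zero_of_ae Y hcont hae' x
  exact_mod_cast this

theorem nonempty_base (Y : YoungTower m I) : Nonempty Y.base := by
  by_contra hne
  rw [not_nonempty_iff] at hne
  have h := Y.measure_base_pos
  rw [← mB_real_univ, Measure.eq_zero_of_isEmpty Y.mB] at h
  simp at h

/-- For a coboundary `F = α ∘ T_B - α`, the function `e^{itα}` is fixed by the perturbed transfer
operator. -/
theorem transferB_exp_of_coboundary (h0 : 0 ≤ ν) (h1 : ν < 1) (hν : Y.BoundedDistortion Y.g ν)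
    {F α : Y.base → ℝ} (hψ : ∀ x, martingalePart F α x = 0) (t : ℝ) :
    (Y.transferB fun y => Complex.exp (Complex.I * t * F y) * Complex.exp (Complex.I * t * α y)) =
      fun x => 1 * Complex.exp (Complex.I * t * α x) := by
  ext x
  have e : (fun y => Complex.exp (Complex.I * t * F y) * Complex.exp (Complex.I * t * α y)) =
      fun y => 1 * Complex.exp (Complex.I * t * α (Y.TB y)) := by
    ext y
    have h := hψ y
    rw [martingalePart, sub_eq_zero] at h
    rw [← Complex.exp_add, one_mul, ← h]
    congr 1
    push_cast; ring
  rw [e, transferB_mul_comp_TB (Y := Y) (fun _ => 1) (fun x => Complex.exp (Complex.I * t * α x)),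
    Y.transferB_one h0 h1 hν]

theorem memCBase_exp (h0 : 0 ≤ ν) {a : Y.Holder ν} {α : Y.base → ℝ} (hα : ∀ x, a x = (α x : ℂ))
    (t : ℝ) : Y.MemCBase ν fun x => Complex.exp (Complex.I * t * α x) := by
  refine ⟨|t| * ‖a‖ + 1, by positivity, fun x y => (norm_exp_I_mul_mul_sub_le _ _ _).trans ?_⟩
  have h := Holder.norm_sub_le h0 a x y
  rw [hα, hα, ← Complex.ofReal_sub, Complex.norm_real, Real.norm_eq_abs] at h
  have h2 := mul_le_mul_of_nonneg_left h (abs_nonneg t)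
  have h3 : 0 ≤ epow ν (Y.sep x y) := Y.dB_nonneg h0 x y
  refine h2.trans ?_
  rw [← mul_assoc]
  exact mul_le_mul_of_nonneg_right (by linarith) h3

/-- The value at `0` has to be checked separately, as `t ^ 2` vanishes there. -/
theorem isEquivalent_sq_of_tendsto {L : ℝ → ℂ} (hL0 : L 0 = 0)
    (h : Tendsto (fun t : ℝ => L t / (t : ℂ) ^ 2) (𝓝[≠] 0) (𝓝 1)) :
    L ~[𝓝 0] fun t : ℝ => (t : ℂ) ^ 2 := by
  have h2 : L ~[𝓝[≠] 0] fun t : ℝ => (t : ℂ) ^ 2 := by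
    refine (isEquivalent_iff_tendsto_one ?_).2 h
    filter_upwards [self_mem_nhdsWithin] with t ht
    exact pow_ne_zero 2 (by exact_mod_cast ht)
  have h3 : (𝓝 (0 : ℝ)) = 𝓝[≠] 0 ⊔ pure 0 := by rw [sup_comm, pure_sup_nhdsNE]
  rw [IsEquivalent, h3]
  exact IsLittleO.sup h2 (isLittleO_pure.2 (by simp [hL0]))

end YoungTower

end

theorem proposition4p4 {X I : Type*} [MeasurableSpace X] [Countable I]
    (m : Measure X) [IsProbabilityMeasure m] (Y : YoungTower m I) (hmix : Y.Mixing)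
    (β : ℝ) (hβ : 2 < β)
    (htail : (fun n : ℕ => m.real {x ∈ Y.base | n < Y.φ (Y.col x)}) =O[atTop]
      (fun n : ℕ => 1 / (n : ℝ) ^ β))
    (τ : ℝ) (hτ0 : 0 < τ) (hτ1 : τ < 1)
    (f : X → ℝ) (hf : Y.MemC τ f) (hf0 : ∫ x, f x ∂m = 0)
    (η : ℝ) (hη0 : 0 < η) (hη1 : η < min (1 / 2) (β - 2))
    (hν : Y.BoundedDistortion Y.g (τ ^ η)) :
    -- the operators `R(1,t)` act on `C_ν(B)`, where `ν = τ ^ η`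
    (∀ (t : ℝ) (u : Y.base → ℂ), Y.MemCBase (τ ^ η) u → Y.MemCBase (τ ^ η) (Y.R1 f t u)) ∧
    -- the variance in the central limit theorem
    ∃ σ : ℝ≥0,
      TendstoInDistribution (fun (n : ℕ) (x : X) => (√(n : ℝ))⁻¹ * Y.birk f n x) atTop
        (id : ℝ → ℝ) (fun _ => m) (gaussianReal 0 (σ ^ 2)) ∧
      -- the function `a` is well defined
      ∃ a : Y.base → ℂ, Y.IsResolventSolution (τ ^ η) f a ∧
        (∀ a', Y.IsResolventSolution (τ ^ η) f a' → a' = a) ∧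
        ∃ lam L : ℝ → ℂ, ∃ ε > 0, ∃ δ > 0,
          -- `lam t` is the unique eigenvalue close to `1`
          (∀ t : ℝ, |t| < δ →
            ‖lam t - 1‖ < ε ∧ Y.IsEigenvalue (τ ^ η) f t (lam t) ∧
            ∀ z : ℂ, ‖z - 1‖ < ε → Y.IsEigenvalue (τ ^ η) f t z → z = lam t) ∧
          (∀ t : ℝ, |t| < δ →
            lam t = 1 - ((σ : ℝ) ^ 2 / (2 * m.real Y.base) : ℝ) * L t) ∧
          (L ~[𝓝 0] fun t : ℝ => (t : ℂ) ^ 2) ∧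
          ((fun t : ℝ => lam t - (Y.EB (fun x => Complex.exp (Complex.I * t * Y.fB f x)) -
              (t : ℂ) ^ 2 * Y.EB (fun x => a x * (Y.fB f x : ℂ)))) =O[𝓝 0]
            fun t : ℝ => t ^ 3) := by
  open YoungTower TowerMap in
  have h0 : 0 < τ ^ η := Real.rpow_pos_of_pos hτ0 η
  have h1 : τ ^ η < 1 := Real.rpow_lt_one hτ0.le hτ1 hη0
  have hτν : τ ≤ τ ^ η := by
    have hη : η ≤ 1 := by linarith [hη1.le.trans (min_le_left _ _)]
    simpa using Real.rpow_le_rpow_of_exponent_ge hτ0 hτ1.le hη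
  have hfm := Y.measurable_of_memC hτ0.le hτ1 hf
  obtain ⟨C, hC0, hC⟩ := hf
  obtain ⟨x₀⟩ : Nonempty X := nonempty_of_isProbabilityMeasure m
  obtain ⟨A, hA0, hA⟩ : ∃ A : ℝ, 0 ≤ A ∧ ∀ x, |f x| ≤ A := by
    refine ⟨|f x₀| + C, by positivity, fun x => ?_⟩
    have e1 := (hC x x₀).trans (mul_le_of_le_one_right hC0.le (epow_le_one hτ0.le hτ1.le _))
    have e2 := abs_sub_abs_le_abs_sub (f x) (f x₀)
    linarith
  have hCν : ∀ x y, |f x - f y| ≤ C * epow (τ ^ η) (Y.sep x y) := fun x y =>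
    (hC x y).trans (mul_le_mul_of_nonneg_left (epow_mono hτ0.le hτν _) hC0.le)
  have hF := retBound_fB hA hA0 hC0.le hCν h0.le
  have hF0 : ∫ x, Y.fB f x ∂Y.mB = 0 := (integral_fB hfm hA).trans hf0
  have hφ := Y.integrable_ret_sq hβ htail
  have hb := Y.measure_base_pos
  generalize τ ^ η = ν at *
  obtain ⟨a, ha, ha'⟩ := exists_poisson h0.le h1 hν hF hF0
  have hα := poisson_real h0.le h1 hν ha ha'
  set α : Y.base → ℝ := fun x => (a x).re
  set V := ∫ x, martingalePart (Y.fB f) α x ^ 2 ∂Y.mB with hVdef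
  have hV : 0 ≤ V := integral_nonneg fun x => sq_nonneg _
  have hσ : ((√V).toNNReal : ℝ) ^ 2 = V := by
    rw [Real.coe_toNNReal _ (Real.sqrt_nonneg V), Real.sq_sqrt hV]
  obtain ⟨ε, hε, δ, hδ, K, w, lam, H⟩ := exists_eigenvalue h0.le h1 hν hφ hF ha ha'
  obtain ⟨K', hlam⟩ : ∃ K' : ℝ, ∀ t : ℝ, |t| < δ →
      ‖lam t - (Y.EB (fun x => Complex.exp (Complex.I * t * Y.fB f x)) -
        (t : ℂ) ^ 2 * Y.EB (fun x => a x * (Y.fB f x : ℂ)))‖ ≤ K' * |t| ^ 3 :=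
    ⟨_, fun t ht => norm_eigenvalue_sub_le h0.le h1 hφ hF (abs_nonneg K) (H t ht).1 (H t ht).2.1
      ((H t ht).2.2.1.trans (mul_le_mul_of_nonneg_right (le_abs_self K) (sq_nonneg t)))⟩
  have hball : ∀ᶠ t : ℝ in 𝓝 0, |t| < δ := by
    filter_upwards [Metric.ball_mem_nhds (0 : ℝ) hδ] with t ht
    simpa using ht
  have hlim := tendsto_eigenvalue_sub_one_div_sq h0.le h1 hν hφ hF hF0 hα ha' (hball.mono hlam)
  have hlam0 : lam 0 = 1 := by
    have := hlam 0 (by simpa using hδ)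
    simpa [EB_const, sub_eq_zero] using this
  refine ⟨fun t u hu => memCBase_transferB_exp h0.le h1 hν hF t hu, (√V).toNNReal,
    tendstoInDistribution_birk hσ hfm fun s hs =>
      tendsto_integral_exp_birk h0.le h1 hν hφ hfm hA hA0 hF hF0 ha hα ha' hs,
    a, isResolventSolution_of_poisson h0.le ha ha',
    fun a' h => isResolventSolution_unique h0.le h1 hν ha ha' h,
    lam, fun t => if V = 0 then (t : ℂ) ^ 2 else 2 * m.real Y.base * (1 - lam t) / V,
    ε, hε, δ, hδ, fun t ht => ⟨(H t ht).2.2.2.1, ?_, ?_⟩, fun t ht => ?_, ?_, ?_⟩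
  · refine ⟨fun x => 1 + w t x, ?_, fun h => ?_, funext (H t ht).2.1⟩
    · have := Holder.memCBase h0.le (Holder.one h0.le + w t)
      convert this using 1
      ext x
      rw [Holder.add_apply, Holder.one_apply]
    · -- `1 + w = 0` would contradict `E_B w = 0`
      have hw : (w t : Y.base → ℂ) = fun _ => -1 := by
        ext x
        have : 1 + w t x = 0 := congrFun h x
        linear_combination this
      have h2 := (H t ht).1
      rw [hw, EB_const] at h2
      norm_num at h2
  · rintro z hz ⟨u, hu, hu0, hzu⟩
    exact (H t ht).2.2.2.2 z u hu hu0 hz hzu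
  · rw [hσ]
    split_ifs with hV0
    · -- without variance, `1` is an eigenvalue of every `R(1,t)`
      have hψ := martingalePart_eq_zero h0 h1 hφ hF hα hV0
      obtain ⟨y₀⟩ := Y.nonempty_base
      have := (H t ht).2.2.2.2 1 _ (memCBase_exp h0.le hα t)
        (fun h => Complex.exp_ne_zero _ (congrFun h y₀)) (by simpa using hε)
        (transferB_exp_of_coboundary h0.le h1 hν hψ t)
      rw [← this, hV0]; simp
    · have e1 : (V : ℂ) ≠ 0 := by exact_mod_cast hV0
      have e2 : ((m.real Y.base : ℝ) : ℂ) ≠ 0 := by exact_mod_cast hb.ne'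
      push_cast
      field_simp
      ring
  · split_ifs with hV0
    · exact IsEquivalent.refl
    · refine isEquivalent_sq_of_tendsto (by simp [hlam0]) ?_
      have e1 : (V : ℂ) ≠ 0 := by exact_mod_cast hV0
      have e2 : ((m.real Y.base : ℝ) : ℂ) ≠ 0 := by exact_mod_cast hb.ne'
      have h2 := hlim.const_mul (-(2 * (m.real Y.base : ℂ) / V))
      have e3 : -(2 * (m.real Y.base : ℂ) / V) * (-(((m.real Y.base)⁻¹ * V : ℝ) : ℂ) / 2) = 1 := by
        push_cast
        field_simp
      rw [← hVdef, e3] at h2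
      refine h2.congr fun t => ?_
      ring
  · refine IsBigO.of_bound K' (hball.mono fun t ht => (hlam t ht).trans (le_of_eq ?_))
    rw [norm_pow, Real.norm_eq_abs]
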